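/- Let $\mu>0$ and let $\sigma:(0,\infty)\to\mathbb R$, with $W(p)=\int_1^p\sigma(z)\,dz$, satisfy the standing assumptions: - (H1) $\sigma$ is locally Lipschitz; - (H2) $\sigma(p)\to-\infty$ as $p\to0+$; - (L1) there are $\alpha,\theta>0$ with $\sigma'(p)\ge\alpha$ for $0<p<\theta$; - (U1) $W$ is strictly convex on $(M,\infty)$ for some $M>0$; - (U2) $\sigma(p)>0$ for all large $p$, and $\int_{p_++1}^\infty \frac{dz}{\sigma(z)}<\infty$, where $p_+$ is the largest root of $\sigma$. Assume moreover: - (C1) $\sigma$ is real analytic on $(0,\infty)$; - (C2) $\sigma$ has precisely two critical points $z_1<z_2$ in $(0,\infty)$, $\sigma''(z_1)\ne0$, $\sigma''(z_2)\neq 0$, and $\sigma(z_2)<\sigma(z_1)$; - (NC3) for some $c\in(\sigma(z_2),\sigma(z_1))$ one has $\frac13\sum_{i=1}^3p_i(c)\ne\mu$, where $p_1(c)\in(0,z_1)$, $p_2(c)\in(z_1,z_2)$, $p_3(c)\in(z_2,\infty)$ are the three roots of $\sigma(p)=c$. Let $X=\{q\in L^2(0,1): q\ge0 \text{ a.e.},\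 \int_0^1q\,dx=\mu\}$ and let $\mathcal E_\mu$ be the set of $\bar p\in L^2(0,1)$ with $\bar p>0$ a.e., $\sigma(\bar p(x))=C$ a.e. for some constant $C\in\mathbb R$, and $\int_0^1\bar p\,dx=\mu$. A *solution* with initial datum $p_0\in X$ is a curve $p\in C([0,\infty);L^2(0,1))$ with $p(\cdot,0)=p_0$ and $\int_0^1p(x,t)\,dx=\mu$ for all $t\geq 0$ such that, for every $T>0$ and for a suitable measurable representative $p(x,t)$ on $(0,1)\times[0,T]$: $p(x,t)>0$ for a.e. $(x,t)$; $\sigma(p(\cdot,t))\in L^1(0,1)$ for a.e. $t\in[0,T]$; for a.e. $x\in(0,1)$, the function $t\mapsto\sigma(p(x,t))-\int_0^1\sigma(p(y,t))\,dy$ belongs to $L^1(\tau,T)$ for all $\tau>0$; and for a.e. $x\in(0,1)$ and all $s,t\in(0,T]$, $$p(x,t)=p(x,s)-\int_s^t\Big(\sigma(p(x,r))-\int_0^1\sigma(p(y,r))\,dy\Big)\,dr.$$ Then for every $p_0\in X$ there is exactly one solution, denoted $T(t)p_0:=p(\cdot,t)$, and there is $\bar p\in\mathcal E_\mu$ such that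 $T(t)p_0\to\bar p$ in $L^2(0,1)$ as $t\to\infty$. -/

import Mathlib

open MeasureTheory Set Filter
open scoped Topology NNReal ENNReal

namespace Viscoelastic

noncomputable section

/-- Lebesgue measure on the interval `(0,1)`. -/
abbrev unitMeasure : Measure ℝ := volume.restrict (Ioo (0 : ℝ) 1)

/-- The Hilbert space `L²(0,1)`. -/
abbrev L2 : Type := Lp ℝ 2 unitMeasure

/-- The stored energy `W(p) = ∫₁ᵖ σ(z) dz` of a stress `σ : (0,∞) → ℝ`. Stresses are represented by
total functions `ℝ → ℝ` of which only the values on `(0,∞)` are constrained. -/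
def storedEnergy (σ : ℝ → ℝ) (p : ℝ) : ℝ := ∫ z in (1 : ℝ)..p, σ z

/-- The standing assumptions on the stress `σ : (0,∞) → ℝ`. -/
structure StandingAssumptions (σ : ℝ → ℝ) : Prop where
  /-- (H1) `σ` is locally Lipschitz on `(0,∞)`. -/
  locallyLipschitz : LocallyLipschitzOn (Ioi 0) σ
  /-- (H2) `σ(p) → -∞` as `p → 0+`. -/
  tendsto_zero : Tendsto σ (𝓝[>] 0) atBot
  /-- (L1) `σ' ≥ α > 0` near `0`. -/
  deriv_lower : ∃ α > 0, ∃ θ > 0, ∀ p ∈ Ioo 0 θ, DifferentiableAt ℝ σ p ∧ α ≤ deriv σ p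
  /-- (U1) `W` is strictly convex for large arguments. -/
  strictConvex_top : ∃ M > 0, StrictConvexOn ℝ (Ioi M) (storedEnergy σ)
  /-- (U2), first half: `σ > 0` for large arguments. -/
  pos_top : ∀ᶠ p in atTop, 0 < σ p
  /-- (U2), second half: `∫ dz / σ(z) < ∞` over `(p₊ + 1, ∞)`, with `p₊` the largest root of `σ`
  (which exists because of the other assumptions). -/
  integrable_top : ∃ pmax : ℝ, IsGreatest {p | 0 < p ∧ σ p = 0} pmax ∧
    IntegrableOn (fun z => 1 / σ z) (Ioi (pmax + 1))

/-- (C2): `σ` has exactly the two critical points `z₁ < z₂` in `(0,∞)`, both are nondegenerate, and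
`σ(z₂) < σ(z₁)`. -/
structure IsCubicLike (σ : ℝ → ℝ) (z₁ z₂ : ℝ) : Prop where
  lt : z₁ < z₂
  critical : {z | 0 < z ∧ deriv σ z = 0} = {z₁, z₂}
  value_lt : σ z₂ < σ z₁
  nondegenerate₁ : iteratedDeriv 2 σ z₁ ≠ 0
  nondegenerate₂ : iteratedDeriv 2 σ z₂ ≠ 0

/-- (NC3): for some `c` strictly between the two critical values, the mean of the three roots
`p₁ ∈ (0,z₁)`, `p₂ ∈ (z₁,z₂)`, `p₃ ∈ (z₂,∞)` of `σ(p) = c` is different from `μ`. -/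
def NC3 (σ : ℝ → ℝ) (z₁ z₂ μ : ℝ) : Prop :=
  ∃ c ∈ Ioo (σ z₂) (σ z₁), ∃ p₁ ∈ Ioo 0 z₁, ∃ p₂ ∈ Ioo z₁ z₂, ∃ p₃ ∈ Ioi z₂,
    σ p₁ = c ∧ σ p₂ = c ∧ σ p₃ = c ∧ (1 / 3) * (p₁ + p₂ + p₃) ≠ μ

/-- The phase space `X = {q ∈ L²(0,1) : q ≥ 0 a.e., ∫₀¹ q dx = μ}`. -/
def phaseSpace (μ : ℝ) : Set L2 :=
  {q | (∀ᵐ x ∂unitMeasure, 0 ≤ q x) ∧ ∫ x, q x ∂unitMeasure = μ}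

/-- The set `E_μ` of equilibria. -/
def equilibria (σ : ℝ → ℝ) (μ : ℝ) : Set L2 :=
  {q | (∀ᵐ x ∂unitMeasure, 0 < q x) ∧ (∃ C : ℝ, ∀ᵐ x ∂unitMeasure, σ (q x) = C) ∧
    ∫ x, q x ∂unitMeasure = μ}

/-- The right-hand side without its sign: `σ(p(x,t)) - ∫₀¹ σ(p(y,t)) dy`. -/
def stressDefect (σ : ℝ → ℝ) (p : ℝ → ℝ → ℝ) (x t : ℝ) : ℝ :=
  σ (p x t) - ∫ y, σ (p y t) ∂unitMeasure

/-- The curve `u : [0,∞) → L²(0,1)`, restricted to `[0,T]`, solves the initial boundary value problem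
`p_t = -σ(p) + ∫₀¹ σ(p) dy`, `p(·,0) = p₀`, `∫₀¹ p(x,t) dx = μ`. The function `p x t` is a pointwise
representative of `u`. -/
structure IsSolutionOn (σ : ℝ → ℝ) (μ : ℝ) (p₀ : L2) (T : ℝ≥0) (u : ℝ≥0 → L2) : Prop where
  continuousOn : ContinuousOn u (Icc 0 T)
  initial : u 0 = p₀
  mass : ∀ t ∈ Icc 0 T, ∫ x, u t x ∂unitMeasure = μ
  equation : ∃ p : ℝ → ℝ → ℝ,
    (∀ t ∈ Icc 0 T, ∀ᵐ x ∂unitMeasure, p x t = u t x) ∧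
    AEStronglyMeasurable (fun z : ℝ × ℝ => p z.1 z.2)
      (unitMeasure.prod (volume.restrict (Icc 0 (T : ℝ)))) ∧
    (∀ᵐ z : ℝ × ℝ ∂(unitMeasure.prod (volume.restrict (Icc 0 (T : ℝ)))), 0 < p z.1 z.2) ∧
    (∀ᵐ t ∂(volume.restrict (Icc 0 (T : ℝ))), Integrable (fun x => σ (p x t)) unitMeasure) ∧
    (∀ᵐ x ∂unitMeasure, ∀ τ > 0, IntegrableOn (stressDefect σ p x) (Ioo τ T)) ∧
    (∀ᵐ x ∂unitMeasure, ∀ s ∈ Ioc 0 (T : ℝ), ∀ t ∈ Ioc 0 (T : ℝ),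
      p x t = p x s - ∫ r in s..t, stressDefect σ p x r)

/-- `u : [0,∞) → L²(0,1)` is a global solution: it is a solution on `[0,T]` for every `T > 0`. -/
def IsSolution (σ : ℝ → ℝ) (μ : ℝ) (p₀ : L2) (u : ℝ≥0 → L2) : Prop :=
  ∀ T : ℝ≥0, 0 < T → IsSolutionOn σ μ p₀ T u

end

end Viscoelastic

open MeasureTheory Set Filter
open scoped Topology NNReal ENNReal BoundedContinuousFunction

namespace Viscoelastic

/-! ### Shape of the stress -/

section

/-! The equation is the `L²` gradient flow of `∫ W(p)` under the constraint of fixed mean. Each `x`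
follows a scalar equation, and all of these share one force, the mean stress `S(t) = ∫ σ(p)`.

Uniqueness. By (C2) and the standing assumptions `σ` increases, decreases and increases again, so `σ
+ K id` is monotone for some `K`. The difference of two solutions has mean zero, so the common force
drops out of the `L²` balance, and squared distances grow at most like `exp (2Kt)`
(`integral_sq_le_exp_mul`).

Existence. For bounded, uniformly positive data the problem is a Lipschitz differential equation in
the bounded continuous functions of a label (`exists_labelFlow`). Integrability of `1/σ` at infinity
brings the largest trajectory down from infinity, and `σ → -∞` at `0` lifts the smallest one, both
at rates independent of the data. Approximating the datum geometrically fast in `L²` therefore gives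
limit trajectories bounded above and away from zero on `[τ, ∞)` (`exists_regularFlow`).

Convergence. The energy is bounded, so the dissipation `∫ (σ(p) - S)²` is integrable in time; being
Lipschitz, it tends to `0`, and `p` is close in the mean to the roots of `σ = S(t)`. The crux is
that `S` converges (`exists_tendsto_meanStress`). Otherwise `S` traverses some interval upwards at
arbitrarily late times. Levels with a single root are impossible, as that root would have to be `μ`
for two different levels. Between the critical values, leaving a branch costs a fixed amount of
dissipation, so the fractions of labels on the three branches are nearly constant during a
traversal. In the limit there are constants `A + B + E = 1` with `A p₁(c) + B p₂(c) + E p₃(c) = μ`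
on an interval of levels, hence by analyticity at all levels between the critical values. As `c`
tends to a critical value, two roots merge at square-root speed while the third moves only linearly,
so the two merging weights agree. All weights are `1/3`, which contradicts (NC3) (`mean_roots_eq`).

Once `S → c`, a trajectory can cross a level `w` with `σ(w) ≠ c` in only one direction at late
times, so it converges; dominated convergence gives the limit in `L²` and shows that it is an
equilibrium. -/

/-- The qualitative shape of a cubic-like stress: strictly increasing on `(0,z₁]`, strictly decreasing
on `[z₁,z₂]`, strictly increasing on `[z₂,∞)`, with limits `-∞` at `0` and `+∞` at `∞`. -/
structure CubicShape (σ : ℝ → ℝ) (z₁ z₂ : ℝ) : Prop where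
  pos : 0 < z₁
  lt : z₁ < z₂
  analytic : AnalyticOnNhd ℝ σ (Ioi 0)
  mono_left : StrictMonoOn σ (Ioc 0 z₁)
  anti : StrictAntiOn σ (Icc z₁ z₂)
  mono_right : StrictMonoOn σ (Ici z₂)
  tendsto_zero : Tendsto σ (𝓝[>] 0) atBot
  tendsto_top : Tendsto σ atTop atTop
  deriv_ne : ∀ z, 0 < z → z ≠ z₁ → z ≠ z₂ → deriv σ z ≠ 0
  deriv_left : deriv σ z₁ = 0
  deriv_right : deriv σ z₂ = 0

/-- A continuous function without zeros on an interval has constant sign there. -/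
lemma pos_or_neg_of_ne_zero {f : ℝ → ℝ} {s : Set ℝ} (hs : s.OrdConnected) (hf : ContinuousOn f s)
    (h : ∀ x ∈ s, f x ≠ 0) : (∀ x ∈ s, 0 < f x) ∨ (∀ x ∈ s, f x < 0) := by
  by_contra! hcon
  obtain ⟨⟨x, hx, hx0⟩, ⟨y, hy, hy0⟩⟩ := hcon
  have := hs.isPreconnected.image f hf
  obtain ⟨z, hz, hz0⟩ := this.ordConnected.out (mem_image_of_mem f hx) (mem_image_of_mem f hy)
    ⟨hx0, hy0⟩
  exact h z hz hz0

lemma not_integrableOn_Ioi_of_le {f : ℝ → ℝ} {a ε : ℝ} (hε : 0 < ε) (h : ∀ᶠ x in atTop, ε ≤ f x) :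
    ¬ IntegrableOn f (Ioi a) := by
  intro hf
  obtain ⟨b, hb⟩ := eventually_atTop.1 h
  have h1 : IntegrableOn f (Ioi (max a b)) := hf.mono_set (Ioi_subset_Ioi (le_max_left _ _))
  have h2 : IntegrableOn (fun _ : ℝ => ε) (Ioi (max a b)) := by
    refine Integrable.mono' h1 aestronglyMeasurable_const ?_
    filter_upwards [self_mem_ae_restrict measurableSet_Ioi] with x hx
    rw [Real.norm_of_nonneg hε.le]
    exact hb x (le_trans (le_max_right _ _) (le_of_lt hx))
  rw [integrableOn_const_iff] at h2
  rcases h2 with h2 | h2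
  · simp at h2; exact hε.ne' h2
  · simp at h2

/-- `σ'` has constant sign between consecutive critical points. (L1) fixes the sign on `(0,z₁)` and
`σ(z₂) < σ(z₁)` fixes it on `(z₁,z₂)`. Beyond `z₂`, if `σ` decreased or merely stayed bounded above,
the positive function `1/σ` would be bounded below at infinity and could not be integrable. -/
theorem cubicShape_of {σ : ℝ → ℝ} {z₁ z₂ : ℝ} (hσ : StandingAssumptions σ)
    (hC1 : AnalyticOnNhd ℝ σ (Ioi 0)) (hC2 : IsCubicLike σ z₁ z₂) : CubicShape σ z₁ z₂ := by
  have hmem : ∀ z, (0 < z ∧ deriv σ z = 0) ↔ (z = z₁ ∨ z = z₂) := fun z => by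
    have := hC2.critical
    rw [Set.ext_iff] at this
    simpa using this z
  have h1 := (hmem z₁).2 (Or.inl rfl)
  have h2 := (hmem z₂).2 (Or.inr rfl)
  have hlt := hC2.lt
  have hne : ∀ z, 0 < z → z ≠ z₁ → z ≠ z₂ → deriv σ z ≠ 0 := fun z hz a b h =>
    ((hmem z).1 ⟨hz, h⟩).elim a b
  have hcont : ContinuousOn σ (Ioi 0) := hC1.continuousOn
  have hdcont : ContinuousOn (deriv σ) (Ioi 0) := hC1.deriv.continuousOn
  have hleft : ∀ x ∈ Ioo 0 z₁, 0 < deriv σ x := by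
    rcases pos_or_neg_of_ne_zero (s := Ioo 0 z₁) ordConnected_Ioo
      (hdcont.mono (fun x hx => hx.1))
      (fun x hx => hne x hx.1 hx.2.ne (hx.2.trans hlt).ne) with h | h
    · exact h
    · obtain ⟨α, hα, θ, hθ, hd⟩ := hσ.deriv_lower
      have hm : 0 < min θ z₁ := lt_min hθ h1.1
      have ha := (hd (min θ z₁ / 2) ⟨by linarith, by linarith [min_le_left θ z₁]⟩).2
      have hb := h (min θ z₁ / 2) ⟨by linarith, by linarith [min_le_right θ z₁]⟩
      linarith
  have hmid : ∀ x ∈ Ioo z₁ z₂, deriv σ x < 0 := by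
    rcases pos_or_neg_of_ne_zero (s := Ioo z₁ z₂) ordConnected_Ioo
      (hdcont.mono (fun x hx => h1.1.trans hx.1))
      (fun x hx => hne x (h1.1.trans hx.1) hx.1.ne' hx.2.ne) with h | h
    · exfalso
      have : StrictMonoOn σ (Icc z₁ z₂) := strictMonoOn_of_deriv_pos (convex_Icc _ _)
        (hcont.mono (fun x hx => h1.1.trans_le hx.1)) (by rw [interior_Icc]; exact h)
      have := this (left_mem_Icc.2 hlt.le) (right_mem_Icc.2 hlt.le) hlt
      linarith [hC2.value_lt]
    · exact h
  obtain ⟨pm, -, hint⟩ := hσ.integrable_top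
  have hright : ∀ x ∈ Ioi z₂, 0 < deriv σ x := by
    rcases pos_or_neg_of_ne_zero (s := Ioi z₂) ordConnected_Ioi
      (hdcont.mono (fun x hx => h2.1.trans hx))
      (fun x hx => hne x (h2.1.trans hx) (hlt.trans hx).ne' (ne_of_gt hx)) with h | h
    · exact h
    · exfalso
      have ha : StrictAntiOn σ (Ici z₂) := strictAntiOn_of_deriv_neg (convex_Ici _)
        (hcont.mono (fun x hx => h2.1.trans_le hx)) (by rw [interior_Ici]; exact h)
      have hev : ∀ᶠ x in atTop, 0 < σ x ∧ σ x ≤ σ z₂ := by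
        filter_upwards [hσ.pos_top, eventually_ge_atTop z₂] with x hx hx2
        exact ⟨hx, ha.antitoneOn self_mem_Ici hx2 hx2⟩
      have hp : 0 < σ z₂ := by
        obtain ⟨x, hx⟩ := hev.exists
        exact hx.1.trans_le hx.2
      refine not_integrableOn_Ioi_of_le (one_div_pos.2 hp) ?_ hint
      filter_upwards [hev] with x hx
      exact one_div_le_one_div_of_le hx.1 hx.2
  have hmr : StrictMonoOn σ (Ici z₂) := strictMonoOn_of_deriv_pos (convex_Ici _)
        (hcont.mono (fun x hx => h2.1.trans_le hx)) (by rw [interior_Ici]; exact hright)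
  have hml : StrictMonoOn σ (Ioc 0 z₁) := strictMonoOn_of_deriv_pos (convex_Ioc _ _)
        (hcont.mono (fun x hx => hx.1)) (by rw [interior_Ioc]; exact hleft)
  have hma : StrictAntiOn σ (Icc z₁ z₂) := strictAntiOn_of_deriv_neg (convex_Icc _ _)
        (hcont.mono (fun x hx => h1.1.trans_le hx.1)) (by rw [interior_Icc]; exact hmid)
  refine ⟨h1.1, hlt, hC1, hml, hma, hmr, hσ.tendsto_zero, ?_, hne, h1.2, h2.2⟩
  rw [tendsto_atTop]
  intro b
  by_contra hb
  have hle : ∀ x, z₂ ≤ x → σ x ≤ b := by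
    intro x hx
    by_contra! hxb
    apply hb
    filter_upwards [eventually_ge_atTop x] with y hy
    exact hxb.le.trans (hmr.monotoneOn hx (hx.trans hy) hy)
  have hev : ∀ᶠ x in atTop, 0 < σ x ∧ σ x ≤ b := by
    filter_upwards [hσ.pos_top, eventually_ge_atTop z₂] with x hx hx2
    exact ⟨hx, hle x hx2⟩
  have hp : 0 < b := by
    obtain ⟨x, hx⟩ := hev.exists
    exact hx.1.trans_le hx.2
  refine not_integrableOn_Ioi_of_le (one_div_pos.2 hp) ?_ hint
  filter_upwards [hev] with x hx
  exact one_div_le_one_div_of_le hx.1 hx.2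

namespace CubicShape

variable {σ : ℝ → ℝ} {z₁ z₂ : ℝ} (h : CubicShape σ z₁ z₂)

include h

lemma pos' : 0 < z₂ := h.pos.trans h.lt

lemma continuousOn : ContinuousOn σ (Ioi 0) := h.analytic.continuousOn

lemma continuousAt {p : ℝ} (hp : 0 < p) : ContinuousAt σ p := h.continuousOn.continuousAt (Ioi_mem_nhds hp)

lemma hasDerivAt {p : ℝ} (hp : 0 < p) : HasDerivAt σ (deriv σ p) p :=
  (h.analytic p hp).differentiableAt.hasDerivAt

lemma continuousOn_deriv : ContinuousOn (deriv σ) (Ioi 0) := h.analytic.deriv.continuousOn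

lemma value_lt : σ z₂ < σ z₁ :=
  h.anti (left_mem_Icc.2 h.lt.le) (right_mem_Icc.2 h.lt.le) h.lt

lemma le_left {p : ℝ} (hp : 0 < p) (hp2 : p ≤ z₂) : σ p ≤ σ z₁ := by
  rcases le_total p z₁ with h1 | h1
  · exact h.mono_left.monotoneOn ⟨hp, h1⟩ ⟨h.pos, le_rfl⟩ h1
  · exact h.anti.antitoneOn (left_mem_Icc.2 h.lt.le) ⟨h1, hp2⟩ h1

lemma right_le {p : ℝ} (hp : z₁ ≤ p) : σ z₂ ≤ σ p := by
  rcases le_total p z₂ with h1 | h1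
  · exact h.anti.antitoneOn ⟨hp, h1⟩ (right_mem_Icc.2 h.lt.le) h1
  · exact h.mono_right.monotoneOn self_mem_Ici h1 h1

/-- `σ(p) ≤ σ(R)` for `p ≤ R` once `R ≥ z₂` and `σ(R) ≥ σ(z₁)`. -/
lemma le_of_le {R p : ℝ} (hR : z₂ ≤ R) (hR1 : σ z₁ ≤ σ R) (hp : 0 < p) (hpR : p ≤ R) : σ p ≤ σ R := by
  rcases le_total p z₂ with h1 | h1
  · exact (h.le_left hp h1).trans hR1
  · exact h.mono_right.monotoneOn h1 hR hpR

/-- `σ(r) ≤ σ(p)` for `r ≤ p` once `r ≤ z₁` and `σ(r) ≤ σ(z₂)`. -/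
lemma le_of_le' {r p : ℝ} (hr : 0 < r) (hr1 : r ≤ z₁) (hr2 : σ r ≤ σ z₂) (hp : r ≤ p) : σ r ≤ σ p := by
  rcases le_total p z₁ with h1 | h1
  · exact h.mono_left.monotoneOn ⟨hr, hr1⟩ ⟨hr.trans_le hp, h1⟩ hp
  · exact hr2.trans (h.right_le h1)

lemma exists_small (b c : ℝ) (hc : 0 < c) : ∃ r, 0 < r ∧ r < c ∧ ∀ p, 0 < p → p ≤ r → σ p ≤ b := by
  have h1 : ∀ᶠ p in 𝓝[>] (0:ℝ), σ p ≤ b := h.tendsto_zero.eventually_le_atBot b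
  rw [eventually_nhdsWithin_iff, Metric.eventually_nhds_iff] at h1
  obtain ⟨ε, hε, hb⟩ := h1
  have hm : 0 < min ε c := lt_min hε hc
  refine ⟨min ε c / 2, by linarith, by linarith [min_le_right ε c], fun p hp hpr => hb ?_ hp⟩
  rw [Real.dist_eq, sub_zero, abs_of_pos hp]
  linarith [min_le_left ε c]

lemma exists_large (b c : ℝ) : ∃ r, c < r ∧ ∀ p, r ≤ p → b ≤ σ p := by
  obtain ⟨r, hr⟩ := eventually_atTop.1 (h.tendsto_top.eventually_ge_atTop b)
  exact ⟨max r (c + 1), by linarith [le_max_right r (c + 1)], fun p hp => hr p ((le_max_left _ _).trans hp)⟩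

/-- `σ + K id` is nondecreasing for a suitable `K`. -/
lemma exists_monotone : ∃ K, 0 ≤ K ∧ ∀ p q, 0 < p → 0 < q → -(K * (p - q) ^ 2) ≤ (σ p - σ q) * (p - q) := by
  -- `σ` decreases only on `[z₁,z₂]`, so a bound for `|σ'|` there serves as `K`.
  obtain ⟨C, hC⟩ := isCompact_Icc.exists_bound_of_continuousOn
    (h.continuousOn_deriv.mono (fun x (hx : x ∈ Icc z₁ z₂) => h.pos.trans_le hx.1))
  have hC0 : 0 ≤ C := (norm_nonneg _).trans (hC z₁ (left_mem_Icc.2 h.lt.le))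
  refine ⟨C, hC0, ?_⟩
  have hdiff : ∀ z ∈ Ioi (0:ℝ), HasDerivAt (fun z => σ z + C * z) (deriv σ z + C) z := fun z hz => by
    simpa using (h.hasDerivAt hz).fun_add ((hasDerivAt_id z).const_mul C)
  have hnn : ∀ z ∈ Ioi (0:ℝ), 0 ≤ deriv σ z + C := by
    intro z hz
    by_cases hz1 : z ∈ Icc z₁ z₂
    · have := hC z hz1
      rw [Real.norm_eq_abs] at this
      linarith [neg_abs_le (deriv σ z)]
    · have : 0 ≤ deriv σ z := by
        rcases lt_or_ge z z₁ with h1 | h1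
        · have hd := (h.hasDerivAt hz).hasDerivWithinAt (s := Ioc 0 z₁)
          rw [← derivWithin_of_mem_nhds (Ioc_mem_nhds hz h1)]
          exact h.mono_left.monotoneOn.derivWithin_nonneg
        · have h2 : z₂ < z := by
            by_contra! h3
            exact hz1 ⟨h1, h3⟩
          rw [← derivWithin_of_mem_nhds (Ici_mem_nhds h2)]
          exact h.mono_right.monotoneOn.derivWithin_nonneg
      linarith
  have hmono : MonotoneOn (fun z => σ z + C * z) (Ioi 0) := by
    refine monotoneOn_of_deriv_nonneg (convex_Ioi 0) (fun z hz => (hdiff z hz).continuousAt.continuousWithinAt) ?_ ?_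
    · rw [interior_Ioi]; exact fun z hz => (hdiff z hz).differentiableAt.differentiableWithinAt
    · rw [interior_Ioi]; intro z hz; rw [(hdiff z hz).deriv]; exact hnn z hz
  intro p q hp hq
  rcases le_total p q with hpq | hpq
  · have := hmono hp hq hpq
    simp only at this
    nlinarith
  · have := hmono hq hp hpq
    simp only at this
    nlinarith

/-- `σ` is Lipschitz on compact subintervals of `(0,∞)`. -/
lemma exists_lipschitz {a b : ℝ} (ha : 0 < a) : ∃ L, 0 ≤ L ∧ ∀ p ∈ Icc a b, ∀ q ∈ Icc a b,
    |σ p - σ q| ≤ L * |p - q| := by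
  obtain ⟨C, hC⟩ := isCompact_Icc.exists_bound_of_continuousOn
    (h.continuousOn_deriv.mono (fun x (hx : x ∈ Icc a b) => ha.trans_le hx.1))
  refine ⟨max C 0, le_max_right _ _, fun p hp q hq => ?_⟩
  have := (convex_Icc a b).norm_image_sub_le_of_norm_hasDerivWithin_le
    (fun x hx => (h.hasDerivAt (ha.trans_le hx.1)).hasDerivWithinAt)
    (fun x hx => (hC x hx).trans (le_max_left C 0)) hq hp
  simpa using this

lemma exists_bound {a b : ℝ} (ha : 0 < a) : ∃ L, 0 ≤ L ∧ ∀ p ∈ Icc a b, |σ p| ≤ L := by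
  obtain ⟨C, hC⟩ := isCompact_Icc.exists_bound_of_continuousOn
    (h.continuousOn.mono (fun x (hx : x ∈ Icc a b) => ha.trans_le hx.1))
  exact ⟨max C 0, le_max_right _ _, fun p hp => (hC p hp).trans (le_max_left _ _)⟩

end CubicShape

end

/-! ### Comparison principles and the contraction estimate -/

section

/-- A function that starts nonpositive and is nonincreasing wherever it is positive stays nonpositive. -/
lemma nonpos_of_deriv_nonpos_of_pos {w w' : ℝ → ℝ} {a b : ℝ} (hc : ContinuousOn w (Icc a b))
    (hd : ∀ t ∈ Ioo a b, HasDerivAt w (w' t) t) (hneg : ∀ t ∈ Ioo a b, 0 < w t → w' t ≤ 0)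
    (ha : w a ≤ 0) : ∀ t ∈ Icc a b, w t ≤ 0 := by
  intro t ht
  by_contra! hpos
  have hsub : Icc a t ⊆ Icc a b := Icc_subset_Icc_right ht.2
  have hcl : IsCompact (Icc a t ∩ w ⁻¹' Iic 0) := by
    have : IsClosed (Icc a t ∩ w ⁻¹' Iic 0) :=
      (hc.mono hsub).preimage_isClosed_of_isClosed isClosed_Icc isClosed_Iic
    exact isCompact_Icc.of_isClosed_subset this inter_subset_left
  -- `s` is the last time up to `t` with `w ≤ 0`; on `(s,t)` the function is positive, hence
  -- nonincreasing, and cannot reach `w t > 0`.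
  obtain ⟨s, ⟨hs, hws⟩, hsmax⟩ := hcl.exists_isGreatest ⟨a, left_mem_Icc.2 ht.1, ha⟩
  simp only [mem_preimage, mem_Iic] at hws
  have hst : s < t := lt_of_le_of_ne hs.2 (fun h => by rw [h] at hws; linarith)
  have hp : ∀ r ∈ Ioo s t, 0 < w r := by
    intro r hr
    by_contra! h
    have := hsmax ⟨⟨hs.1.trans hr.1.le, hr.2.le⟩, h⟩
    linarith [hr.1]
  have hio : ∀ r ∈ Ioo s t, r ∈ Ioo a b := fun r hr => ⟨hs.1.trans_lt hr.1, hr.2.trans_le ht.2⟩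
  have : AntitoneOn w (Icc s t) := by
    refine antitoneOn_of_deriv_nonpos (convex_Icc _ _) (hc.mono (Icc_subset_Icc hs.1 ht.2)) ?_ ?_
    · rw [interior_Icc]
      exact fun r hr => (hd r (hio r hr)).differentiableAt.differentiableWithinAt
    · rw [interior_Icc]
      intro r hr
      rw [(hd r (hio r hr)).deriv]
      exact hneg r (hio r hr) (hp r hr)
  have := this (left_mem_Icc.2 hst.le) (right_mem_Icc.2 hst.le) hst.le
  linarith

/-- Comparison principle: `w' ≤ K w` wherever `w > 0` propagates `w ≤ 0`. -/
lemma nonpos_of_deriv_le_mul {w w' : ℝ → ℝ} {a b K : ℝ} (hc : ContinuousOn w (Icc a b))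
    (hd : ∀ t ∈ Ioo a b, HasDerivAt w (w' t) t) (hneg : ∀ t ∈ Ioo a b, 0 < w t → w' t ≤ K * w t)
    (ha : w a ≤ 0) : ∀ t ∈ Icc a b, w t ≤ 0 := by
  have he : ∀ t, HasDerivAt (fun t => Real.exp (-K * t)) (Real.exp (-K * t) * -K) t := fun t => by
    simpa using ((hasDerivAt_id t).const_mul (-K)).exp
  have := nonpos_of_deriv_nonpos_of_pos (w := fun t => Real.exp (-K * t) * w t)
    (w' := fun t => Real.exp (-K * t) * -K * w t + Real.exp (-K * t) * w' t) (a := a) (b := b)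
    (by fun_prop) (fun t ht => (he t).fun_mul (hd t ht)) (fun t ht hp => by
      have hw : 0 < w t := pos_of_mul_pos_right hp (Real.exp_pos _).le
      have := mul_le_mul_of_nonneg_left (hneg t ht hw) (Real.exp_pos (-K * t)).le
      linarith) (mul_nonpos_of_nonneg_of_nonpos (Real.exp_pos _).le ha)
  intro t ht
  exact nonpos_of_mul_nonpos_right (this t ht) (Real.exp_pos _)

/-- Fundamental theorem of calculus for `e^{-2Kt} f(t)²` with `f` absolutely continuous. -/
lemma exp_mul_sq_eq_integral {f g : ℝ → ℝ} {s t K : ℝ} (hst : s ≤ t)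
    (hg : IntervalIntegrable g volume s t) (hf : ∀ r ∈ Icc s t, f r = f s + ∫ ρ in s..r, g ρ) :
    Real.exp (-(2 * K) * t) * f t ^ 2 - Real.exp (-(2 * K) * s) * f s ^ 2 =
      ∫ r in s..t, Real.exp (-(2 * K) * r) * (2 * f r * g r - 2 * K * f r ^ 2) := by
  set F : ℝ → ℝ := fun r => f s + ∫ ρ in s..r, g ρ with hF
  have hFac : AbsolutelyContinuousOnInterval F s t :=
    (LipschitzOnWith.absolutelyContinuousOnInterval
      (LipschitzWith.const (α := ℝ) (f s)).lipschitzOnWith).add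
      (hg.absolutelyContinuousOnInterval_intervalIntegral left_mem_uIcc)
  have hEac : AbsolutelyContinuousOnInterval (fun r => Real.exp (-(2 * K) * r)) s t := by
    refine ContDiffOn.absolutelyContinuousOnInterval (ContDiff.contDiffOn ?_)
    fun_prop
  have hac := hEac.mul (hFac.mul hFac)
  have h1 := hac.integral_deriv_eq_sub
  have hFt : F t = f t := (hf t (right_mem_Icc.2 hst)).symm
  have hFs : F s = f s := (hf s (left_mem_Icc.2 hst)).symm
  simp only [Pi.mul_apply, hFt, hFs] at h1
  rw [pow_two, pow_two, ← h1]
  apply intervalIntegral.integral_congr_ae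
  filter_upwards [hg.ae_hasDerivAt_integral] with r hr hrm
  have hr' : r ∈ uIcc s t := uIoc_subset_uIcc hrm
  have hd1 : HasDerivAt F (g r) r := (hr hr' s left_mem_uIcc).const_add (f s)
  have hd2 : HasDerivAt (fun r => Real.exp (-(2 * K) * r)) (Real.exp (-(2 * K) * r) * -(2 * K)) r := by
    simpa using ((hasDerivAt_id r).const_mul (-(2 * K))).exp
  have hFr : F r = f r := (hf r (by rwa [uIcc_of_le hst] at hr')).symm
  have := hd2.mul (hd1.mul hd1)
  rw [this.deriv]
  simp only [Pi.mul_apply, hFr]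
  ring

section Contraction

variable {Ω : Type*} [MeasurableSpace Ω] {P : Measure Ω} [IsProbabilityMeasure P]

/-- The `L²` contraction estimate for differences of solutions of a gradient flow whose energy is
`K`-convex and whose constraint force `D` depends on time only. -/
theorem integral_sq_le_exp_mul {f G : Ω → ℝ → ℝ} {D : ℝ → ℝ} {s t K C : ℝ} (hst : s ≤ t)
    (hfm : AEStronglyMeasurable (fun z : Ω × ℝ => f z.1 z.2) (P.prod (volume.restrict (Ioc s t))))
    (hD : IntervalIntegrable D volume s t)
    (hG : ∀ᵐ x ∂P, IntervalIntegrable (G x) volume s t)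
    (heq : ∀ᵐ x ∂P, ∀ r ∈ Icc s t, f x r = f x s - ∫ ρ in s..r, (G x ρ - D ρ))
    (hmono : ∀ᵐ x ∂P, ∀ᵐ r ∂(volume.restrict (Ioc s t)), -(K * f x r ^ 2) ≤ G x r * f x r)
    (hmean : ∀ r ∈ Icc s t, ∫ x, f x r ∂P = 0)
    (hint : ∀ r ∈ Icc s t, Integrable (fun x => f x r) P)
    (hbd : ∀ r ∈ Icc s t, ∫ x, |f x r| ∂P ≤ C)
    (hs : Integrable (fun x => f x s ^ 2) P) (ht : Integrable (fun x => f x t ^ 2) P) :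
    ∫ x, f x t ^ 2 ∂P ≤ Real.exp (2 * K * (t - s)) * ∫ x, f x s ^ 2 ∂P := by
  set w : ℝ → ℝ := fun r => Real.exp (-(2 * K) * r) with hw
  have hwc : Continuous w := by fun_prop
  have hDw : Integrable (fun r => w r * D r) (volume.restrict (Ioc s t)) :=
    (intervalIntegrable_iff_integrableOn_Ioc_of_le hst).1 (hD.continuousOn_mul hwc.continuousOn)
  have hprod : Integrable (fun z : Ω × ℝ => 2 * (f z.1 z.2 * (w z.2 * D z.2)))
      (P.prod (volume.restrict (Ioc s t))) := by
    have hm : AEStronglyMeasurable (fun z : Ω × ℝ => f z.1 z.2 * (w z.2 * D z.2))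
      (P.prod (volume.restrict (Ioc s t))) := hfm.mul hDw.aestronglyMeasurable.comp_snd
    refine Integrable.const_mul ?_ 2
    rw [integrable_prod_iff' hm]
    constructor
    · filter_upwards [self_mem_ae_restrict measurableSet_Ioc] with r hr
      exact (hint r (Ioc_subset_Icc_self hr)).mul_const _
    · refine Integrable.mono' (hDw.norm.const_mul C) hm.norm.prod_swap.integral_prod_right' ?_
      filter_upwards [self_mem_ae_restrict measurableSet_Ioc] with r hr
      rw [Real.norm_of_nonneg (integral_nonneg fun x => norm_nonneg _)]
      simp only [norm_mul]
      rw [integral_mul_const]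
      refine mul_le_mul_of_nonneg_right ?_ (by positivity)
      simpa using hbd r (Ioc_subset_Icc_self hr)
  -- The derivative of `exp(-2Kr) f²` is `exp(-2Kr) (-2fG + 2fD - 2Kf²)`, and `hmono` bounds
  -- everything but the term in `D` by zero.
  have hpt : ∀ᵐ x ∂P, w t * f x t ^ 2 - w s * f x s ^ 2 ≤
      ∫ r, 2 * (f x r * (w r * D r)) ∂(volume.restrict (Ioc s t)) := by
    filter_upwards [hG, heq, hmono, hprod.prod_right_ae] with x hGx hfx hmx hix
    have hgi : IntervalIntegrable (fun r => -(G x r - D r)) volume s t := (hGx.sub hD).neg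
    have hfx' : ∀ r ∈ Icc s t, f x r = f x s + ∫ ρ in s..r, -(G x ρ - D ρ) := by
      intro r hr
      rw [intervalIntegral.integral_neg, hfx r hr, sub_eq_add_neg]
    rw [exp_mul_sq_eq_integral (K := K) hst hgi hfx', intervalIntegral.integral_of_le hst]
    have hfc : ContinuousOn (f x) (uIcc s t) := by
      rw [uIcc_of_le hst]
      have : ContinuousOn (fun r => f x s + ∫ ρ in s..r, -(G x ρ - D ρ)) (Icc s t) := by
        have := intervalIntegral.continuousOn_primitive_interval' hgi left_mem_uIcc
        rw [uIcc_of_le hst] at this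
        fun_prop
      exact this.congr hfx'
    refine integral_mono_ae ?_ hix ?_
    · rw [← IntegrableOn, ← intervalIntegrable_iff_integrableOn_Ioc_of_le hst]
      refine IntervalIntegrable.continuousOn_mul ?_ hwc.continuousOn
      refine IntervalIntegrable.sub ?_ (ContinuousOn.intervalIntegrable (by fun_prop))
      exact hgi.continuousOn_mul (by fun_prop)
    · filter_upwards [hmx] with r hr
      have := Real.exp_pos (-(2 * K) * r)
      simp only [hw]
      nlinarith [mul_le_mul_of_nonneg_left hr this.le]
  -- The constraint force does no work: it is constant in space and `f` has mean zero.
  have hzero : ∫ x, ∫ r, 2 * (f x r * (w r * D r)) ∂(volume.restrict (Ioc s t)) ∂P = 0 := by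
    rw [integral_integral_swap hprod]
    rw [← integral_zero ℝ ℝ (μ := volume.restrict (Ioc s t))]
    refine integral_congr_ae ?_
    filter_upwards [self_mem_ae_restrict measurableSet_Ioc] with r hr
    rw [integral_const_mul, integral_mul_const, hmean r (Ioc_subset_Icc_self hr)]
    simp
  have hfin := integral_mono_ae ((ht.const_mul (w t)).sub (hs.const_mul (w s)))
    hprod.integral_prod_left hpt
  simp only [hzero, Pi.sub_apply] at hfin
  rw [integral_sub (ht.const_mul (w t)) (hs.const_mul (w s)), integral_const_mul,
    integral_const_mul] at hfin
  have e1 : Real.exp (2 * K * t) * w t = 1 := by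
    rw [hw, ← Real.exp_add]; simp
  have e2 : Real.exp (2 * K * t) * w s = Real.exp (2 * K * (t - s)) := by
    rw [hw, ← Real.exp_add]; congr 1; ring
  have := mul_le_mul_of_nonneg_left hfin (Real.exp_pos (2 * K * t)).le
  calc ∫ x, f x t ^ 2 ∂P = (Real.exp (2 * K * t) * w t) * ∫ x, f x t ^ 2 ∂P := by rw [e1, one_mul]
    _ ≤ (Real.exp (2 * K * t) * w s) * ∫ x, f x s ^ 2 ∂P := by linarith
    _ = _ := by rw [e2]

end Contraction

end

/-! ### Uniqueness of solutions -/

section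

instance : IsProbabilityMeasure unitMeasure := ⟨by simp⟩

lemma norm_sq_eq_integral (f : L2) : ‖f‖ ^ 2 = ∫ x, f x ^ 2 ∂unitMeasure := by
  have := real_inner_self_eq_norm_sq f
  rw [← this, L2.inner_def]
  refine integral_congr_ae (Eventually.of_forall fun x => ?_)
  simp [pow_two]

lemma norm_sub_sq_eq_integral {f g : L2} {p q : ℝ → ℝ} (hp : p =ᵐ[unitMeasure] f)
    (hq : q =ᵐ[unitMeasure] g) : ‖f - g‖ ^ 2 = ∫ x, (p x - q x) ^ 2 ∂unitMeasure := by
  rw [norm_sq_eq_integral]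
  refine integral_congr_ae ?_
  filter_upwards [Lp.coeFn_sub f g, hp, hq] with x h1 h2 h3
  rw [h1, h2, h3, Pi.sub_apply]

lemma integrable_coe (f : L2) : Integrable f unitMeasure := (Lp.memLp f).integrable (by norm_num)

lemma integrable_sq_coe (f : L2) : Integrable (fun x => f x ^ 2) unitMeasure := (Lp.memLp f).integrable_sq

/-- The spatial mean of the stress of a solution is locally integrable in time. -/
lemma integrableOn_mean_stress {σ : ℝ → ℝ} (hσ : ContinuousOn σ (Ioi 0)) {μ s T : ℝ} (hμ : 0 < μ)
    (hs : 0 < s) {p : ℝ → ℝ → ℝ} (hmass : ∀ t ∈ Icc s T, ∫ x, p x t ∂unitMeasure = μ)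
    (hi : ∀ᵐ x ∂unitMeasure, ∀ τ > 0, IntegrableOn (stressDefect σ p x) (Ioo τ T))
    (heq : ∀ᵐ x ∂unitMeasure, ∀ s ∈ Ioc 0 T, ∀ t ∈ Ioc 0 T,
      p x t = p x s - ∫ r in s..t, stressDefect σ p x r) :
    IntegrableOn (fun t => ∫ y, σ (p y t) ∂unitMeasure) (Icc s T) := by
  refine LocallyIntegrableOn.integrableOn_isCompact (fun t ht => ?_) isCompact_Icc
  have hsT : s ≤ T := ht.1.trans ht.2
  -- A solution only controls the difference between stress and mean stress. Since the mass is
  -- positive, some label has `p x t > 0`; its stress is continuous near `t`, and subtracting the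
  -- integrable defect leaves the mean.
  obtain ⟨x, hix, hex, hpx⟩ : ∃ x, (∀ τ > 0, IntegrableOn (stressDefect σ p x) (Ioo τ T)) ∧
      (∀ s ∈ Ioc 0 T, ∀ t ∈ Ioc 0 T, p x t = p x s - ∫ r in s..t, stressDefect σ p x r) ∧
      0 < p x t := by
    by_contra! hcon
    have : ∫ x, p x t ∂unitMeasure ≤ 0 := by
      refine integral_nonpos_of_ae ?_
      filter_upwards [hi, heq] with x h1 h2
      exact hcon x h1 h2
    rw [hmass t ht] at this
    linarith
  have hI : IntegrableOn (stressDefect σ p x) (Icc s T) := by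
    rw [integrableOn_Icc_iff_integrableOn_Ioc, integrableOn_Ioc_iff_integrableOn_Ioo]
    exact hix s hs
  have hpc : ContinuousOn (p x) (Icc s T) := by
    have h1 : IntervalIntegrable (stressDefect σ p x) volume s T :=
      (intervalIntegrable_iff_integrableOn_Icc_of_le hsT).2 hI
    have := intervalIntegral.continuousOn_primitive_interval' h1 left_mem_uIcc
    rw [uIcc_of_le hsT] at this
    have h2 : ContinuousOn (fun t => p x s - ∫ r in s..t, stressDefect σ p x r) (Icc s T) := by
      fun_prop
    exact h2.congr fun r hr => hex s ⟨hs, hsT⟩ r ⟨hs.trans_le hr.1, hr.2⟩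
  have hev : ∀ᶠ r in 𝓝[Icc s T] t, 0 < p x r := (hpc t ht).eventually (lt_mem_nhds hpx)
  rw [eventually_nhdsWithin_iff, Metric.eventually_nhds_iff_ball] at hev
  obtain ⟨ε, hε, hball⟩ := hev
  set V := Icc s T ∩ Metric.ball t ε with hV
  have hVn : 𝓝[V] t = 𝓝[Icc s T] t := nhdsWithin_inter_of_mem' (mem_nhdsWithin_of_mem_nhds (Metric.ball_mem_nhds t hε))
  have hσc : ContinuousOn (fun r => σ (p x r)) V :=
    hσ.comp (hpc.mono inter_subset_left) fun r hr => hball r hr.2 hr.1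
  have h1 : IntegrableAtFilter (fun r => σ (p x r)) (𝓝[Icc s T] t) volume := by
    rw [← hVn]
    exact hσc.integrableAt_nhdsWithin (measurableSet_Icc.inter measurableSet_ball)
      ⟨ht, Metric.mem_ball_self hε⟩
  have h2 : IntegrableAtFilter (stressDefect σ p x) (𝓝[Icc s T] t) volume :=
    ⟨Icc s T, self_mem_nhdsWithin, hI⟩
  have := h1.sub h2
  refine this.congr (Eventually.of_forall fun r => ?_)
  simp [stressDefect]

/-- Two solutions diverge at most exponentially in `L²`. -/
theorem IsSolutionOn.norm_sub_le {σ : ℝ → ℝ} {z₁ z₂ μ K : ℝ} (h : CubicShape σ z₁ z₂)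
    (hK : ∀ p q, 0 < p → 0 < q → -(K * (p - q) ^ 2) ≤ (σ p - σ q) * (p - q)) (hμ : 0 < μ)
    {p₀ q₀ : L2} {T : ℝ≥0} {u v : ℝ≥0 → L2} (hu : IsSolutionOn σ μ p₀ T u)
    (hv : IsSolutionOn σ μ q₀ T v) {s t : ℝ≥0} (hs : 0 < s) (hst : s ≤ t) (htT : t ≤ T) :
    ‖u t - v t‖ ^ 2 ≤ Real.exp (2 * K * (t - s)) * ‖u s - v s‖ ^ 2 := by
  obtain ⟨p, hpu, hpm, hppos, -, hpi, hpe⟩ := hu.equation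
  obtain ⟨q, hqv, hqm, hqpos, -, hqi, hqe⟩ := hv.equation
  have hs' : (0:ℝ) < s := hs
  have hst' : (s:ℝ) ≤ t := hst
  have htT' : (t:ℝ) ≤ T := htT
  have hmem : ∀ r : ℝ, r ∈ Icc (s:ℝ) t → ∃ r' : ℝ≥0, r' ∈ Icc 0 T ∧ (r' : ℝ) = r := by
    intro r hr
    lift r to ℝ≥0 using hs'.le.trans hr.1
    exact ⟨r, ⟨zero_le, by exact_mod_cast hr.2.trans htT'⟩, rfl⟩
  have hf : ∀ r : ℝ, r ∈ Icc (s:ℝ) t → ∃ r' : ℝ≥0, r' ∈ Icc 0 T ∧ (r' : ℝ) = r ∧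
      (fun x => p x r - q x r) =ᵐ[unitMeasure] (u r' - v r' : L2) := by
    intro r hr
    obtain ⟨r', hr', rfl⟩ := hmem r hr
    refine ⟨r', hr', rfl, ?_⟩
    filter_upwards [hpu r' hr', hqv r' hr', Lp.coeFn_sub (u r') (v r')] with x h1 h2 h3
    rw [h1, h2, h3, Pi.sub_apply]
  have hpmass : ∀ r ∈ Icc (s:ℝ) T, ∫ x, p x r ∂unitMeasure = μ := by
    intro r hr
    lift r to ℝ≥0 using hs'.le.trans hr.1
    have hr' : r ∈ Icc 0 T := ⟨zero_le, by exact_mod_cast hr.2⟩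
    rw [← hu.mass r hr', integral_congr_ae (hpu r hr')]
  have hqmass : ∀ r ∈ Icc (s:ℝ) T, ∫ x, q x r ∂unitMeasure = μ := by
    intro r hr
    lift r to ℝ≥0 using hs'.le.trans hr.1
    have hr' : r ∈ Icc 0 T := ⟨zero_le, by exact_mod_cast hr.2⟩
    rw [← hv.mass r hr', integral_congr_ae (hqv r hr')]
  have hSp := (integrableOn_mean_stress h.continuousOn hμ hs' hpmass hpi hpe).mono_set
    (Icc_subset_Icc_right htT')
  have hSq := (integrableOn_mean_stress h.continuousOn hμ hs' hqmass hqi hqe).mono_set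
    (Icc_subset_Icc_right htT')
  rw [← intervalIntegrable_iff_integrableOn_Icc_of_le hst'] at hSp hSq
  have hdef : ∀ g : ℝ → ℝ, (∀ τ > 0, IntegrableOn g (Ioo τ T)) → IntervalIntegrable g volume s t := by
    intro g hg
    rw [intervalIntegrable_iff_integrableOn_Ioo_of_le hst']
    exact (hg s hs').mono_set (Ioo_subset_Ioo_right htT')
  have hG : ∀ᵐ x ∂unitMeasure, IntervalIntegrable (fun r => σ (p x r)) volume s t ∧
      IntervalIntegrable (fun r => σ (q x r)) volume s t := by
    filter_upwards [hpi, hqi] with x h1 h2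
    constructor
    · simpa [stressDefect] using (hdef _ h1).add hSp
    · simpa [stressDefect] using (hdef _ h2).add hSq
  have hle : volume.restrict (Ioc (s:ℝ) t) ≤ volume.restrict (Icc 0 (T:ℝ)) :=
    Measure.restrict_mono_set _ (fun r hr => ⟨hs'.le.trans hr.1.le, hr.2.trans htT'⟩)
  have hple : unitMeasure.prod (volume.restrict (Ioc (s:ℝ) t)) ≤
      unitMeasure.prod (volume.restrict (Icc 0 (T:ℝ))) := Measure.prod_mono le_rfl hle
  -- By `|d| ≤ (1 + d²)/2`, a bound `C` on `‖u - v‖²` yields the `L¹` bound `(1 + C)/2` that the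
  -- contraction estimate asks for.
  obtain ⟨C, hC⟩ := (isCompact_Icc (a := (0:ℝ≥0)) (b := T)).exists_bound_of_continuousOn
    ((hu.continuousOn.sub hv.continuousOn).norm.pow 2)
  have key := integral_sq_le_exp_mul (P := unitMeasure) (f := fun x r => p x r - q x r)
    (G := fun x r => σ (p x r) - σ (q x r))
    (D := fun r => ∫ y, σ (p y r) ∂unitMeasure - ∫ y, σ (q y r) ∂unitMeasure)
    (K := K) (C := (1 + C) / 2) hst' ((hpm.sub hqm).mono_measure hple) (hSp.sub hSq)
    (hG.mono fun x hx => hx.1.sub hx.2) ?_ ?_ ?_ ?_ ?_ ?_ ?_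
  · have e : ∀ r : ℝ≥0, r ∈ Icc 0 T → ‖u r - v r‖ ^ 2 = ∫ x, (p x r - q x r) ^ 2 ∂unitMeasure :=
      fun r hr => norm_sub_sq_eq_integral (hpu r hr) (hqv r hr)
    rw [e t ⟨zero_le, htT⟩, e s ⟨zero_le, hst.trans htT⟩]
    exact key
  · filter_upwards [hpe, hqe, hG, hpi, hqi] with x h1 h2 hg h3 h4 r hr
    have hsT : (s:ℝ) ∈ Ioc (0:ℝ) T := ⟨hs', hst'.trans htT'⟩
    have hrT : r ∈ Ioc (0:ℝ) T := ⟨hs'.trans_le hr.1, hr.2.trans htT'⟩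
    have hsub : uIcc (s:ℝ) r ⊆ uIcc (s:ℝ) t := by
      rw [uIcc_of_le hst', uIcc_of_le hr.1]; exact Icc_subset_Icc_right hr.2
    rw [h1 s hsT r hrT, h2 s hsT r hrT]
    have : ∫ ρ in (s:ℝ)..r, (σ (p x ρ) - σ (q x ρ) -
        (∫ y, σ (p y ρ) ∂unitMeasure - ∫ y, σ (q y ρ) ∂unitMeasure)) =
        (∫ ρ in (s:ℝ)..r, stressDefect σ p x ρ) - ∫ ρ in (s:ℝ)..r, stressDefect σ q x ρ := by
      rw [← intervalIntegral.integral_sub ((hdef _ h3).mono_set hsub) ((hdef _ h4).mono_set hsub)]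
      refine intervalIntegral.integral_congr fun ρ _ => ?_
      simp only [stressDefect]
      ring
    rw [this]
    ring
  · have h1 := Measure.ae_ae_of_ae_prod (ae_mono hple hppos)
    have h2 := Measure.ae_ae_of_ae_prod (ae_mono hple hqpos)
    filter_upwards [h1, h2] with x h1 h2
    filter_upwards [h1, h2] with r h1 h2
    exact hK _ _ h1 h2
  · intro r hr
    obtain ⟨r', hr', rfl⟩ := hmem r hr
    rw [integral_sub ((integrable_coe _).congr (EventuallyEq.symm (hpu r' hr')))
      ((integrable_coe _).congr (EventuallyEq.symm (hqv r' hr'))), hpmass _ ⟨hr.1, hr.2.trans htT'⟩,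
      hqmass _ ⟨hr.1, hr.2.trans htT'⟩, sub_self]
  · intro r hr
    obtain ⟨r', hr', rfl, he⟩ := hf r hr
    exact (integrable_coe _).congr he.symm
  · intro r hr
    obtain ⟨r', hr', rfl, he⟩ := hf r hr
    have h1 := hC r' hr'
    simp only [Pi.sub_apply, Pi.pow_apply] at h1
    rw [Real.norm_of_nonneg (by positivity), norm_sq_eq_integral] at h1
    have h2 : ∫ x, |p x r' - q x r'| ∂unitMeasure ≤
        ∫ x, (1 + (u r' - v r' : L2) x ^ 2) / 2 ∂unitMeasure := by
      refine integral_mono_ae ((integrable_coe _).congr he.symm).abs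
        (((integrable_const 1).add (integrable_sq_coe _)).div_const 2) ?_
      filter_upwards [he] with x hx
      rw [hx]
      nlinarith [sq_nonneg (|(u r' - v r' : L2) x| - 1), sq_abs ((u r' - v r' : L2) x)]
    rw [integral_div, integral_add (integrable_const 1) (integrable_sq_coe _)] at h2
    rw [integral_const, probReal_univ, one_smul] at h2
    linarith
  · obtain ⟨r', hr', hr, he⟩ := hf s (left_mem_Icc.2 hst')
    exact (integrable_sq_coe _).congr (he.fun_comp (· ^ 2)).symm
  · obtain ⟨r', hr', hr, he⟩ := hf t (right_mem_Icc.2 hst')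
    exact (integrable_sq_coe _).congr (he.fun_comp (· ^ 2)).symm

/-- Solutions are unique. -/
theorem IsSolution.unique {σ : ℝ → ℝ} {z₁ z₂ μ : ℝ} (h : CubicShape σ z₁ z₂) (hμ : 0 < μ)
    {p₀ : L2} {u v : ℝ≥0 → L2} (hu : IsSolution σ μ p₀ u) (hv : IsSolution σ μ p₀ v) : u = v := by
  obtain ⟨K, hK0, hK⟩ := h.exists_monotone
  funext t
  rcases eq_or_ne t 0 with rfl | ht0
  · rw [(hu 1 one_pos).initial, (hv 1 one_pos).initial]
  have ht : 0 < t := pos_iff_ne_zero.2 ht0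
  have hcu := ((hu t ht).continuousOn.sub (hv t ht).continuousOn).norm.pow 2
  -- The equation is available only for positive times, so the estimate starts at `s > 0`, and the
  -- common datum enters through `L²` continuity as `s → 0`.
  have hlim : Tendsto (fun s : ℝ≥0 => Real.exp (2 * K * t) * ‖u s - v s‖ ^ 2) (𝓝[Ioc 0 t] 0)
      (𝓝 (Real.exp (2 * K * t) * 0)) := by
    refine Tendsto.const_mul _ ?_
    have := (hcu 0 ⟨le_rfl, zero_le⟩).mono_left (nhdsWithin_mono 0 (Ioc_subset_Icc_self (b := t)))
    simpa [Pi.pow_def, (hu t ht).initial, (hv t ht).initial] using this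
  have hne : (𝓝[Ioc (0:ℝ≥0) t] 0).NeBot := by
    rw [← mem_closure_iff_nhdsWithin_neBot, closure_Ioc ht0.symm]
    exact left_mem_Icc.2 ht.le
  have hle : ‖u t - v t‖ ^ 2 ≤ Real.exp (2 * K * t) * 0 := by
    refine ge_of_tendsto hlim ?_
    filter_upwards [self_mem_nhdsWithin] with s hs
    refine ((hu t ht).norm_sub_le h hK hμ (hv t ht) hs.1 hs.2 le_rfl).trans ?_
    refine mul_le_mul_of_nonneg_right (Real.exp_le_exp.2 ?_) (by positivity)
    have := mul_nonneg hK0 s.2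
    have e : ((s:ℝ≥0):ℝ) = s.1 := rfl
    nlinarith
  have h0 : ‖u t - v t‖ = 0 := by
    rw [mul_zero] at hle
    exact pow_eq_zero_iff (two_ne_zero) |>.1 (le_antisymm hle (by positivity))
  exact sub_eq_zero.1 (norm_eq_zero.1 h0)

end

/-! ### Flows with bounded, uniformly positive data -/

section

variable {Ω : Type*} [MeasurableSpace Ω] {P : Measure Ω} [IsProbabilityMeasure P]

/-- A solution of the evolution equation on `[0,T]` with bounded, uniformly positive data `g ∘ p₀`, written as
a flow: `φ y t` is the value at time `t` of the trajectory carrying the label `y`. -/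
structure LabelFlow (σ : ℝ → ℝ) (P : Measure Ω) (p₀ : Ω → ℝ) (μ : ℝ) (g : ℝ → ℝ) (T : ℝ)
    (φ : ℝ → ℝ → ℝ) : Prop where
  initial : ∀ y, φ y 0 = g y
  continuous : Continuous fun z : ℝ × ℝ => φ z.1 z.2
  bounds : ∃ A B, 0 < A ∧ ∀ y, ∀ t ∈ Icc 0 T, φ y t ∈ Icc A B
  deriv : ∀ y, ∀ t ∈ Ioo 0 T,
    HasDerivAt (φ y) (-(σ (φ y t) - ∫ x, σ (φ (p₀ x) t) ∂P)) t
  mass : ∀ t ∈ Icc 0 T, ∫ x, φ (p₀ x) t ∂P = μ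

/-- The global solution of an autonomous differential equation with bounded Lipschitz right-hand side. -/
lemma exists_hasDerivWithinAt_of_bounded {E : Type*} [NormedAddCommGroup E] [NormedSpace ℝ E]
    [CompleteSpace E] {F : E → E} {K L : ℝ≥0} (hK : LipschitzWith K F) (hL : ∀ x, ‖F x‖ ≤ L) (x₀ : E)
    {T : ℝ} (hT : 0 ≤ T) :
    ∃ α : ℝ → E, α 0 = x₀ ∧ ∀ t ∈ Icc 0 T, HasDerivWithinAt α (F (α t)) (Icc 0 T) t := by
  -- A field bounded by `L` moves `x₀` by at most `L T`, so the ball of that radius allows the whole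
  -- interval `[0,T]` at once.
  have hp : IsPicardLindelof (fun _ => F) (tmin := 0) (tmax := T) ⟨0, left_mem_Icc.2 hT⟩ x₀
      (L * T.toNNReal) 0 L K :=
    IsPicardLindelof.of_time_independent (fun x _ => hL x) hK.lipschitzOnWith (by
      simp [hT])
  exact hp.exists_eq_forall_mem_Icc_hasDerivWithinAt₀

/-- Integration of bounded continuous functions against the law of a random variable. -/
noncomputable def meanCLM (P : Measure Ω) [IsProbabilityMeasure P] (p₀ : Ω → ℝ) (hp : Measurable p₀) :
    (ℝ →ᵇ ℝ) →L[ℝ] ℝ :=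
  LinearMap.mkContinuous
    { toFun := fun f => ∫ x, f (p₀ x) ∂P
      map_add' := fun f g => by
        have hi : ∀ f : ℝ →ᵇ ℝ, Integrable (fun x => f (p₀ x)) P := fun f =>
          Integrable.of_bound (f.continuous.measurable.comp hp).aestronglyMeasurable ‖f‖
            (Eventually.of_forall fun x => f.norm_coe_le_norm _)
        exact integral_add (hi f) (hi g)
      map_smul' := fun c f => by
        simpa using integral_const_mul c (fun x => f (p₀ x)) } 1 (fun f => by
    rw [one_mul]
    have := norm_integral_le_of_norm_le_const (μ := P) (f := fun x => f (p₀ x)) (C := ‖f‖)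
      (Eventually.of_forall fun x => f.norm_coe_le_norm _)
    simpa using this)

lemma meanCLM_apply (p₀ : Ω → ℝ) (hp : Measurable p₀) (f : ℝ →ᵇ ℝ) :
    meanCLM P p₀ hp f = ∫ x, f (p₀ x) ∂P := rfl

/-- Existence of label flows. -/
theorem exists_labelFlow {σ : ℝ → ℝ} {z₁ z₂ : ℝ} (h : CubicShape σ z₁ z₂) {p₀ : Ω → ℝ}
    (hp : Measurable p₀) {μ : ℝ} (g : ℝ →ᵇ ℝ) {c : ℝ} (hc : 0 < c) (hg : ∀ y, c ≤ g y)
    (hμ : ∫ x, g (p₀ x) ∂P = μ) {T : ℝ} (hT : 0 < T) :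
    ∃ φ, LabelFlow σ P p₀ μ g T φ := by
  -- `A` and `B` are barriers: `σ A` and `σ B` are the extreme values of `σ` on `[A,B]`. Freezing
  -- `σ` outside `[A,B]` makes it globally bounded and Lipschitz, and the solution will turn out
  -- never to leave `[A,B]`.
  obtain ⟨A, hA0, hAc, hA⟩ := h.exists_small (σ z₂) (min c z₁) (lt_min hc h.pos)
  obtain ⟨B, hBc, hB⟩ := h.exists_large (σ z₁) (max ‖g‖ (max z₂ c))
  have hAB : A ≤ B := by
    have h1 := min_le_left c z₁
    have h2 := (le_max_right z₂ c).trans (le_max_right ‖g‖ (max z₂ c))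
    linarith
  have hA1 : A ≤ z₁ := hAc.le.trans (min_le_right _ _)
  have hB2 : z₂ ≤ B := ((le_max_left z₂ c).trans (le_max_right ‖g‖ _)).trans hBc.le
  have hσA : ∀ p ∈ Icc A B, σ A ≤ σ p := fun p hp => h.le_of_le' hA0 hA1 (hA A hA0 le_rfl) hp.1
  have hσB : ∀ p ∈ Icc A B, σ p ≤ σ B := fun p hp =>
    h.le_of_le hB2 (hB B le_rfl) (hA0.trans_le hp.1) hp.2
  set τ : ℝ → ℝ := fun p => σ (projIcc A B hAB p) with hτ
  obtain ⟨L, hL0, hL⟩ := h.exists_lipschitz (b := B) hA0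
  obtain ⟨C, hC0, hC⟩ := h.exists_bound (b := B) hA0
  have hτlip : LipschitzWith L.toNNReal τ := by
    refine LipschitzWith.of_dist_le_mul fun p q => ?_
    rw [Real.coe_toNNReal _ hL0]
    refine (hL _ (projIcc A B hAB p).2 _ (projIcc A B hAB q).2).trans ?_
    exact mul_le_mul_of_nonneg_left (by simpa [Subtype.dist_eq, Real.dist_eq] using (LipschitzWith.projIcc hAB).dist_le_mul p q) hL0
  set ℓ := meanCLM P p₀ hp with hℓ
  set one : ℝ →ᵇ ℝ := BoundedContinuousFunction.const ℝ 1 with hone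
  -- `Λ f = (mean of f) - f`, so the equation reads `α' = Λ (N α)`. Since `Λ f` always has mean
  -- zero, mass is conserved.
  set Λ : (ℝ →ᵇ ℝ) →L[ℝ] (ℝ →ᵇ ℝ) := ℓ.smulRight one - ContinuousLinearMap.id ℝ _ with hΛ
  set N : (ℝ →ᵇ ℝ) → (ℝ →ᵇ ℝ) := BoundedContinuousFunction.comp τ hτlip with hN
  have hNle : ∀ f, ‖N f‖ ≤ C := fun f =>
    (BoundedContinuousFunction.norm_le hC0).2 fun y => hC _ (projIcc A B hAB (f y)).2
  have hlip : LipschitzWith (‖Λ‖₊ * L.toNNReal) (fun f => Λ (N f)) :=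
    Λ.lipschitz.comp (BoundedContinuousFunction.lipschitz_comp hτlip)
  obtain ⟨α, hα0, hα⟩ := exists_hasDerivWithinAt_of_bounded (L := ‖Λ‖₊ * C.toNNReal) hlip
    (fun f => by
      refine (Λ.le_opNorm _).trans ?_
      rw [NNReal.coe_mul, Real.coe_toNNReal _ hC0, coe_nnnorm]
      exact mul_le_mul_of_nonneg_left (hNle f) (norm_nonneg _)) g hT.le
  have hαc : ContinuousOn α (Icc 0 T) := fun t ht => (hα t ht).continuousWithinAt
  have hΛ_apply : ∀ f y, Λ f y = ℓ f - f y := fun f y => by simp [hΛ, hone]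
  have hℓΛ : ∀ f, ℓ (Λ f) = 0 := fun f => by
    have h1 : ℓ one = 1 := by simp [hℓ, meanCLM_apply, hone]
    simp [hΛ, h1]
  set φ : ℝ → ℝ → ℝ := fun y t => α (projIcc 0 T hT.le t) y with hφ
  have hφα : ∀ y, ∀ t ∈ Icc 0 T, φ y t = α t y := fun y t ht => by
    simp only [hφ, projIcc_of_mem hT.le ht]
  have hφc : Continuous fun z : ℝ × ℝ => φ z.1 z.2 := by
    have h1 : Continuous fun t : ℝ => α (projIcc 0 T hT.le t) :=
      hαc.comp_continuous (continuous_subtype_val.comp continuous_projIcc)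
        (fun t => (projIcc 0 T hT.le t).2)
    exact ((h1.comp continuous_snd).eval continuous_fst)
  have hφd : ∀ y, ∀ t ∈ Ioo 0 T, HasDerivAt (φ y) (-(τ (φ y t) - ∫ x, τ (φ (p₀ x) t) ∂P)) t := by
    intro y t ht
    have ht' := Ioo_subset_Icc_self ht
    have h1 : HasDerivAt α (Λ (N (α t))) t := (hα t ht').hasDerivAt (Icc_mem_nhds ht.1 ht.2)
    have h2 := (BoundedContinuousFunction.evalCLM ℝ y).hasFDerivAt.comp_hasDerivAt t h1
    have h3 : HasDerivAt (φ y) (Λ (N (α t)) y) t := by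
      refine HasDerivAt.congr_of_eventuallyEq h2 ?_
      filter_upwards [Ioo_mem_nhds ht.1 ht.2] with r hr
      rw [hφα y r (Ioo_subset_Icc_self hr)]
      rfl
    convert h3 using 1
    rw [hΛ_apply, neg_sub, hφα y t ht', hℓ, meanCLM_apply]
    congr 1
    refine integral_congr_ae (Eventually.of_forall fun x => ?_)
    simp only [hφα _ t ht']
    rfl
  have hτm : ∀ t, Integrable (fun x => τ (φ (p₀ x) t)) P := fun t =>
    Integrable.of_bound (hτlip.continuous.comp ((hφc.comp (Continuous.prodMk_left t)))
      |>.measurable.comp hp).aestronglyMeasurable C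
      (Eventually.of_forall fun x => hC _ (projIcc A B hAB _).2)
  have hSB : ∀ t, ∫ x, τ (φ (p₀ x) t) ∂P ≤ σ B := fun t => by
    have := integral_mono (hτm t) (integrable_const (σ B)) fun x => hσB _ (projIcc A B hAB _).2
    simpa using this
  have hSA : ∀ t, σ A ≤ ∫ x, τ (φ (p₀ x) t) ∂P := fun t => by
    have := integral_mono (integrable_const (σ A)) (hτm t) fun x => hσA _ (projIcc A B hAB _).2
    simpa using this
  have hφy : ∀ y, Continuous (φ y) := fun y => hφc.comp (Continuous.prodMk_right y)
  have hφ0 : ∀ y, φ y 0 = g y := fun y => by rw [hφα y 0 (left_mem_Icc.2 hT.le), hα0]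
  -- Below `A` the truncated stress equals `σ A`, which is at most the mean, so the trajectory does
  -- not decrease there; symmetrically above `B`.
  have hbd : ∀ y, ∀ t ∈ Icc 0 T, φ y t ∈ Icc A B := by
    intro y t ht
    constructor
    · have := nonpos_of_deriv_nonpos_of_pos (w := fun t => A - φ y t) (a := 0) (b := T)
        (continuous_const.sub (hφy y)).continuousOn (fun t ht => (hφd y t ht).const_sub A)
        (fun t ht hpos => by
          have : τ (φ y t) = σ A := by rw [hτ]; simp only [projIcc_of_le_left hAB (sub_pos.1 hpos).le]
          rw [this, neg_neg]
          linarith [hSA t])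
        (by rw [hφ0]; linarith [hg y, min_le_left c z₁]) t ht
      linarith
    · have := nonpos_of_deriv_nonpos_of_pos (w := fun t => φ y t - B) (a := 0) (b := T)
        ((hφy y).sub continuous_const).continuousOn (fun t ht => (hφd y t ht).sub_const B)
        (fun t ht hpos => by
          have : τ (φ y t) = σ B := by rw [hτ]; simp only [projIcc_of_right_le hAB (sub_pos.1 hpos).le]
          rw [this]
          linarith [hSB t])
        (by
          rw [hφ0]
          have h1 := (le_abs_self (g y)).trans (g.norm_coe_le_norm y)
          linarith [le_max_left ‖g‖ (max z₂ c)]) t ht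
      linarith
  have hτσ : ∀ y, ∀ t ∈ Icc 0 T, τ (φ y t) = σ (φ y t) := fun y t ht => by
    simp only [hτ, projIcc_of_mem hAB (hbd y t ht)]
  refine ⟨φ, hφ0, hφc, ⟨A, B, hA0, hbd⟩, ?_, ?_⟩
  · intro y t ht
    have := hφd y t ht
    simp only [hτσ _ t (Ioo_subset_Icc_self ht)] at this
    exact this
  · intro t ht
    have hconst : ∀ t ∈ Icc 0 T, ℓ (α t) = ℓ (α 0) := by
      refine constant_of_has_deriv_right_zero (ℓ.continuous.comp_continuousOn hαc) fun t ht => ?_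
      have h1 := (ℓ.hasFDerivAt.comp_hasDerivWithinAt t (hα t (Ico_subset_Icc_self ht)))
      rw [hℓΛ] at h1
      exact h1.mono_of_mem_nhdsWithin (Icc_mem_nhdsGE_of_mem ht)
    rw [← hμ, ← meanCLM_apply p₀ hp g, ← hα0, ← hconst t ht]
    exact integral_congr_ae (Eventually.of_forall fun x => hφα _ t ht)

end

/-! ### Universal upper and lower bounds at positive times -/

section

set_option linter.unusedSectionVars false

variable {Ω : Type*} [MeasurableSpace Ω] {P : Measure Ω} [IsProbabilityMeasure P]

namespace LabelFlow

variable {σ : ℝ → ℝ} {z₁ z₂ : ℝ} {p₀ : Ω → ℝ} {μ : ℝ} {g : ℝ → ℝ} {T : ℝ} {φ : ℝ → ℝ → ℝ}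

lemma pos (hφ : LabelFlow σ P p₀ μ g T φ) (y : ℝ) {t : ℝ} (ht : t ∈ Icc 0 T) : 0 < φ y t := by
  obtain ⟨A, B, hA, hb⟩ := hφ.bounds
  exact hA.trans_le (hb y t ht).1

lemma continuous_time (hφ : LabelFlow σ P p₀ μ g T φ) (y : ℝ) : Continuous (φ y) :=
  hφ.continuous.comp (Continuous.prodMk_right y)

lemma measurable_label (hφ : LabelFlow σ P p₀ μ g T φ) (hp : Measurable p₀) (t : ℝ) :
    Measurable fun x => φ (p₀ x) t :=
  (hφ.continuous.comp (Continuous.prodMk_left t)).measurable.comp hp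

lemma integrable (hφ : LabelFlow σ P p₀ μ g T φ) (hp : Measurable p₀) {t : ℝ} (ht : t ∈ Icc 0 T) :
    Integrable (fun x => φ (p₀ x) t) P := by
  obtain ⟨A, B, hA, hb⟩ := hφ.bounds
  refine Integrable.of_bound (hφ.measurable_label hp t).aestronglyMeasurable B
    (Eventually.of_forall fun x => ?_)
  rw [Real.norm_of_nonneg (hφ.pos _ ht).le]
  exact (hb _ t ht).2

lemma measurable_stress (hφ : LabelFlow σ P p₀ μ g T φ) (h : CubicShape σ z₁ z₂) (hp : Measurable p₀)
    {t : ℝ} (ht : t ∈ Icc 0 T) : Measurable fun x => σ (φ (p₀ x) t) := by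
  have hc : Continuous fun y => σ (φ y t) := continuous_iff_continuousAt.2 fun y =>
    ContinuousAt.comp (f := fun y => φ y t) (h.continuousAt (hφ.pos y ht))
      (hφ.continuous.comp (Continuous.prodMk_left t)).continuousAt
  exact hc.measurable.comp hp

lemma integrable_stress (hφ : LabelFlow σ P p₀ μ g T φ) (h : CubicShape σ z₁ z₂) (hp : Measurable p₀)
    {t : ℝ} (ht : t ∈ Icc 0 T) : Integrable (fun x => σ (φ (p₀ x) t)) P := by
  obtain ⟨A, B, hA, hb⟩ := hφ.bounds
  obtain ⟨C, -, hC⟩ := h.exists_bound (b := B) hA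
  exact Integrable.of_bound (hφ.measurable_stress h hp ht).aestronglyMeasurable C
    (Eventually.of_forall fun x => hC _ (hb _ t ht))

/-- Label flows are order preserving. -/
lemma mono (hφ : LabelFlow σ P p₀ μ g T φ) (h : CubicShape σ z₁ z₂) {y y' : ℝ} (hy : g y ≤ g y')
    {t : ℝ} (ht : t ∈ Icc 0 T) : φ y t ≤ φ y' t := by
  obtain ⟨K, hK0, hK⟩ := h.exists_monotone
  have := nonpos_of_deriv_le_mul (w := fun t => φ y t - φ y' t) (a := 0) (b := T) (K := K)
    ((hφ.continuous_time y).sub (hφ.continuous_time y')).continuousOn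
    (fun t ht => (hφ.deriv y t ht).sub (hφ.deriv y' t ht))
    (fun t ht hpos => by
      have h1 := hK _ _ (hφ.pos y (Ioo_subset_Icc_self ht)) (hφ.pos y' (Ioo_subset_Icc_self ht))
      have h2 : -(K * (φ y t - φ y' t)) ≤ σ (φ y t) - σ (φ y' t) := by
        by_contra! hcon
        have := mul_lt_mul_of_pos_right hcon hpos
        nlinarith
      linarith)
    (by simpa [hφ.initial] using hy) t ht
  linarith

end LabelFlow

/-- Label flows come down from infinity at a universal rate. -/
theorem exists_forall_labelFlow_le {σ : ℝ → ℝ} {z₁ z₂ : ℝ} (h : CubicShape σ z₁ z₂)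
    {m : ℝ} (hint : IntegrableOn (fun z => 1 / σ z) (Ioi m)) {p₀ : Ω → ℝ} (hp : Measurable p₀)
    {μ : ℝ} {τ : ℝ} (hτ : 0 < τ) :
    ∃ b, ∀ g T φ, LabelFlow σ P p₀ μ g T φ → (∃ y', ∀ y, g y ≤ g y') →
      ∀ y, ∀ t ∈ Icc τ T, φ y t ≤ b := by
  -- `R ≥ 2μ` makes `σ(M) μ / R` at most half of `σ(M)`, and `R'` makes `σ(R)` at most a quarter of
  -- it, where `M` is the largest trajectory and `M ≥ R'`.
  obtain ⟨R, hR0, hR⟩ := h.exists_large (max (σ z₁) 0) (max (2 * μ) z₂)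
  obtain ⟨R', hR'0, hR'⟩ := h.exists_large (4 * σ R + 1) R
  have hRz : z₂ ≤ R := (le_max_right _ _).trans hR0.le
  have hRμ : 2 * μ ≤ R := (le_max_left _ _).trans hR0.le
  have hRpos : 0 < R := h.pos'.trans_le hRz
  have hσR0 : 0 ≤ σ R := (le_max_right _ _).trans (hR R le_rfl)
  have hσ1 : ∀ p, R ≤ p → σ z₁ ≤ σ p := fun p hp => (le_max_left _ _).trans (hR p hp)
  have hσpos : ∀ p, R' ≤ p → 0 < σ p := fun p hp => by linarith [hR' p hp]
  set a := max m R' with ha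
  have hinta : IntegrableOn (fun z => 1 / σ z) (Ioi a) := hint.mono_set (Ioi_subset_Ioi (le_max_left _ _))
  set G : ℝ → ℝ := fun q => ∫ z in a..q, 1 / σ z with hG
  have hlim : Tendsto G atTop (𝓝 (∫ z in Ioi a, 1 / σ z)) :=
    intervalIntegral_tendsto_integral_Ioi a hinta tendsto_id
  -- With tolerance `τ/8`, the function `G` varies by less than `τ/4` beyond `b₀`.
  obtain ⟨b₀, hb₀⟩ := Metric.tendsto_atTop.1 hlim (τ / 8) (by linarith)
  set b := max b₀ (a + 1) with hb
  have hba : a < b := by linarith [le_max_right b₀ (a + 1)]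
  have hRb : R' ≤ b := (le_max_right m R').trans hba.le
  have hGd : ∀ q, b ≤ q → HasDerivAt G (1 / σ q) q := by
    intro q hq
    have haq : a < q := hba.trans_le hq
    have hcont : ContinuousOn (fun z => 1 / σ z) (Ioi a) := by
      refine ContinuousOn.div continuousOn_const (h.continuousOn.mono fun z hz => ?_) fun z hz => ?_
      · exact hRpos.trans (hR'0.trans ((le_max_right m R').trans_lt hz))
      · exact (hσpos z ((le_max_right m R').trans (le_of_lt hz))).ne'
    refine intervalIntegral.integral_hasDerivAt_right ?_ ?_ (hcont.continuousAt (Ioi_mem_nhds haq))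
    · rw [intervalIntegrable_iff_integrableOn_Ioc_of_le haq.le]
      exact hinta.mono_set Ioc_subset_Ioi_self
    · exact hcont.stronglyMeasurableAtFilter isOpen_Ioi q haq
  refine ⟨b, fun g T φ hφ ⟨y', hy'⟩ y t ht => (hφ.mono h (hy' y) ⟨hτ.le.trans ht.1, ht.2⟩).trans ?_⟩
  have hτT : τ ≤ T := ht.1.trans ht.2
  -- While `M = φ y'` exceeds `b`, every value satisfies `σ(p) ≤ σ(R) + (σ(M)/R) p`. Integration
  -- bounds the mean stress by `σ(R) + σ(M) μ / R ≤ (3/4) σ(M)`.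
  have hM' : ∀ t ∈ Ioo 0 T, b ≤ φ y' t →
      -(σ (φ y' t) - ∫ x, σ (φ (p₀ x) t) ∂P) ≤ -(σ (φ y' t) / 4) := by
    intro t ht hbM
    have ht' := Ioo_subset_Icc_self ht
    have hRM : R' ≤ φ y' t := hRb.trans hbM
    have hσM := hR' _ hRM
    have hS : ∫ x, σ (φ (p₀ x) t) ∂P ≤ ∫ x, (σ R + σ (φ y' t) / R * φ (p₀ x) t) ∂P := by
      refine integral_mono (hφ.integrable_stress h hp ht')
        ((integrable_const _).add ((hφ.integrable hp ht').const_mul _)) fun x => ?_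
      have hpx := hφ.pos (p₀ x) ht'
      have hd : 0 ≤ σ (φ y' t) / R := div_nonneg (hσpos _ hRM).le hRpos.le
      rcases le_total (φ (p₀ x) t) R with h1 | h1
      · have := h.le_of_le hRz (hσ1 R le_rfl) hpx h1
        have := mul_nonneg hd hpx.le
        simp only
        linarith
      · have h2 := h.le_of_le (hRz.trans (hR'0.le.trans hRM)) (hσ1 _ (hR'0.le.trans hRM)) hpx
          (hφ.mono h (hy' (p₀ x)) ht')
        have h3 : σ (φ y' t) / R * R ≤ σ (φ y' t) / R * φ (p₀ x) t := mul_le_mul_of_nonneg_left h1 hd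
        rw [div_mul_cancel₀ _ hRpos.ne'] at h3
        simp only
        linarith
    rw [integral_add (integrable_const _) ((hφ.integrable hp ht').const_mul _), integral_const_mul,
      hφ.mass t ht'] at hS
    simp only [integral_const, probReal_univ, one_smul] at hS
    have h5 : σ (φ y' t) / R * μ ≤ σ (φ y' t) / 2 := by
      rw [div_mul_eq_mul_div, div_le_div_iff₀ hRpos two_pos]
      nlinarith [(hσpos _ hRM)]
    linarith
  have hstay : ∀ s ∈ Icc 0 T, φ y' s ≤ b → ∀ t ∈ Icc s T, φ y' t ≤ b := by
    intro s hs hsb t ht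
    have := nonpos_of_deriv_nonpos_of_pos (w := fun t => φ y' t - b) (a := s) (b := T)
      ((hφ.continuous_time y').sub continuous_const).continuousOn
      (fun t ht => (hφ.deriv y' t ⟨hs.1.trans_lt ht.1, ht.2⟩).sub_const b)
      (fun t ht hpos => by
        have h1 : b ≤ φ y' t := (sub_pos.1 hpos).le
        have := hM' t ⟨hs.1.trans_lt ht.1, ht.2⟩ h1
        linarith [hσpos _ (hRb.trans h1)])
      (by linarith) t ht
    linarith
  by_cases hex : ∃ s ∈ Icc 0 τ, φ y' s ≤ b
  · obtain ⟨s, hs, hsb⟩ := hex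
    exact hstay s ⟨hs.1, hs.2.trans hτT⟩ hsb t ⟨hs.2.trans ht.1, ht.2⟩
  · exfalso
    push Not at hex
    -- If `M` stays above `b` on `[0,τ]`, then `G(M)` falls at rate at least `1/4`, hence by at
    -- least `τ/4` in total, which the choice of `b` forbids.
    have hanti : AntitoneOn (fun t => G (φ y' t) + t / 4) (Icc 0 τ) := by
      have hd : ∀ t ∈ Ioo 0 τ, HasDerivAt (fun t => G (φ y' t) + t / 4)
          (1 / σ (φ y' t) * (-(σ (φ y' t) - ∫ x, σ (φ (p₀ x) t) ∂P)) + 1 / 4) t := fun t ht =>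
        ((hGd _ (hex t (Ioo_subset_Icc_self ht)).le).comp t
          (hφ.deriv y' t ⟨ht.1, ht.2.trans_le hτT⟩)).add ((hasDerivAt_id t).div_const 4)
      refine antitoneOn_of_deriv_nonpos (convex_Icc _ _) ?_ ?_ ?_
      · refine ContinuousOn.add (fun t ht => ?_) (by fun_prop)
        exact ((hGd _ (hex t ht).le).continuousAt.comp
          (hφ.continuous_time y').continuousAt).continuousWithinAt
      · rw [interior_Icc]
        exact fun t ht => (hd t ht).differentiableAt.differentiableWithinAt
      · rw [interior_Icc]
        intro t ht
        rw [(hd t ht).deriv]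
        have h1 := hex t (Ioo_subset_Icc_self ht)
        have h2 := hM' t ⟨ht.1, ht.2.trans_le hτT⟩ h1.le
        have h3 := hσpos _ (hRb.trans h1.le)
        have h4 := mul_le_mul_of_nonneg_left h2 (one_div_pos.2 h3).le
        have h5 : 1 / σ (φ y' t) * -(σ (φ y' t) / 4) = -(1 / 4) := by field_simp
        linarith
    have h1 := hanti (left_mem_Icc.2 hτ.le) (right_mem_Icc.2 hτ.le) hτ.le
    have h2 := hb₀ (φ y' 0) ((le_max_left _ _).trans (hex 0 (left_mem_Icc.2 hτ.le)).le)
    have h3 := hb₀ (φ y' τ) ((le_max_left _ _).trans (hex τ (right_mem_Icc.2 hτ.le)).le)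
    rw [Real.dist_eq, abs_lt] at h2 h3
    simp only at h1
    linarith

/-- Label flows become uniformly positive at a universal rate. -/
theorem exists_forall_le_labelFlow {σ : ℝ → ℝ} {z₁ z₂ : ℝ} (h : CubicShape σ z₁ z₂)
    {m : ℝ} (hint : IntegrableOn (fun z => 1 / σ z) (Ioi m)) {p₀ : Ω → ℝ} (hp : Measurable p₀)
    {μ : ℝ} (hμ : 0 < μ) {τ : ℝ} (hτ : 0 < τ) :
    ∃ a, 0 < a ∧ ∀ g T φ, LabelFlow σ P p₀ μ g T φ → (∃ y', ∀ y, g y ≤ g y') →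
      (∃ y', ∀ y, g y' ≤ g y) → ∀ y, ∀ t ∈ Icc τ T, a ≤ φ y t := by
  -- The upper bound is spent on `[0, τ/2]`; the rise of the smallest trajectory takes place in
  -- `[τ/2, τ]`.
  obtain ⟨b₀, hb₀⟩ := exists_forall_labelFlow_le (P := P) (μ := μ) h hint hp (half_pos hτ)
  set b := max b₀ 1
  have hb1 : 1 ≤ b := le_max_right _ _
  have hb0 : 0 < b := by linarith
  obtain ⟨r, hr0, hr, hrσ⟩ := h.exists_small (σ z₂) (min (μ / 2) z₁) (lt_min (by linarith) h.pos)
  have hrμ := hr.trans_le (min_le_left _ _)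
  have hrz := hr.trans_le (min_le_right _ _)
  obtain ⟨a, ha0, ha, haσ⟩ := h.exists_small (σ r - 2 * b / μ) (min r (τ / 2))
    (lt_min hr0 (by linarith))
  have har := ha.trans_le (min_le_left _ _)
  have haτ := ha.trans_le (min_le_right _ _)
  have hbμ : 0 < 2 * b / μ := by positivity
  refine ⟨a, ha0, fun g T φ hφ hmax ⟨y', hy'⟩ y t ht =>
    le_trans ?_ (hφ.mono h (hy' y) ⟨hτ.le.trans ht.1, ht.2⟩)⟩
  have hτT : τ ≤ T := ht.1.trans ht.2
  -- Let `m = φ y'` be the smallest trajectory and `Δ = σ(r) - σ(m)`. Every value satisfies `σ(p) ≥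
  -- σ(m) + (Δ/b)(p - μ/2)`: for `p ≤ μ/2` because `σ(p) ≥ σ(m)`, and otherwise because `σ(p) ≥
  -- σ(r)` and `p ≤ b`. Integrating, the mean exceeds `σ(m)` by `Δμ/(2b)`, which is at least `1` by
  -- the choice of `a`.
  have hm' : ∀ t ∈ Ioo (τ / 2) T, φ y' t ≤ a →
      1 ≤ -(σ (φ y' t) - ∫ x, σ (φ (p₀ x) t) ∂P) := by
    intro t ht hma
    have htT : t ∈ Icc 0 T := ⟨by linarith [ht.1], ht.2.le⟩
    have hm0 := hφ.pos y' htT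
    have hσm := haσ _ hm0 hma
    set Δ := σ r - σ (φ y' t) with hΔ
    have hΔb : 2 * b / μ ≤ Δ := by linarith
    have hsub : Integrable (fun x => φ (p₀ x) t - μ / 2) P := (hφ.integrable hp htT).sub (integrable_const _)
    have hS : ∫ x, (σ (φ y' t) + Δ / b * (φ (p₀ x) t - μ / 2)) ∂P ≤ ∫ x, σ (φ (p₀ x) t) ∂P := by
      refine integral_mono ((integrable_const _).add
        (hsub.const_mul _))
        (hφ.integrable_stress h hp htT) fun x => ?_
      have hd : 0 ≤ Δ / b := div_nonneg (by linarith) hb0.le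
      have hmx := hφ.mono h (hy' (p₀ x)) htT
      simp only
      rcases le_total (φ (p₀ x) t) (μ / 2) with h1 | h1
      · have h2 := mul_nonneg hd (sub_nonneg.2 h1)
        have h3 := h.le_of_le' hm0 (by linarith) (by linarith [hrσ r hr0 le_rfl]) hmx
        nlinarith
      · have h2 : φ (p₀ x) t ≤ b := (hb₀ g T φ hφ hmax (p₀ x) t ⟨ht.1.le, ht.2.le⟩).trans (le_max_left _ _)
        have h3 := h.le_of_le' hr0 hrz.le (hrσ r hr0 le_rfl) (hrμ.le.trans h1)
        have h4 : Δ / b * (φ (p₀ x) t - μ / 2) ≤ Δ / b * b := mul_le_mul_of_nonneg_left (by linarith) hd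
        rw [div_mul_cancel₀ _ hb0.ne'] at h4
        linarith
    rw [integral_add (integrable_const _) (hsub.const_mul _),
      integral_const_mul, integral_sub (hφ.integrable hp htT) (integrable_const _), hφ.mass t htT] at hS
    simp only [integral_const, probReal_univ, one_smul] at hS
    have h5 : 1 ≤ Δ / b * (μ - μ / 2) := by
      rw [div_mul_eq_mul_div, le_div_iff₀ hb0]
      rw [div_le_iff₀ hμ] at hΔb
      linarith
    linarith
  have hτa : φ y' τ ≥ a := by
    have hk : a / (τ / 2) ≤ 1 := by rw [div_le_one (by linarith)]; linarith
    -- The line from `0` at time `τ/2` to `a` at time `τ` has slope at most `1` since `a < τ/2`.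
    -- Wherever `m` is below it, `m ≤ a` and so `m' ≥ 1`; hence the line cannot overtake `m`.
    have := nonpos_of_deriv_nonpos_of_pos (w := fun t => a / (τ / 2) * (t - τ / 2) - φ y' t)
      (w' := fun t => a / (τ / 2) * 1 - -(σ (φ y' t) - ∫ x, σ (φ (p₀ x) t) ∂P)) (a := τ / 2) (b := τ)
      (Continuous.continuousOn (by have := hφ.continuous_time y'; fun_prop))
      (fun t ht => (((hasDerivAt_id t).sub_const (τ / 2)).const_mul _).sub
        (hφ.deriv y' t ⟨by linarith [ht.1], ht.2.trans_le hτT⟩))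
      (fun t ht hpos => by
        have h1 : a / (τ / 2) * (t - τ / 2) ≤ a / (τ / 2) * (τ / 2) :=
          mul_le_mul_of_nonneg_left (by linarith [ht.2]) (by positivity)
        rw [div_mul_cancel₀ _ (by linarith)] at h1
        have := hm' t ⟨ht.1, ht.2.trans_le hτT⟩ (by linarith)
        linarith)
      (by
        have := hφ.pos y' (t := τ / 2) ⟨by linarith, by linarith⟩
        simp only [sub_self, mul_zero]
        linarith) τ ⟨by linarith, le_rfl⟩
    have h2 : a / (τ / 2) * (τ - τ / 2) = a := by field_simp; ring
    linarith
  have := nonpos_of_deriv_nonpos_of_pos (w := fun t => a - φ y' t) (a := τ) (b := T)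
    (continuous_const.sub (hφ.continuous_time y')).continuousOn
    (fun t ht => (hφ.deriv y' t ⟨by linarith [ht.1], ht.2⟩).const_sub a)
    (fun t ht hpos => by
      have := hm' t ⟨by linarith [ht.1], ht.2⟩ (sub_pos.1 hpos).le
      linarith)
    (by linarith) t ht
  linarith

end

/-! ### Stability of flows and approximation of data -/

section

set_option linter.unusedSectionVars false

variable {Ω : Type*} [MeasurableSpace Ω] {P : Measure Ω} [IsProbabilityMeasure P]

namespace LabelFlow

variable {σ : ℝ → ℝ} {z₁ z₂ : ℝ} {p₀ : Ω → ℝ} {μ : ℝ} {g g' : ℝ → ℝ} {T T' : ℝ} {φ φ' : ℝ → ℝ → ℝ}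

lemma continuousOn_stress (hφ : LabelFlow σ P p₀ μ g T φ) (h : CubicShape σ z₁ z₂) (y : ℝ) :
    ContinuousOn (fun t => σ (φ y t)) (Icc 0 T) :=
  h.continuousOn.comp (hφ.continuous_time y).continuousOn fun _ ht => hφ.pos y ht

lemma continuousOn_mean_stress (hφ : LabelFlow σ P p₀ μ g T φ) (h : CubicShape σ z₁ z₂)
    (hp : Measurable p₀) : ContinuousOn (fun t => ∫ x, σ (φ (p₀ x) t) ∂P) (Icc 0 T) := by
  obtain ⟨A, B, hA, hb⟩ := hφ.bounds
  obtain ⟨C, -, hC⟩ := h.exists_bound (b := B) hA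
  exact continuousOn_of_dominated (bound := fun _ => C)
    (fun t ht => (hφ.measurable_stress h hp ht).aestronglyMeasurable)
    (fun t ht => Eventually.of_forall fun x => hC _ (hb _ t ht)) (integrable_const _)
    (Eventually.of_forall fun x => hφ.continuousOn_stress h (p₀ x))

lemma intervalIntegrable_deriv (hφ : LabelFlow σ P p₀ μ g T φ) (h : CubicShape σ z₁ z₂)
    (hp : Measurable p₀) (y : ℝ) {s t : ℝ} (hs : s ∈ Icc 0 T) (ht : t ∈ Icc 0 T) :
    IntervalIntegrable (fun r => σ (φ y r) - ∫ x, σ (φ (p₀ x) r) ∂P) volume s t :=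
  (((hφ.continuousOn_stress h y).sub (hφ.continuousOn_mean_stress h hp)).mono
    (ordConnected_Icc.uIcc_subset hs ht)).intervalIntegrable

lemma sub_eq_integral (hφ : LabelFlow σ P p₀ μ g T φ) (h : CubicShape σ z₁ z₂)
    (hp : Measurable p₀) (y : ℝ) {s t : ℝ} (hs : 0 ≤ s) (hst : s ≤ t) (ht : t ≤ T) :
    φ y t - φ y s = -∫ r in s..t, (σ (φ y r) - ∫ x, σ (φ (p₀ x) r) ∂P) := by
  rw [← intervalIntegral.integral_neg]
  exact (intervalIntegral.integral_eq_sub_of_hasDerivAt_of_le hst (hφ.continuous_time y).continuousOn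
    (fun r hr => hφ.deriv y r ⟨hs.trans_lt hr.1, hr.2.trans_le ht⟩)
    (hφ.intervalIntegrable_deriv h hp y ⟨hs, hst.trans ht⟩ ⟨hs.trans hst, ht⟩).neg).symm

/-- The velocity is at most `2C`. The constant depends on the range of values only, which makes the
approximating flows equicontinuous in time. -/
lemma abs_sub_le (hφ : LabelFlow σ P p₀ μ g T φ) (h : CubicShape σ z₁ z₂) (hp : Measurable p₀)
    {a b C τ : ℝ} (hτ : 0 ≤ τ) (hC : ∀ p ∈ Icc a b, |σ p| ≤ C) (hb : ∀ y, ∀ t ∈ Icc τ T, φ y t ∈ Icc a b)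
    (y : ℝ) {s t : ℝ} (hs : s ∈ Icc τ T) (ht : t ∈ Icc τ T) : |φ y t - φ y s| ≤ 2 * C * |t - s| := by
  wlog hst : s ≤ t generalizing s t
  · rw [abs_sub_comm, abs_sub_comm t s]
    exact this ht hs (le_of_not_ge hst)
  rw [hφ.sub_eq_integral h hp y (hτ.trans hs.1) hst ht.2, abs_neg, ← Real.norm_eq_abs]
  refine intervalIntegral.norm_integral_le_of_norm_le_const fun r hr => ?_
  rw [uIoc_of_le hst] at hr
  have hr' : r ∈ Icc τ T := ⟨hs.1.trans hr.1.le, hr.2.trans ht.2⟩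
  have h1 : ‖∫ x, σ (φ (p₀ x) r) ∂P‖ ≤ C := by
    simpa using norm_integral_le_of_norm_le_const (μ := P) (f := fun x => σ (φ (p₀ x) r)) (C := C)
      (Eventually.of_forall fun x => (hC _ (hb (p₀ x) r hr')))
  calc _ ≤ ‖σ (φ y r)‖ + ‖∫ x, σ (φ (p₀ x) r) ∂P‖ := norm_sub_le _ _
    _ ≤ C + C := add_le_add (hC _ (hb y r hr')) h1
    _ = 2 * C := by ring

lemma integral_sq_sub_le (hφ : LabelFlow σ P p₀ μ g T φ) (hφ' : LabelFlow σ P p₀ μ g' T' φ')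
    (h : CubicShape σ z₁ z₂) (hp : Measurable p₀) {K : ℝ}
    (hK : ∀ p q, 0 < p → 0 < q → -(K * (p - q) ^ 2) ≤ (σ p - σ q) * (p - q))
    {t : ℝ} (ht : 0 ≤ t) (htT : t ≤ T) (htT' : t ≤ T') :
    ∫ x, (φ (p₀ x) t - φ' (p₀ x) t) ^ 2 ∂P ≤
      Real.exp (2 * K * t) * ∫ x, (g (p₀ x) - g' (p₀ x)) ^ 2 ∂P := by
  have h1 : ∀ r ∈ Icc 0 t, r ∈ Icc 0 T := fun r hr => ⟨hr.1, hr.2.trans htT⟩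
  have h2 : ∀ r ∈ Icc 0 t, r ∈ Icc 0 T' := fun r hr => ⟨hr.1, hr.2.trans htT'⟩
  have h0t : (0:ℝ) ∈ Icc 0 t := left_mem_Icc.2 ht
  obtain ⟨A, B, hA, hb⟩ := hφ.bounds
  obtain ⟨A', B', hA', hb'⟩ := hφ'.bounds
  have hmeas : ∀ r, Measurable fun x => φ (p₀ x) r - φ' (p₀ x) r := fun r =>
    (hφ.measurable_label hp r).sub (hφ'.measurable_label hp r)
  have hbound : ∀ r ∈ Icc 0 t, ∀ x, |φ (p₀ x) r - φ' (p₀ x) r| ≤ B + B' := by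
    intro r hr x
    have e1 := hb (p₀ x) r (h1 r hr)
    have e2 := hb' (p₀ x) r (h2 r hr)
    rw [abs_le]
    constructor <;> linarith [e1.1, e1.2, e2.1, e2.2]
  have hsq : ∀ r ∈ Icc 0 t, Integrable (fun x => (φ (p₀ x) r - φ' (p₀ x) r) ^ 2) P := fun r hr => by
    refine Integrable.of_bound ((hmeas r).pow_const 2).aestronglyMeasurable ((B + B') ^ 2)
      (Eventually.of_forall fun x => ?_)
    rw [norm_pow]
    exact pow_le_pow_left₀ (norm_nonneg _) (hbound r hr x) 2
  have key := integral_sq_le_exp_mul (P := P) (f := fun x r => φ (p₀ x) r - φ' (p₀ x) r)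
    (G := fun x r => σ (φ (p₀ x) r) - σ (φ' (p₀ x) r))
    (D := fun r => ∫ x, σ (φ (p₀ x) r) ∂P - ∫ x, σ (φ' (p₀ x) r) ∂P)
    (s := 0) (t := t) (K := K) (C := B + B') ht ?_ ?_ ?_ ?_ ?_ ?_ ?_ ?_ (hsq 0 h0t)
    (hsq t (right_mem_Icc.2 ht))
  · simpa [hφ.initial, hφ'.initial] using key
  · have hm : Measurable fun z : Ω × ℝ => (p₀ z.1, z.2) := (hp.comp measurable_fst).prodMk measurable_snd
    exact ((hφ.continuous.measurable.comp hm).sub (hφ'.continuous.measurable.comp hm)).aestronglyMeasurable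
  · refine ContinuousOn.intervalIntegrable ?_
    rw [uIcc_of_le ht]
    exact ((hφ.continuousOn_mean_stress h hp).mono h1).sub ((hφ'.continuousOn_mean_stress h hp).mono h2)
  · refine Eventually.of_forall fun x => ContinuousOn.intervalIntegrable ?_
    rw [uIcc_of_le ht]
    exact ((hφ.continuousOn_stress h _).mono h1).sub ((hφ'.continuousOn_stress h _).mono h2)
  · refine Eventually.of_forall fun x r hr => ?_
    have e1 := hφ.sub_eq_integral h hp (p₀ x) le_rfl hr.1 (h1 r hr).2
    have e2 := hφ'.sub_eq_integral h hp (p₀ x) le_rfl hr.1 (h2 r hr).2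
    have e3 := intervalIntegral.integral_sub
      (hφ.intervalIntegrable_deriv h hp (p₀ x) (h1 0 h0t) (h1 r hr))
      (hφ'.intervalIntegrable_deriv h hp (p₀ x) (h2 0 h0t) (h2 r hr))
    have e4 : ∀ r, σ (φ (p₀ x) r) - σ (φ' (p₀ x) r) -
        (∫ x, σ (φ (p₀ x) r) ∂P - ∫ x, σ (φ' (p₀ x) r) ∂P) =
        (σ (φ (p₀ x) r) - ∫ x, σ (φ (p₀ x) r) ∂P) - (σ (φ' (p₀ x) r) - ∫ x, σ (φ' (p₀ x) r) ∂P) :=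
      fun r => by ring
    simp only [e4]
    rw [e3]
    linarith
  · refine Eventually.of_forall fun x => ?_
    filter_upwards [self_mem_ae_restrict measurableSet_Ioc] with r hr
    exact hK _ _ (hφ.pos _ (h1 r (Ioc_subset_Icc_self hr))) (hφ'.pos _ (h2 r (Ioc_subset_Icc_self hr)))
  · intro r hr
    rw [integral_sub (hφ.integrable hp (h1 r hr)) (hφ'.integrable hp (h2 r hr)), hφ.mass r (h1 r hr),
      hφ'.mass r (h2 r hr), sub_self]
  · exact fun r hr => (hφ.integrable hp (h1 r hr)).sub (hφ'.integrable hp (h2 r hr))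
  · intro r hr
    have := integral_mono ((hφ.integrable hp (h1 r hr)).sub (hφ'.integrable hp (h2 r hr))).abs
      (integrable_const (B + B')) (hbound r hr)
    simpa using this

end LabelFlow

/-- Nonnegative square-integrable data are `L²` limits of bounded, uniformly positive data of the same mean
which are functions of the datum attaining a maximum and a minimum. -/
theorem exists_bounded_data {p₀ : Ω → ℝ} (hp : Measurable p₀) (hp0 : ∀ x, 0 ≤ p₀ x)
    (hp2 : Integrable (fun x => p₀ x ^ 2) P) {μ : ℝ} (hμ : 0 < μ) (hmean : ∫ x, p₀ x ∂P = μ)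
    {ε : ℝ} (hε : 0 < ε) :
    ∃ g : ℝ →ᵇ ℝ, ∃ c, 0 < c ∧ (∀ y, c ≤ g y) ∧ ∫ x, g (p₀ x) ∂P = μ ∧ (∃ y', ∀ y, g y ≤ g y') ∧
      (∃ y', ∀ y, g y' ≤ g y) ∧ Integrable (fun x => (g (p₀ x) - p₀ x) ^ 2) P ∧
      ∫ x, (g (p₀ x) - p₀ x) ^ 2 ∂P ≤ ε := by
  have hp1 : Integrable p₀ P := ((memLp_two_iff_integrable_sq hp.aestronglyMeasurable).2 hp2).integrable
    (by norm_num)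
  set l : ℕ → ℝ := fun n => 1 - 1 / ((n:ℝ) + 1) with hl
  have hl0 : ∀ n, 0 ≤ l n := fun n => by
    have : 1 / ((n:ℝ) + 1) ≤ 1 := by rw [div_le_one (by positivity)]; linarith [n.cast_nonneg (α := ℝ)]
    simp only [hl]; linarith
  have hl1 : ∀ n, l n < 1 := fun n => by
    have : 0 < 1 / ((n:ℝ) + 1) := by positivity
    simp only [hl]; linarith
  have hllim : Tendsto l atTop (𝓝 1) := by
    simpa [hl] using tendsto_one_div_add_atTop_nhds_zero_nat.const_sub (1:ℝ)
  have hmin_int : ∀ n : ℕ, Integrable (fun x => min (p₀ x) n) P := fun n =>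
    Integrable.mono' hp1 (hp.min measurable_const).aestronglyMeasurable (Eventually.of_forall fun x => by
      rw [Real.norm_of_nonneg (le_min (hp0 x) n.cast_nonneg)]
      exact min_le_left _ _)
  have hmin_lim : ∀ x, Tendsto (fun n : ℕ => min (p₀ x) n) atTop (𝓝 (p₀ x)) := fun x => by
    refine tendsto_const_nhds.congr' ?_
    filter_upwards [tendsto_natCast_atTop_atTop.eventually_ge_atTop (p₀ x)] with n hn
    rw [min_eq_left hn]
  set I : ℕ → ℝ := fun n => ∫ x, min (p₀ x) n ∂P with hI
  have hIle : ∀ n, I n ≤ μ := fun n => by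
    rw [← hmean]
    exact integral_mono (hmin_int n) hp1 fun x => min_le_left _ _
  have hI0 : ∀ n, 0 ≤ I n := fun n => integral_nonneg fun x => le_min (hp0 x) n.cast_nonneg
  have hIlim : Tendsto I atTop (𝓝 μ) := by
    rw [← hmean]
    refine tendsto_integral_of_dominated_convergence p₀ (fun n => (hmin_int n).aestronglyMeasurable) hp1
      (fun n => Eventually.of_forall fun x => ?_) (Eventually.of_forall hmin_lim)
    rw [Real.norm_of_nonneg (le_min (hp0 x) n.cast_nonneg)]
    exact min_le_left _ _
  -- Truncate at `n`, shrink by `l n < 1`, and restore the mean by an additive constant. The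
  -- shrinking makes this constant strictly positive, which gives the uniform lower bound. The
  -- minimum is attained at `y = 0` and the maximum at `y = n`.
  set G : ℕ → ℝ → ℝ := fun n y => l n * min (max y 0) n + (μ - l n * I n) with hG
  have hc : ∀ n, 0 < μ - l n * I n := fun n => by
    have := mul_le_mul_of_nonneg_left (hIle n) (hl0 n)
    nlinarith [hl1 n]
  have hGp : ∀ n x, G n (p₀ x) = l n * min (p₀ x) n + (μ - l n * I n) := fun n x => by
    simp only [hG, max_eq_left (hp0 x)]
  have hbd : ∀ n x, |G n (p₀ x) - p₀ x| ≤ p₀ x + μ := fun n x => by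
    rw [hGp, abs_le]
    have h1 : 0 ≤ l n * min (p₀ x) n := mul_nonneg (hl0 n) (le_min (hp0 x) n.cast_nonneg)
    have h2 : l n * min (p₀ x) n ≤ 1 * p₀ x :=
      mul_le_mul (hl1 n).le (min_le_left _ _) (le_min (hp0 x) n.cast_nonneg) zero_le_one
    have h3 := mul_nonneg (hl0 n) (hI0 n)
    constructor <;> linarith [hc n, hp0 x]
  have hGc : ∀ n, Continuous (G n) := fun n => by fun_prop
  have hdom : Integrable (fun x => (p₀ x + μ) ^ 2) P := by
    have : (fun x => (p₀ x + μ) ^ 2) = fun x => p₀ x ^ 2 + 2 * μ * p₀ x + μ ^ 2 := by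
      funext x; ring
    rw [this]
    exact (hp2.add (hp1.const_mul _)).add (integrable_const _)
  have hmeas : ∀ n, AEStronglyMeasurable (fun x => (G n (p₀ x) - p₀ x) ^ 2) P := fun n =>
    ((((hGc n).measurable.comp hp).sub hp).pow_const 2).aestronglyMeasurable
  have hbd2 : ∀ n, ∀ᵐ x ∂P, ‖(G n (p₀ x) - p₀ x) ^ 2‖ ≤ (p₀ x + μ) ^ 2 := fun n =>
    Eventually.of_forall fun x => by
      rw [norm_pow]
      exact pow_le_pow_left₀ (norm_nonneg _) (hbd n x) 2
  have hlim : Tendsto (fun n => ∫ x, (G n (p₀ x) - p₀ x) ^ 2 ∂P) atTop (𝓝 (∫ _, (0:ℝ) ∂P)) := by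
    refine tendsto_integral_of_dominated_convergence _ hmeas hdom hbd2 (Eventually.of_forall fun x => ?_)
    have := (((hllim.mul (hmin_lim x)).add (hllim.mul hIlim |>.const_sub μ)).sub_const (p₀ x)).pow 2
    simp only [hGp]
    convert this using 2
    ring
  rw [integral_zero] at hlim
  obtain ⟨n, hn⟩ := (hlim.eventually_lt_const hε).exists
  have hmono : Monotone (G n) := fun y y' hyy => by
    have := mul_le_mul_of_nonneg_left (min_le_min (max_le_max hyy (le_refl (0:ℝ))) (le_refl (n:ℝ))) (hl0 n)
    simp only [hG]
    linarith
  have hle : ∀ y, G n y ≤ G n n := fun y => by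
    have := mul_le_mul_of_nonneg_left (min_le_right (max y 0) (n:ℝ)) (hl0 n)
    simp only [hG, max_eq_left n.cast_nonneg (a := (n:ℝ)), min_self]
    linarith
  have hge : ∀ y, G n 0 ≤ G n y := fun y => by
    have := mul_nonneg (hl0 n) (le_min (le_max_right y 0) (n.cast_nonneg (α := ℝ)))
    simp only [hG, max_self, min_eq_left (n.cast_nonneg (α := ℝ))]
    linarith
  have hpos : ∀ y, μ - l n * I n ≤ G n y := fun y => by
    have := mul_nonneg (hl0 n) (le_min (le_max_right y 0) (n.cast_nonneg (α := ℝ)))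
    simp only [hG]
    linarith
  refine ⟨BoundedContinuousFunction.ofNormedAddCommGroup (G n) (hGc n) (G n n) (fun y => by
    rw [Real.norm_of_nonneg ((hc n).le.trans (hpos y))]; exact hle y), μ - l n * I n, hc n, hpos, ?_,
    ⟨n, hle⟩, ⟨0, hge⟩, hdom.mono' (hmeas n) (hbd2 n), hn.le⟩
  simp only [BoundedContinuousFunction.coe_ofNormedAddCommGroup, hGp]
  rw [integral_add ((hmin_int n).const_mul _) (integrable_const _), integral_const_mul]
  simp [hI]

end

/-! ### Existence for square-integrable data -/

section

set_option linter.unusedSectionVars false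

variable {Ω : Type*} [MeasurableSpace Ω] {P : Measure Ω} [IsProbabilityMeasure P]

/-- A sequence of random variables whose increments decay geometrically in `L²` converges a.e. -/
lemma ae_exists_tendsto_of_integral_sq_le {f : ℕ → Ω → ℝ} (hf : ∀ k, Measurable (f k))
    (hi : ∀ k, Integrable (fun x => (f k x - f (k + 1) x) ^ 2) P) {C : ℝ}
    (hC : ∀ k, ∫ x, (f k x - f (k + 1) x) ^ 2 ∂P ≤ C * (1 / 4) ^ k) :
    ∀ᵐ x ∂P, ∃ l, Tendsto (fun k => f k x) atTop (𝓝 l) := by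
  have hm : ∀ k, Measurable fun x => f k x - f (k + 1) x := fun k => (hf k).sub (hf (k + 1))
  have hint : ∀ k, Integrable (fun x => f k x - f (k + 1) x) P := fun k =>
    ((memLp_two_iff_integrable_sq (hm k).aestronglyMeasurable).2 (hi k)).integrable (by norm_num)
  have hle : ∀ k, ∫ x, ‖f k x - f (k + 1) x‖ ∂P ≤ (1 + C) * (1 / 2) ^ k := fun k => by
    -- From `|d| ≤ 2⁻ᵏ + 2ᵏ d²`, the `L²` decay `4⁻ᵏ` gives `L¹` increments of order `2⁻ᵏ`, which
    -- are summable.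
    have h1 : ∫ x, ‖f k x - f (k + 1) x‖ ∂P ≤
        ∫ x, ((1 / 2) ^ k + 2 ^ k * (f k x - f (k + 1) x) ^ 2) ∂P := by
      refine integral_mono (hint k).norm ((integrable_const _).add ((hi k).const_mul _)) fun x => ?_
      simp only
      set d := f k x - f (k + 1) x
      rw [← sq_abs d, Real.norm_eq_abs]
      have e : (2:ℝ) ^ k * (1 / 2) ^ k = 1 := by rw [← mul_pow]; norm_num
      have e2 : (0:ℝ) < (2:ℝ) ^ k := by positivity
      have e3 : (0:ℝ) < (1 / 2:ℝ) ^ k := by positivity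
      have : 0 ≤ 2 ^ k * (|d| - (1 / 2) ^ k) ^ 2 := by positivity
      have e4 : 2 ^ k * (|d| - (1 / 2) ^ k) ^ 2 = 2 ^ k * |d| ^ 2 - 2 * (2 ^ k * (1 / 2) ^ k) * |d| +
          (2 ^ k * (1 / 2) ^ k) * (1 / 2) ^ k := by ring
      rw [e4, e] at this
      linarith [abs_nonneg d]
    rw [integral_add (integrable_const _) ((hi k).const_mul _), integral_const_mul] at h1
    simp only [integral_const, probReal_univ, one_smul] at h1
    have h2 := mul_le_mul_of_nonneg_left (hC k) (by positivity : (0:ℝ) ≤ 2 ^ k)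
    have e : (2:ℝ) ^ k * (C * (1 / 4) ^ k) = C * (1 / 2) ^ k := by
      rw [mul_left_comm, ← mul_pow]; norm_num
    linarith
  have hsum : ∫⁻ x, ∑' k, ‖f k x - f (k + 1) x‖ₑ ∂P ≠ ∞ := by
    rw [lintegral_tsum fun k => (hm k).enorm.aemeasurable]
    have hsm : Summable fun k : ℕ => (1 + C) * (1 / 2 : ℝ) ^ k :=
      (summable_geometric_of_lt_one (by norm_num) (by norm_num)).mul_left _
    refine ne_top_of_le_ne_top hsm.tsum_ofReal_ne_top (ENNReal.tsum_le_tsum fun k => ?_)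
    rw [← ofReal_integral_norm_eq_lintegral_enorm (hint k)]
    exact ENNReal.ofReal_le_ofReal (hle k)
  have hlt := ae_lt_top (Measurable.tsum fun k => (hm k).enorm) hsum
  filter_upwards [hlt] with x hx
  have hs : Summable fun k => dist (f k x) (f (k + 1) x) := by
    have : Summable fun k => ‖f k x - f (k + 1) x‖₊ := ENNReal.tsum_coe_ne_top_iff_summable.1 hx.ne
    simpa [dist_eq_norm] using (NNReal.summable_coe.2 this)
  exact cauchySeq_tendsto_of_complete (cauchySeq_of_summable_dist hs)

/-- A solution of the evolution equation for positive times, in the form of trajectories which satisfy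
the equation for every label, and which is bounded and uniformly positive away from `t = 0`. -/
structure RegularFlow (σ : ℝ → ℝ) (P : Measure Ω) (μ : ℝ) (p : Ω → ℝ → ℝ) : Prop where
  measurable : ∀ t, 0 < t → Measurable fun x => p x t
  bounds : ∀ τ, 0 < τ → ∃ a b, 0 < a ∧ ∀ x t, τ ≤ t → p x t ∈ Icc a b
  mass : ∀ t, 0 < t → ∫ x, p x t ∂P = μ
  deriv : ∀ x t, 0 < t → HasDerivAt (p x) (-(σ (p x t) - ∫ y, σ (p y t) ∂P)) t

/-- Label flows on growing time intervals whose data approximate `p₀` geometrically fast. -/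
structure ApproxSequence (σ : ℝ → ℝ) (P : Measure Ω) (p₀ : Ω → ℝ) (μ K : ℝ) (g : ℕ → ℝ → ℝ)
    (φ : ℕ → ℝ → ℝ → ℝ) : Prop where
  flow : ∀ k, LabelFlow σ P p₀ μ (g k) (k + 1) (φ k)
  bounds : ∀ τ, 0 < τ → ∃ a b : ℝ, 0 < a ∧ ∀ (k : ℕ) (y : ℝ), ∀ t ∈ Icc τ ((k:ℝ) + 1), φ k y t ∈ Icc a b
  integrable_data : ∀ k, Integrable (fun x => (g k (p₀ x) - p₀ x) ^ 2) P
  data : ∀ k, ∫ x, (g k (p₀ x) - p₀ x) ^ 2 ∂P ≤ (1 / 4) ^ k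
  dist : ∀ k l : ℕ, k ≤ l → ∀ t ∈ Icc 0 ((k:ℝ) + 1),
    ∫ x, (φ k (p₀ x) t - φ l (p₀ x) t) ^ 2 ∂P ≤ Real.exp (2 * K * t) * (4 * (1 / 4) ^ k)

/-- The bounds at times `t ≥ τ` are independent of `k` because the smoothing estimates do not depend
on the data. The factor `4` comes from `‖g k - g l‖² ≤ 2‖g k - p₀‖² + 2‖g l - p₀‖²`. -/
theorem exists_approxSequence {σ : ℝ → ℝ} {z₁ z₂ : ℝ} (h : CubicShape σ z₁ z₂)
    {m : ℝ} (hint : IntegrableOn (fun z => 1 / σ z) (Ioi m)) {p₀ : Ω → ℝ} (hp : Measurable p₀)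
    (hp0 : ∀ x, 0 ≤ p₀ x) (hp2 : Integrable (fun x => p₀ x ^ 2) P) {μ : ℝ} (hμ : 0 < μ)
    (hmean : ∫ x, p₀ x ∂P = μ) {K : ℝ}
    (hK : ∀ p q, 0 < p → 0 < q → -(K * (p - q) ^ 2) ≤ (σ p - σ q) * (p - q)) :
    ∃ g φ, ApproxSequence σ P p₀ μ K g φ := by
  choose g c hc hcg hgμ hgmax hgmin hgi hgε using fun k : ℕ =>
    exists_bounded_data hp hp0 hp2 hμ hmean (ε := (1 / 4) ^ k) (by positivity)
  choose φ hφ using fun k : ℕ =>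
    exists_labelFlow (P := P) h hp (g k) (hc k) (hcg k) (hgμ k) (T := (k:ℝ) + 1) (by positivity)
  refine ⟨fun k => g k, φ, hφ, fun τ hτ => ?_, hgi, hgε, fun k l hkl t ht => ?_⟩
  · obtain ⟨b, hb⟩ := exists_forall_labelFlow_le (P := P) (μ := μ) h hint hp hτ
    obtain ⟨a, ha, hab⟩ := exists_forall_le_labelFlow (P := P) h hint hp hμ hτ
    exact ⟨a, b, ha, fun k y t ht =>
      ⟨hab _ _ _ (hφ k) (hgmax k) (hgmin k) y t ht, hb _ _ _ (hφ k) (hgmax k) y t ht⟩⟩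
  · have hkl' : (k:ℝ) ≤ l := by exact_mod_cast hkl
    refine ((hφ k).integral_sq_sub_le (hφ l) h hp hK ht.1 ht.2 (by linarith [ht.2])).trans ?_
    refine mul_le_mul_of_nonneg_left ?_ (Real.exp_pos _).le
    have h1 : ∫ x, (g k (p₀ x) - g l (p₀ x)) ^ 2 ∂P ≤
        ∫ x, (2 * (g k (p₀ x) - p₀ x) ^ 2 + 2 * (g l (p₀ x) - p₀ x) ^ 2) ∂P := by
      refine integral_mono_of_nonneg (Eventually.of_forall fun x => sq_nonneg _)
        (((hgi k).const_mul 2).add ((hgi l).const_mul 2)) (Eventually.of_forall fun x => ?_)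
      simp only
      nlinarith [sq_nonneg ((g k (p₀ x) - p₀ x) + (g l (p₀ x) - p₀ x))]
    rw [integral_add ((hgi k).const_mul 2) ((hgi l).const_mul 2), integral_const_mul,
      integral_const_mul] at h1
    have h2 : ((1:ℝ) / 4) ^ l ≤ (1 / 4) ^ k := pow_le_pow_of_le_one (by norm_num) (by norm_num) hkl
    linarith [hgε k, hgε l]

namespace ApproxSequence

variable {σ : ℝ → ℝ} {z₁ z₂ : ℝ} {p₀ : Ω → ℝ} {μ K : ℝ} {g : ℕ → ℝ → ℝ} {φ : ℕ → ℝ → ℝ → ℝ}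

lemma integrable_sq_sub (hs : ApproxSequence σ P p₀ μ K g φ) (hp : Measurable p₀) {k l : ℕ} (hkl : k ≤ l)
    {t : ℝ} (ht : t ∈ Icc 0 ((k:ℝ) + 1)) :
    Integrable (fun x => (φ k (p₀ x) t - φ l (p₀ x) t) ^ 2) P := by
  have hkl' : (k:ℝ) ≤ l := by exact_mod_cast hkl
  have ht' : t ∈ Icc 0 ((l:ℝ) + 1) := ⟨ht.1, by linarith [ht.2]⟩
  obtain ⟨A, B, hA, hb⟩ := (hs.flow k).bounds
  obtain ⟨A', B', hA', hb'⟩ := (hs.flow l).bounds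
  refine Integrable.of_bound ((((hs.flow k).measurable_label hp t).sub
    ((hs.flow l).measurable_label hp t)).pow_const 2).aestronglyMeasurable ((B + B') ^ 2)
    (Eventually.of_forall fun x => ?_)
  rw [norm_pow]
  refine pow_le_pow_left₀ (norm_nonneg _) ?_ 2
  have e1 := hb (p₀ x) t ht
  have e2 := hb' (p₀ x) t ht'
  rw [Real.norm_eq_abs, abs_le]
  constructor <;> linarith [e1.1, e1.2, e2.1, e2.2]

lemma ae_exists_tendsto (hs : ApproxSequence σ P p₀ μ K g φ) (hp : Measurable p₀) {t : ℝ} (ht : 0 < t) :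
    ∀ᵐ x ∂P, ∃ l, Tendsto (fun k => φ k (p₀ x) t) atTop (𝓝 l) := by
  -- The flow `φ k` solves the equation only up to time `k + 1`, so the sequence is shifted past `N
  -- ≥ t`.
  obtain ⟨N, hN⟩ := exists_nat_ge t
  have hmem : ∀ k : ℕ, t ∈ Icc 0 (((k + N : ℕ):ℝ) + 1) := fun k => ⟨ht.le, by
    push_cast; linarith [k.cast_nonneg (α := ℝ)]⟩
  have := ae_exists_tendsto_of_integral_sq_le (P := P) (f := fun k x => φ (k + N) (p₀ x) t)
    (fun k => (hs.flow (k + N)).measurable_label hp t)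
    (fun k => hs.integrable_sq_sub hp (by omega) (hmem k)) (C := Real.exp (2 * K * t) * 4) (fun k => by
      refine (hs.dist (k + N) (k + 1 + N) (by omega) t (hmem k)).trans ?_
      have h2 : ((1:ℝ) / 4) ^ (k + N) ≤ (1 / 4) ^ k :=
        pow_le_pow_of_le_one (by norm_num) (by norm_num) (by omega)
      rw [mul_assoc (Real.exp _)]
      exact mul_le_mul_of_nonneg_left (by linarith) (Real.exp_pos _).le)
  filter_upwards [this] with x ⟨l, hl⟩
  exact ⟨l, (tendsto_add_atTop_iff_nat N).1 hl⟩

/-- By equicontinuity in time, convergence at rational times gives convergence at all times. -/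
lemma exists_tendsto_of_rat (hs : ApproxSequence σ P p₀ μ K g φ) (h : CubicShape σ z₁ z₂)
    (hp : Measurable p₀) {y : ℝ}
    (hy : ∀ q : ℚ, 0 < q → ∃ l, Tendsto (fun k => φ k y q) atTop (𝓝 l)) {t : ℝ} (ht : 0 < t) :
    ∃ l, Tendsto (fun k => φ k y t) atTop (𝓝 l) := by
  refine cauchySeq_tendsto_of_complete (Metric.cauchySeq_iff.2 fun ε hε => ?_)
  obtain ⟨a, b, ha, hab⟩ := hs.bounds (t / 2) (half_pos ht)
  obtain ⟨C, hC0, hC⟩ := h.exists_bound (b := b) ha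
  -- Speeds are at most `2C`, so moving from `t` to `q` changes each value by less than `ε/4`.
  obtain ⟨q, hq1, hq2⟩ := exists_rat_btwn (show t < t + ε / (8 * (C + 1)) by
    have : 0 < ε / (8 * (C + 1)) := by positivity
    linarith)
  have hq0 : 0 < q := by exact_mod_cast ht.trans hq1
  obtain ⟨l, hl⟩ := hy q hq0
  obtain ⟨N₁, hN₁⟩ := Metric.cauchySeq_iff.1 hl.cauchySeq (ε / 2) (half_pos hε)
  obtain ⟨N₂, hN₂⟩ := exists_nat_ge (q:ℝ)
  have hlip : ∀ k : ℕ, N₂ ≤ k → |φ k y q - φ k y t| < ε / 4 := fun k hk => by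
    have hk' : (N₂:ℝ) ≤ k := by exact_mod_cast hk
    have := (hs.flow k).abs_sub_le h hp (half_pos ht).le hC (hab k) y (s := t) (t := q)
      ⟨by linarith, by linarith⟩ ⟨by linarith, by linarith⟩
    refine this.trans_lt ?_
    rw [abs_of_pos (by linarith)]
    have h1 : (q:ℝ) - t < ε / (8 * (C + 1)) := by linarith
    rw [lt_div_iff₀ (by positivity)] at h1
    nlinarith
  refine ⟨max N₁ N₂, fun k hk j hj => ?_⟩
  have e1 := hlip k ((le_max_right _ _).trans hk)
  have e2 := hlip j ((le_max_right _ _).trans hj)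
  have e3 := hN₁ k ((le_max_left _ _).trans hk) j ((le_max_left _ _).trans hj)
  rw [Real.dist_eq, abs_lt] at *
  constructor <;> linarith

end ApproxSequence

/-- `σ` is unconstrained outside `(0,∞)`; precomposing it with `max a` gives a function continuous
on all of `ℝ`. -/
lemma CubicShape.measurable_comp {σ : ℝ → ℝ} {z₁ z₂ : ℝ} (h : CubicShape σ z₁ z₂) {a : ℝ} (ha : 0 < a)
    {f : Ω → ℝ} (hf : Measurable f) (haf : ∀ x, a ≤ f x) : Measurable fun x => σ (f x) := by
  have hc : Continuous fun z => σ (max a z) := h.continuousOn.comp_continuous (by fun_prop)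
    fun z => ha.trans_le (le_max_left a z)
  have he : (fun x => σ (f x)) = fun x => σ (max a (f x)) := funext fun x => by rw [max_eq_right (haf x)]
  rw [he]
  exact hc.measurable.comp hf

/-- Existence of a regular flow with given initial datum. -/
theorem exists_regularFlow {σ : ℝ → ℝ} {z₁ z₂ : ℝ} (h : CubicShape σ z₁ z₂)
    {m : ℝ} (hint : IntegrableOn (fun z => 1 / σ z) (Ioi m)) {p₀ : Ω → ℝ} (hp : Measurable p₀)
    (hp0 : ∀ x, 0 ≤ p₀ x) (hp2 : Integrable (fun x => p₀ x ^ 2) P) {μ : ℝ} (hμ : 0 < μ)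
    (hmean : ∫ x, p₀ x ∂P = μ) :
    ∃ p, RegularFlow σ P μ p ∧ Tendsto (fun t => ∫ x, (p x t - p₀ x) ^ 2 ∂P) (𝓝[>] 0) (𝓝 0) := by
  obtain ⟨K, hK0, hK⟩ := h.exists_monotone
  obtain ⟨g, φ, hs⟩ := exists_approxSequence (P := P) h hint hp hp0 hp2 hμ hmean hK
  have hae : ∀ᵐ x ∂P, ∀ q : ℚ, 0 < q → ∃ l, Tendsto (fun k => φ k (p₀ x) q) atTop (𝓝 l) := by
    rw [ae_all_iff]
    intro q
    by_cases hq : 0 < q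
    · filter_upwards [hs.ae_exists_tendsto hp (t := (q:ℝ)) (by exact_mod_cast hq)] with x hx _
      exact hx
    · exact Eventually.of_forall fun x hx => absurd hx hq
  -- replace `p₀` by a version all of whose values are good labels
  obtain ⟨q₀, hq₀m, hq₀ae, hq₀⟩ : ∃ q₀ : Ω → ℝ, Measurable q₀ ∧ (∀ᵐ x ∂P, q₀ x = p₀ x) ∧
      ∀ x, ∀ q : ℚ, 0 < q → ∃ l, Tendsto (fun k => φ k (q₀ x) q) atTop (𝓝 l) := by
    obtain ⟨x₀, hx₀⟩ := hae.exists
    obtain ⟨N, hNsub, hNm, hN0⟩ := exists_measurable_superset_of_null (ae_iff.1 hae)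
    classical
    refine ⟨N.piecewise (fun _ => p₀ x₀) p₀, Measurable.piecewise hNm measurable_const hp, ?_, ?_⟩
    · have : ∀ᵐ x ∂P, x ∉ N := measure_eq_zero_iff_ae_notMem.1 hN0
      filter_upwards [this] with x hx
      exact piecewise_eq_of_notMem _ _ _ hx
    · intro x
      by_cases hx : x ∈ N
      · rw [piecewise_eq_of_mem _ _ _ hx]; exact hx₀
      · rw [piecewise_eq_of_notMem _ _ _ hx]
        by_contra hcon
        exact hx (hNsub hcon)
  set p : Ω → ℝ → ℝ := fun x t => limUnder atTop fun k => φ k (q₀ x) t with hpdef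
  have hlim : ∀ x t, 0 < t → Tendsto (fun k => φ k (q₀ x) t) atTop (𝓝 (p x t)) := fun x t ht =>
    tendsto_nhds_limUnder (hs.exists_tendsto_of_rat h hp (hq₀ x) ht)
  have hlim' : ∀ t, 0 < t → ∀ᵐ x ∂P, Tendsto (fun k => φ k (p₀ x) t) atTop (𝓝 (p x t)) := fun t ht => by
    filter_upwards [hq₀ae] with x hx
    rw [← hx]
    exact hlim x t ht
  have hT : ∀ t : ℝ, ∀ᶠ k : ℕ in atTop, t ≤ (k:ℝ) + 1 := fun t => by
    filter_upwards [tendsto_natCast_atTop_atTop.eventually_ge_atTop t] with k hk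
    linarith
  have hbounds : ∀ τ, 0 < τ → ∃ a b, 0 < a ∧ (∀ x t, τ ≤ t → p x t ∈ Icc a b) ∧
      ∀ (k : ℕ) (y : ℝ), ∀ t ∈ Icc τ ((k:ℝ) + 1), φ k y t ∈ Icc a b := fun τ hτ => by
    obtain ⟨a, b, ha, hab⟩ := hs.bounds τ hτ
    refine ⟨a, b, ha, fun x t ht => isClosed_Icc.mem_of_tendsto (hlim x t (hτ.trans_le ht)) ?_, hab⟩
    filter_upwards [hT t] with k hk
    exact hab k _ t ⟨ht, hk⟩
  have hmeas : ∀ t, 0 < t → Measurable fun x => p x t := fun t ht =>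
    measurable_of_tendsto_metrizable (f := fun k x => φ k (q₀ x) t)
      (fun k => ((hs.flow k).continuous.comp (Continuous.prodMk_left t)).measurable.comp hq₀m)
      (tendsto_pi_nhds.2 fun x => hlim x t ht)
  have hppos : ∀ x t, 0 < t → 0 < p x t := fun x t ht => by
    obtain ⟨a, b, ha, hab, -⟩ := hbounds t ht
    exact ha.trans_le (hab x t le_rfl).1
  have hσlim : ∀ x t, 0 < t → Tendsto (fun k => σ (φ k (q₀ x) t)) atTop (𝓝 (σ (p x t))) := fun x t ht =>
    (h.continuousAt (hppos x t ht)).tendsto.comp (hlim x t ht)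
  have hmass : ∀ t, 0 < t → ∫ x, p x t ∂P = μ := fun t ht => by
    obtain ⟨a, b, ha, hab, habk⟩ := hbounds t ht
    have h1 : Tendsto (fun k => ∫ x, φ k (p₀ x) t ∂P) atTop (𝓝 (∫ x, p x t ∂P)) := by
      refine tendsto_integral_filter_of_dominated_convergence (fun _ => b)
        (Eventually.of_forall fun k => ((hs.flow k).measurable_label hp t).aestronglyMeasurable) ?_
        (integrable_const _) (hlim' t ht)
      filter_upwards [hT t] with k hk
      refine Eventually.of_forall fun x => ?_
      have := habk k (p₀ x) t ⟨le_rfl, hk⟩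
      rw [Real.norm_of_nonneg (ha.le.trans this.1)]
      exact this.2
    refine tendsto_nhds_unique h1 (tendsto_const_nhds.congr' ?_)
    filter_upwards [hT t] with k hk
    exact ((hs.flow k).mass t ⟨ht.le, hk⟩).symm
  set S : ℝ → ℝ := fun t => ∫ x, σ (p x t) ∂P with hS
  -- The means are taken over `p₀`, the trajectories over `q₀`; the two labels agree almost
  -- everywhere, so the limit is still the mean stress of `p`.
  have hSlim : ∀ t, 0 < t → Tendsto (fun k => ∫ x, σ (φ k (p₀ x) t) ∂P) atTop (𝓝 (S t)) := fun t ht => by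
    obtain ⟨a, b, ha, hab, habk⟩ := hbounds t ht
    obtain ⟨C, hC0, hC⟩ := h.exists_bound (b := b) ha
    refine tendsto_integral_filter_of_dominated_convergence (fun _ => C) ?_ ?_ (integrable_const _) ?_
    · filter_upwards [hT t] with k hk
      exact ((hs.flow k).measurable_stress h hp ⟨ht.le, hk⟩).aestronglyMeasurable
    · filter_upwards [hT t] with k hk
      exact Eventually.of_forall fun x => hC _ (habk k (p₀ x) t ⟨le_rfl, hk⟩)
    · filter_upwards [hlim' t ht] with x hx
      exact (h.continuousAt (hppos x t ht)).tendsto.comp hx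
  have hmean_bound : ∀ {C : ℝ} {f : Ω → ℝ}, (∀ x, |f x| ≤ C) → |∫ x, f x ∂P| ≤ C := fun {C f} hf => by
    simpa using norm_integral_le_of_norm_le_const (μ := P) (f := f) (C := C) (Eventually.of_forall hf)
  have hpc : ∀ x, ContinuousOn (p x) (Ioi 0) := fun x t ht => by
    have ht2 : 0 < t / 2 := half_pos ht
    obtain ⟨a, b, ha, hab, habk⟩ := hbounds (t / 2) ht2
    obtain ⟨C, hC0, hC⟩ := h.exists_bound (b := b) ha
    have hl : LipschitzOnWith (2 * C).toNNReal (p x) (Ici (t / 2)) := by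
      refine LipschitzOnWith.of_dist_le_mul fun r hr s hs' => ?_
      rw [Real.coe_toNNReal _ (by positivity), Real.dist_eq, Real.dist_eq]
      refine le_of_tendsto (((hlim x r (ht2.trans_le hr)).sub (hlim x s (ht2.trans_le hs'))).abs) ?_
      filter_upwards [hT r, hT s] with k hk hk'
      exact (hs.flow k).abs_sub_le h hp ht2.le hC (habk k) _ ⟨hs', hk'⟩ ⟨hr, hk⟩
    exact (hl.continuousOn.continuousAt (Ici_mem_nhds (half_lt_self ht))).continuousWithinAt
  have hσpc : ∀ x, ContinuousOn (fun t => σ (p x t)) (Ioi 0) := fun x =>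
    h.continuousOn.comp (hpc x) fun t ht => hppos x t ht
  have hSc : ContinuousOn S (Ioi 0) := fun t ht => by
    have ht2 : 0 < t / 2 := half_pos ht
    obtain ⟨a, b, ha, hab, -⟩ := hbounds (t / 2) ht2
    obtain ⟨C, hC0, hC⟩ := h.exists_bound (b := b) ha
    have hev : ∀ᶠ r in 𝓝 t, t / 2 ≤ r := Ici_mem_nhds (half_lt_self ht)
    refine (continuousAt_of_dominated (bound := fun _ => C) ?_ ?_ (integrable_const _) ?_).continuousWithinAt
    · filter_upwards [hev] with r hr
      exact (h.measurable_comp ha (hmeas r (ht2.trans_le hr)) fun x => (hab x r hr).1).aestronglyMeasurable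
    · filter_upwards [hev] with r hr
      exact Eventually.of_forall fun x => hC _ (hab x r hr)
    · exact Eventually.of_forall fun x => (hσpc x).continuousAt (Ioi_mem_nhds ht)
  have hhc : ∀ x, ContinuousOn (fun t => σ (p x t) - S t) (Ioi 0) := fun x => (hσpc x).sub hSc
  -- On `[s,t]` with `s > 0` the flows share their bounds, so dominated convergence passes to the
  -- limit in the integral equation, for every label.
  have heq : ∀ x s t, 0 < s → s ≤ t → p x t - p x s = -∫ r in s..t, (σ (p x r) - S r) := by
    intro x s t hs0 hst
    obtain ⟨a, b, ha, hab, habk⟩ := hbounds s hs0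
    obtain ⟨C, hC0, hC⟩ := h.exists_bound (b := b) ha
    have h1 : Tendsto (fun k => ∫ r in s..t, (σ (φ k (q₀ x) r) - ∫ y, σ (φ k (p₀ y) r) ∂P)) atTop
        (𝓝 (∫ r in s..t, (σ (p x r) - S r))) := by
      refine intervalIntegral.tendsto_integral_filter_of_dominated_convergence (fun _ => 2 * C) ?_ ?_
        intervalIntegrable_const ?_
      · filter_upwards [hT t] with k hk
        have := ((hs.flow k).intervalIntegrable_deriv h hp (q₀ x) (s := s) (t := t) ⟨hs0.le, hst.trans hk⟩
          ⟨hs0.le.trans hst, hk⟩).aestronglyMeasurable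
        rwa [uIoc_of_le hst]
      · filter_upwards [hT t] with k hk
        refine Eventually.of_forall fun r hr => ?_
        rw [uIoc_of_le hst] at hr
        have hr' : r ∈ Icc s ((k:ℝ) + 1) := ⟨hr.1.le, hr.2.trans hk⟩
        refine (norm_sub_le _ _).trans ?_
        have e1 : ‖σ (φ k (q₀ x) r)‖ ≤ C := hC _ (habk k _ r hr')
        have e2 : ‖∫ y, σ (φ k (p₀ y) r) ∂P‖ ≤ C := hmean_bound fun y => hC _ (habk k _ r hr')
        linarith
      · refine Eventually.of_forall fun r hr => ?_
        rw [uIoc_of_le hst] at hr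
        exact (hσlim x r (hs0.trans hr.1)).sub (hSlim r (hs0.trans hr.1))
    refine tendsto_nhds_unique ((hlim x t (hs0.trans_le hst)).sub (hlim x s hs0)) (h1.neg.congr' ?_)
    filter_upwards [hT t] with k hk
    exact ((hs.flow k).sub_eq_integral h hp _ hs0.le hst hk).symm
  refine ⟨p, ⟨hmeas, fun τ hτ => ?_, hmass, fun x t ht => ?_⟩, ?_⟩
  · obtain ⟨a, b, ha, hab, -⟩ := hbounds τ hτ
    exact ⟨a, b, ha, hab⟩
  · have ht2 : 0 < t / 2 := half_pos ht
    have hsub : uIcc (t / 2) t ⊆ Ioi 0 := by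
      rw [uIcc_of_le (half_le_self ht.le)]
      exact fun r hr => ht2.trans_le hr.1
    have hd : HasDerivAt (fun u => ∫ r in (t / 2)..u, (σ (p x r) - S r)) (σ (p x t) - S t) t :=
      intervalIntegral.integral_hasDerivAt_right ((hhc x).mono hsub).intervalIntegrable
        ((hhc x).stronglyMeasurableAtFilter isOpen_Ioi t ht) ((hhc x).continuousAt (Ioi_mem_nhds ht))
    refine (hd.neg.const_add (p x (t / 2))).congr_of_eventuallyEq ?_
    filter_upwards [Ici_mem_nhds (half_lt_self ht)] with u hu
    have := heq x (t / 2) u ht2 hu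
    simp only [Pi.neg_apply]
    linarith
  -- The datum is attained in `L²` by a three-term split: `p` to `φ k`, small in `k` uniformly for
  -- `t ≤ 1`; `φ k` to its datum `g k`, small as `t → 0` for fixed `k`; and `g k` to `p₀`.
  -- Uniformity in the first term comes from letting `l → ∞` in the mutual distance of `φ k` and `φ
  -- l`.
  · have hsq : ∀ k : ℕ, ∀ t ∈ Ioc (0:ℝ) 1, Integrable (fun x => (p x t - φ k (p₀ x) t) ^ 2) P ∧
        ∫ x, (p x t - φ k (p₀ x) t) ^ 2 ∂P ≤ Real.exp (2 * K) * (4 * (1 / 4) ^ k) := by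
      intro k t ht
      obtain ⟨a, b, ha, hab, habk⟩ := hbounds t ht.1
      have ht1 : ∀ k : ℕ, t ≤ (k:ℝ) + 1 := fun k => by linarith [ht.2, k.cast_nonneg (α := ℝ)]
      have hb1 : ∀ u v, u ∈ Icc a b → v ∈ Icc a b → ‖(u - v) ^ 2‖ ≤ b ^ 2 := fun u v hu hv => by
        rw [norm_pow]
        refine pow_le_pow_left₀ (norm_nonneg _) ?_ 2
        rw [Real.norm_eq_abs, abs_le]
        constructor <;> linarith [hu.1, hu.2, hv.1, hv.2]
      constructor
      · exact Integrable.of_bound (((hmeas t ht.1).sub ((hs.flow k).measurable_label hp t)).pow_const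
          2).aestronglyMeasurable (b ^ 2)
          (Eventually.of_forall fun x => hb1 _ _ (hab x t le_rfl) (habk k _ t ⟨le_rfl, ht1 k⟩))
      · have h1 : Tendsto (fun l => ∫ x, (φ k (p₀ x) t - φ l (p₀ x) t) ^ 2 ∂P) atTop
            (𝓝 (∫ x, (φ k (p₀ x) t - p x t) ^ 2 ∂P)) := by
          refine tendsto_integral_of_dominated_convergence (fun _ => b ^ 2) (fun l => ?_)
            (integrable_const _) (fun l => ?_) ?_
          · exact ((((hs.flow k).measurable_label hp t).sub
              ((hs.flow l).measurable_label hp t)).pow_const 2).aestronglyMeasurable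
          · exact Eventually.of_forall fun x => hb1 _ _ (habk k _ t ⟨le_rfl, ht1 k⟩)
              (habk l _ t ⟨le_rfl, ht1 l⟩)
          · filter_upwards [hlim' t ht.1] with x hx
            exact (hx.const_sub _).pow 2
        have h2 : ∫ x, (p x t - φ k (p₀ x) t) ^ 2 ∂P = ∫ x, (φ k (p₀ x) t - p x t) ^ 2 ∂P :=
          integral_congr_ae (Eventually.of_forall fun x => by simp only; ring)
        rw [h2]
        refine le_of_tendsto h1 ?_
        filter_upwards [eventually_ge_atTop k] with l hl
        refine (hs.dist k l hl t ⟨ht.1.le, ht1 k⟩).trans ?_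
        refine mul_le_mul_of_nonneg_right (Real.exp_le_exp.2 ?_) (by positivity)
        have := mul_le_mul_of_nonneg_left ht.2 (by positivity : 0 ≤ 2 * K)
        linarith
    have hcont0 : ∀ k : ℕ, Tendsto (fun t => ∫ x, (φ k (p₀ x) t - g k (p₀ x)) ^ 2 ∂P) (𝓝[>] 0) (𝓝 0) ∧
        ∀ t ∈ Ioc (0:ℝ) 1, Integrable (fun x => (φ k (p₀ x) t - g k (p₀ x)) ^ 2) P := by
      intro k
      obtain ⟨A, B, hA, hb⟩ := (hs.flow k).bounds
      have hk0 : (0:ℝ) ∈ Icc (0:ℝ) ((k:ℝ) + 1) := ⟨le_rfl, by positivity⟩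
      have hk1 : ∀ t ∈ Ioc (0:ℝ) 1, t ∈ Icc (0:ℝ) ((k:ℝ) + 1) := fun t ht =>
        ⟨ht.1.le, by linarith [ht.2, k.cast_nonneg (α := ℝ)]⟩
      have hm : ∀ t, AEStronglyMeasurable (fun x => (φ k (p₀ x) t - g k (p₀ x)) ^ 2) P := fun t => by
        simp only [← (hs.flow k).initial]
        exact ((((hs.flow k).measurable_label hp t).sub
              ((hs.flow k).measurable_label hp 0)).pow_const 2).aestronglyMeasurable
      have hbd : ∀ t ∈ Ioc (0:ℝ) 1, ∀ᵐ x ∂P, ‖(φ k (p₀ x) t - g k (p₀ x)) ^ 2‖ ≤ B ^ 2 := fun t ht =>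
        Eventually.of_forall fun x => by
          rw [norm_pow, ← (hs.flow k).initial]
          refine pow_le_pow_left₀ (norm_nonneg _) ?_ 2
          have e1 := hb (p₀ x) t (hk1 t ht)
          have e2 := hb (p₀ x) 0 hk0
          rw [Real.norm_eq_abs, abs_le]
          constructor <;> linarith [e1.1, e1.2, e2.1, e2.2]
      refine ⟨?_, fun t ht => Integrable.of_bound (hm t) _ (hbd t ht)⟩
      have := tendsto_integral_filter_of_dominated_convergence (μ := P) (l := 𝓝[>] (0:ℝ))
        (F := fun t x => (φ k (p₀ x) t - g k (p₀ x)) ^ 2) (f := fun _ => 0) (fun _ => B ^ 2)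
        (Eventually.of_forall hm) (by
          filter_upwards [Ioc_mem_nhdsGT (zero_lt_one (α := ℝ))] with t ht
          exact hbd t ht) (integrable_const _)
        (Eventually.of_forall fun x => by
          have h1 : Tendsto (φ k (p₀ x)) (𝓝[>] 0) (𝓝 (φ k (p₀ x) 0)) :=
            ((hs.flow k).continuous_time (p₀ x)).continuousAt.tendsto.mono_left nhdsWithin_le_nhds
          rw [(hs.flow k).initial] at h1
          simpa using (h1.sub_const (g k (p₀ x))).pow 2)
      simpa using this
    rw [Metric.tendsto_nhds]
    intro ε hε
    have hgeo : Tendsto (fun k : ℕ => 3 * (Real.exp (2 * K) * 4 + 1) * (1 / 4 : ℝ) ^ k) atTop (𝓝 0) := by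
      simpa using (tendsto_pow_atTop_nhds_zero_of_lt_one (r := (1 / 4 : ℝ)) (by norm_num)
        (by norm_num)).const_mul (3 * (Real.exp (2 * K) * 4 + 1))
    obtain ⟨k, hk⟩ := (hgeo.eventually_lt_const (half_pos hε)).exists
    filter_upwards [Ioc_mem_nhdsGT (zero_lt_one (α := ℝ)),
      (hcont0 k).1.eventually_lt_const (show (0:ℝ) < ε / 6 by linarith)] with t ht hc
    rw [dist_zero_right, Real.norm_of_nonneg (integral_nonneg fun x => sq_nonneg _)]
    obtain ⟨hi1, hle1⟩ := hsq k t ht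
    have hi2 := (hcont0 k).2 t ht
    have hi3 := hs.integrable_data k
    have h4 : ∫ x, (p x t - p₀ x) ^ 2 ∂P ≤ ∫ x, (3 * (p x t - φ k (p₀ x) t) ^ 2 +
        3 * (φ k (p₀ x) t - g k (p₀ x)) ^ 2 + 3 * (g k (p₀ x) - p₀ x) ^ 2) ∂P := by
      refine integral_mono_of_nonneg (Eventually.of_forall fun x => sq_nonneg _)
        (((hi1.const_mul 3).add (hi2.const_mul 3)).add (hi3.const_mul 3)) (Eventually.of_forall fun x => ?_)
      simp only
      nlinarith [sq_nonneg ((p x t - φ k (p₀ x) t) - (φ k (p₀ x) t - g k (p₀ x))),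
        sq_nonneg ((p x t - φ k (p₀ x) t) - (g k (p₀ x) - p₀ x)),
        sq_nonneg ((φ k (p₀ x) t - g k (p₀ x)) - (g k (p₀ x) - p₀ x))]
    rw [integral_add (f := fun x => 3 * (p x t - φ k (p₀ x) t) ^ 2 + 3 * (φ k (p₀ x) t - g k (p₀ x)) ^ 2)
      ((hi1.const_mul 3).add (hi2.const_mul 3)) (hi3.const_mul 3), integral_add (hi1.const_mul 3) (hi2.const_mul 3), integral_const_mul, integral_const_mul,
      integral_const_mul] at h4
    linarith [hs.data k]

end

/-! ### Affine relations between the three roots -/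

section

/-- Second order expansion at a critical point. -/
lemma tendsto_sub_div_sq {σ : ℝ → ℝ} {z : ℝ} (ha : AnalyticAt ℝ σ z) (h1 : deriv σ z = 0) :
    Tendsto (fun p => (σ p - σ z) / (p - z) ^ 2) (𝓝[≠] z) (𝓝 (iteratedDeriv 2 σ z / 2)) := by
  have hd2 : HasDerivAt (deriv σ) (iteratedDeriv 2 σ z) z := by
    rw [iteratedDeriv_succ, iteratedDeriv_one]
    exact ha.deriv.differentiableAt.hasDerivAt
  have hg : ∀ x, HasDerivAt (fun p : ℝ => (p - z) ^ 2) (2 * (x - z)) x := fun x => by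
    simpa using ((hasDerivAt_id x).sub_const z).fun_pow 2
  have hev : ∀ᶠ x in 𝓝 z, DifferentiableAt ℝ σ x :=
    ha.eventually_analyticAt.mono fun x hx => hx.differentiableAt
  refine deriv.lhopital_zero_nhdsNE ?_ ?_ ?_ ?_ ?_
  · filter_upwards [eventually_nhdsWithin_of_eventually_nhds hev] with x hx
    exact hx.sub_const _
  · filter_upwards [self_mem_nhdsWithin] with x hx
    rw [(hg x).deriv]
    exact mul_ne_zero two_ne_zero (sub_ne_zero.2 hx)
  · have : ContinuousAt (fun p => σ p - σ z) z := ha.continuousAt.sub continuousAt_const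
    simpa [ContinuousAt] using this.tendsto.mono_left nhdsWithin_le_nhds
  · have : ContinuousAt (fun p : ℝ => (p - z) ^ 2) z := by fun_prop
    simpa [ContinuousAt] using this.tendsto.mono_left nhdsWithin_le_nhds
  · have := (hasDerivAt_iff_tendsto_slope.1 hd2).div_const 2
    refine this.congr' ?_
    filter_upwards [self_mem_nhdsWithin] with x hx
    rw [(hg x).deriv, slope_def_field, h1, deriv_sub_const, sub_zero, div_div, mul_comm]

/-- If three roots of `σ = c` obey an affine relation while `c` tends to a nondegenerate critical value,
then the weights of the two merging roots agree. -/
lemma weights_eq_of_merging {σ : ℝ → ℝ} {z w A B E m : ℝ} {q r s : ℝ → ℝ} {F : Filter ℝ} [F.NeBot]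
    (hz : AnalyticAt ℝ σ z) (hz1 : deriv σ z = 0) (hz2 : iteratedDeriv 2 σ z ≠ 0)
    (hw : DifferentiableAt ℝ σ w) (hw1 : deriv σ w ≠ 0) (hzw : σ z = σ w)
    (hq : Tendsto q F (𝓝[<] z)) (hr : Tendsto r F (𝓝[>] z)) (hs : Tendsto s F (𝓝[≠] w))
    (hqr : ∀ᶠ c in F, σ (q c) = σ (r c)) (hsr : ∀ᶠ c in F, σ (s c) = σ (r c))
    (hrel : ∀ᶠ c in F, A * q c + B * r c + E * s c = m) : A = B := by
  have hκ := tendsto_sub_div_sq hz hz1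
  have hκ0 : iteratedDeriv 2 σ z / 2 ≠ 0 := div_ne_zero hz2 two_ne_zero
  have hq' : Tendsto q F (𝓝[≠] z) := hq.mono_right (nhdsWithin_mono _ fun x hx => ne_of_lt hx)
  have hr' : Tendsto r F (𝓝[≠] z) := hr.mono_right (nhdsWithin_mono _ fun x hx => ne_of_gt hx)
  have hqlt : ∀ᶠ c in F, q c < z := hq.eventually self_mem_nhdsWithin
  have hrgt : ∀ᶠ c in F, z < r c := hr.eventually self_mem_nhdsWithin
  have hsne : ∀ᶠ c in F, s c ≠ w := hs.eventually self_mem_nhdsWithin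
  have hkr := hκ.comp hr'
  have hkq := hκ.comp hq'
  -- Both `σ(q)` and `σ(r)` depart quadratically from `σ(z)` with the same coefficient, and they are
  -- equal, so the distances of `q` and `r` from `z` are asymptotically the same.
  have hratio : Tendsto (fun c => (z - q c) / (r c - z)) F (𝓝 1) := by
    have h1 := (hkr.div hkq hκ0).sqrt
    rw [div_self hκ0, Real.sqrt_one] at h1
    have hkqne := hkq.eventually_ne hκ0
    refine h1.congr' ?_
    filter_upwards [hqlt, hrgt, hqr, hkqne] with c h1 h2 h3 h4
    simp only [Function.comp, Pi.div_apply] at h4 ⊢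
    have hσ : σ (r c) - σ z ≠ 0 := by
      rw [← h3]
      exact fun h0 => h4 (by rw [h0, zero_div])
    have e : (σ (r c) - σ z) / (r c - z) ^ 2 / ((σ (q c) - σ z) / (q c - z) ^ 2) =
        ((z - q c) / (r c - z)) ^ 2 := by
      rw [h3, div_div_div_eq, mul_comm (σ (r c) - σ z), mul_div_mul_right _ _ hσ, div_pow]
      congr 1
      ring
    rw [e, Real.sqrt_sq (div_nonneg (by linarith) (by linarith))]
  -- `σ` is invertible to first order at `w`, so `s - w` is of the order of `σ(r) - σ(z)`, that is
  -- of `(r - z)²`.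
  have hthird : Tendsto (fun c => (s c - w) / (r c - z)) F (𝓝 0) := by
    have h1 := ((hasDerivAt_iff_tendsto_slope.1 hw.hasDerivAt).comp hs).inv₀ hw1
    have h2 : Tendsto (fun c => r c - z) F (𝓝 0) := by
      have := (hr.mono_right nhdsWithin_le_nhds).sub_const z
      rwa [sub_self] at this
    have h3 := (h1.mul hkr).mul h2
    rw [mul_zero] at h3
    have hkrne := hkr.eventually_ne hκ0
    refine h3.congr' ?_
    filter_upwards [hrgt, hsr, hkrne] with c h2 h3 h4
    simp only [Function.comp] at h4 ⊢
    have hσ : σ (r c) - σ z ≠ 0 := fun h0 => h4 (by rw [h0, zero_div])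
    rw [slope_def_field, h3, ← hzw]
    have : r c - z ≠ 0 := (sub_pos.2 h2).ne'
    field_simp
  have hlimit : A * z + B * z + E * w = m := by
    have h1 := (((hq.mono_right nhdsWithin_le_nhds).const_mul A).add
      ((hr.mono_right nhdsWithin_le_nhds).const_mul B)).add ((hs.mono_right nhdsWithin_le_nhds).const_mul E)
    exact tendsto_nhds_unique h1 (tendsto_const_nhds.congr' (hrel.mono fun c hc => hc.symm))
  -- The affine relation minus its limit, divided by `r - z`.
  have hfin : Tendsto (fun c => -(A * ((z - q c) / (r c - z))) + B + E * ((s c - w) / (r c - z))) F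
      (𝓝 (-(A * 1) + B + E * 0)) :=
    ((hratio.const_mul A).neg.add_const B).add (hthird.const_mul E)
  have h0 : -(A * 1) + B + E * 0 = 0 := by
    refine tendsto_nhds_unique hfin (tendsto_const_nhds.congr' ?_)
    filter_upwards [hrgt, hrel] with c h1 h2
    have : r c - z ≠ 0 := (sub_pos.2 h1).ne'
    field_simp
    linarith
  linarith

namespace CubicShape

variable {σ : ℝ → ℝ} {z₁ z₂ : ℝ}

lemma exists_left (h : CubicShape σ z₁ z₂) {c : ℝ} (hc : c < σ z₁) : ∃ p ∈ Ioo 0 z₁, σ p = c := by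
  obtain ⟨r, hr0, hr1, hr⟩ := h.exists_small (c - 1) z₁ h.pos
  have hcont : ContinuousOn σ (Icc r z₁) := h.continuousOn.mono fun x hx => hr0.trans_le hx.1
  obtain ⟨p, hp, hpc⟩ := intermediate_value_Ioo hr1.le hcont ⟨by linarith [hr r hr0 le_rfl], hc⟩
  exact ⟨p, ⟨hr0.trans hp.1, hp.2⟩, hpc⟩

lemma exists_middle (h : CubicShape σ z₁ z₂) {c : ℝ} (hc : c ∈ Ioo (σ z₂) (σ z₁)) :
    ∃ p ∈ Ioo z₁ z₂, σ p = c := by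
  have hcont : ContinuousOn σ (Icc z₁ z₂) := h.continuousOn.mono fun x hx => h.pos.trans_le hx.1
  obtain ⟨p, hp, hpc⟩ := intermediate_value_Ioo' h.lt.le hcont hc
  exact ⟨p, hp, hpc⟩

lemma exists_right (h : CubicShape σ z₁ z₂) {c : ℝ} (hc : σ z₂ < c) : ∃ p ∈ Ioi z₂, σ p = c := by
  obtain ⟨r, hr0, hr⟩ := h.exists_large (c + 1) z₂
  have hcont : ContinuousOn σ (Icc z₂ r) := h.continuousOn.mono fun x hx => h.pos'.trans_le hx.1
  obtain ⟨p, hp, hpc⟩ := intermediate_value_Ioo hr0.le hcont ⟨hc, by linarith [hr r le_rfl]⟩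
  exact ⟨p, hp.1, hpc⟩

/-- Branches of the inverse of `σ` are analytic. -/
lemma analyticAt_branch (h : CubicShape σ z₁ z₂) {s : Set ℝ} (hs : IsOpen s) (hs0 : s ⊆ Ioi 0)
    (hs1 : z₁ ∉ s) (hs2 : z₂ ∉ s) (hinj : InjOn σ s) {J : Set ℝ} (hJ : IsOpen J) {q : ℝ → ℝ}
    (hq : ∀ c ∈ J, q c ∈ s ∧ σ (q c) = c) : AnalyticOnNhd ℝ q J := by
  intro c hc
  obtain ⟨hqs, hσ⟩ := hq c hc
  have hpos : 0 < q c := hs0 hqs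
  have ha := h.analytic (q c) hpos
  have hd : deriv σ (q c) ≠ 0 := h.deriv_ne _ hpos (fun e => hs1 (e ▸ hqs)) (fun e => hs2 (e ▸ hqs))
  -- At a noncritical point `σ` is a local analytic isomorphism, so it suffices that `q ∘ σ` is
  -- analytic; near `q c` it is the identity.
  rw [← hσ, ← analyticAt_comp_iff_of_deriv_ne_zero ha hd]
  refine analyticAt_id.congr ?_
  have hJ' : ∀ᶠ p in 𝓝 (q c), σ p ∈ J := ha.continuousAt.eventually (by rw [hσ]; exact hJ.mem_nhds hc)
  filter_upwards [hs.mem_nhds hqs, hJ'] with p hp hpJ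
  exact (hinj (hq _ hpJ).1 hp (hq _ hpJ).2).symm

/-- Strict monotonicity turns bounds on the level into bounds on the root. The endpoint `w = z₁` is
allowed, which is what the merging argument needs. -/
lemma tendsto_left (h : CubicShape σ z₁ z₂) {q : ℝ → ℝ} {F : Filter ℝ} {w : ℝ} (hw : 0 < w) (hw1 : w ≤ z₁)
    (hF : Tendsto id F (𝓝 (σ w))) (hq : ∀ᶠ c in F, q c ∈ Ioo 0 z₁ ∧ σ (q c) = c) : Tendsto q F (𝓝 w) := by
  refine tendsto_order.2 ⟨fun a ha => ?_, fun b hb => ?_⟩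
  · have hm : max a (w / 2) < w := max_lt ha (by linarith)
    have h0 : 0 < max a (w / 2) := lt_max_of_lt_right (by linarith)
    have hσ : σ (max a (w / 2)) < σ w := h.mono_left ⟨h0, hm.le.trans hw1⟩ ⟨hw, hw1⟩ hm
    filter_upwards [hq, hF.eventually_const_lt hσ] with c hc hlt
    rw [id, ← hc.2] at hlt
    exact (le_max_left _ _).trans_lt
      ((h.mono_left.lt_iff_lt ⟨h0, hm.le.trans hw1⟩ ⟨hc.1.1, hc.1.2.le⟩).1 hlt)
  · rcases hw1.eq_or_lt with rfl | hw1
    · filter_upwards [hq] with c hc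
      exact hc.1.2.trans hb
    · have hm : w < min b z₁ := lt_min hb hw1
      have hσ : σ w < σ (min b z₁) := h.mono_left ⟨hw, hw1.le⟩ ⟨hw.trans hm, min_le_right _ _⟩ hm
      filter_upwards [hq, hF.eventually_lt_const hσ] with c hc hlt
      rw [id, ← hc.2] at hlt
      exact ((h.mono_left.lt_iff_lt ⟨hc.1.1, hc.1.2.le⟩ ⟨hw.trans hm, min_le_right _ _⟩).1 hlt).trans_le
        (min_le_left _ _)

lemma tendsto_middle (h : CubicShape σ z₁ z₂) {q : ℝ → ℝ} {F : Filter ℝ} {w : ℝ} (hw : w ∈ Icc z₁ z₂)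
    (hF : Tendsto id F (𝓝 (σ w))) (hq : ∀ᶠ c in F, q c ∈ Ioo z₁ z₂ ∧ σ (q c) = c) : Tendsto q F (𝓝 w) := by
  refine tendsto_order.2 ⟨fun a ha => ?_, fun b hb => ?_⟩
  · rcases hw.1.eq_or_lt with rfl | hw1
    · filter_upwards [hq] with c hc
      exact ha.trans hc.1.1
    · have hm : max a z₁ < w := max_lt ha hw1
      have hmem : max a z₁ ∈ Icc z₁ z₂ := ⟨le_max_right _ _, hm.le.trans hw.2⟩
      have hσ := h.anti hmem hw hm
      filter_upwards [hq, hF.eventually_lt_const hσ] with c hc hlt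
      rw [id, ← hc.2] at hlt
      exact (le_max_left _ _).trans_lt ((h.anti.lt_iff_gt (Ioo_subset_Icc_self hc.1) hmem).1 hlt)
  · rcases hw.2.eq_or_lt with rfl | hw1
    · filter_upwards [hq] with c hc
      exact hc.1.2.trans hb
    · have hm : w < min b z₂ := lt_min hb hw1
      have hmem : min b z₂ ∈ Icc z₁ z₂ := ⟨hw.1.trans hm.le, min_le_right _ _⟩
      have hσ := h.anti hw hmem hm
      filter_upwards [hq, hF.eventually_const_lt hσ] with c hc hlt
      rw [id, ← hc.2] at hlt
      exact ((h.anti.lt_iff_gt hmem (Ioo_subset_Icc_self hc.1)).1 hlt).trans_le (min_le_left _ _)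

lemma tendsto_right (h : CubicShape σ z₁ z₂) {q : ℝ → ℝ} {F : Filter ℝ} {w : ℝ} (hw : z₂ ≤ w)
    (hF : Tendsto id F (𝓝 (σ w))) (hq : ∀ᶠ c in F, q c ∈ Ioi z₂ ∧ σ (q c) = c) : Tendsto q F (𝓝 w) := by
  refine tendsto_order.2 ⟨fun a ha => ?_, fun b hb => ?_⟩
  · rcases hw.eq_or_lt with rfl | hw1
    · filter_upwards [hq] with c hc
      exact ha.trans hc.1
    · have hm : max a z₂ < w := max_lt ha hw1
      have hmem : max a z₂ ∈ Ici z₂ := mem_Ici.2 (le_max_right _ _)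
      have hσ := h.mono_right hmem hw hm
      filter_upwards [hq, hF.eventually_const_lt hσ] with c hc hlt
      rw [id, ← hc.2] at hlt
      exact (le_max_left _ _).trans_lt ((h.mono_right.lt_iff_lt hmem (Ioi_subset_Ici_self hc.1)).1 hlt)
  · have hmem : b ∈ Ici z₂ := hw.trans hb.le
    have hσ := h.mono_right hw hmem hb
    filter_upwards [hq, hF.eventually_lt_const hσ] with c hc hlt
    rw [id, ← hc.2] at hlt
    exact (h.mono_right.lt_iff_lt (Ioi_subset_Ici_self hc.1) hmem).1 hlt

/-- An affine relation between the three roots that holds on a nondegenerate interval of levels forces the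
mean of the three roots to be constant. -/
theorem mean_roots_eq (h : CubicShape σ z₁ z₂) (hz₁ : iteratedDeriv 2 σ z₁ ≠ 0)
    (hz₂ : iteratedDeriv 2 σ z₂ ≠ 0) {A B E m c₁ c₂ : ℝ} (hsum : A + B + E = 1) (hc₁ : σ z₂ ≤ c₁)
    (hc : c₁ < c₂) (hc₂ : c₂ ≤ σ z₁)
    (hrel : ∀ p₁ ∈ Ioo 0 z₁, ∀ p₂ ∈ Ioo z₁ z₂, ∀ p₃ ∈ Ioi z₂, ∀ c ∈ Ioo c₁ c₂,
      σ p₁ = c → σ p₂ = c → σ p₃ = c → A * p₁ + B * p₂ + E * p₃ = m) :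
    ∀ p₁ ∈ Ioo 0 z₁, ∀ p₂ ∈ Ioo z₁ z₂, ∀ p₃ ∈ Ioi z₂, ∀ c ∈ Ioo (σ z₂) (σ z₁),
      σ p₁ = c → σ p₂ = c → σ p₃ = c → (1 / 3) * (p₁ + p₂ + p₃) = m := by
  have e1 : ∀ c, ∃ p, c ∈ Ioo (σ z₂) (σ z₁) → p ∈ Ioo 0 z₁ ∧ σ p = c := fun c => by
    by_cases hc : c ∈ Ioo (σ z₂) (σ z₁)
    · obtain ⟨p, hp, hpc⟩ := h.exists_left hc.2
      exact ⟨p, fun _ => ⟨hp, hpc⟩⟩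
    · exact ⟨0, fun h => absurd h hc⟩
  have e2 : ∀ c, ∃ p, c ∈ Ioo (σ z₂) (σ z₁) → p ∈ Ioo z₁ z₂ ∧ σ p = c := fun c => by
    by_cases hc : c ∈ Ioo (σ z₂) (σ z₁)
    · obtain ⟨p, hp, hpc⟩ := h.exists_middle hc
      exact ⟨p, fun _ => ⟨hp, hpc⟩⟩
    · exact ⟨0, fun h => absurd h hc⟩
  have e3 : ∀ c, ∃ p, c ∈ Ioo (σ z₂) (σ z₁) → p ∈ Ioi z₂ ∧ σ p = c := fun c => by
    by_cases hc : c ∈ Ioo (σ z₂) (σ z₁)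
    · obtain ⟨p, hp, hpc⟩ := h.exists_right hc.1
      exact ⟨p, fun _ => ⟨hp, hpc⟩⟩
    · exact ⟨0, fun h => absurd h hc⟩
  choose q₁ hq₁ using e1
  choose q₂ hq₂ using e2
  choose q₃ hq₃ using e3
  have i1 : InjOn σ (Ioo 0 z₁) := h.mono_left.injOn.mono Ioo_subset_Ioc_self
  have i2 : InjOn σ (Ioo z₁ z₂) := h.anti.injOn.mono Ioo_subset_Icc_self
  have i3 : InjOn σ (Ioi z₂) := h.mono_right.injOn.mono Ioi_subset_Ici_self
  have a1 := h.analyticAt_branch isOpen_Ioo (fun x hx => hx.1) (fun hx => lt_irrefl _ hx.2)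
    (fun hx => lt_asymm hx.2 h.lt) i1 isOpen_Ioo hq₁
  have a2 := h.analyticAt_branch isOpen_Ioo (fun x hx => h.pos.trans hx.1) (fun hx => lt_irrefl _ hx.1)
    (fun hx => lt_irrefl _ hx.2) i2 isOpen_Ioo hq₂
  have a3 := h.analyticAt_branch isOpen_Ioi (fun x hx => h.pos'.trans hx) (fun hx => lt_asymm (mem_Ioi.1 hx) h.lt)
    (fun hx => lt_irrefl _ (mem_Ioi.1 hx)) i3 isOpen_Ioo hq₃
  have hall : ∀ c ∈ Ioo (σ z₂) (σ z₁), A * q₁ c + B * q₂ c + E * q₃ c = m := by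
    have hG : AnalyticOnNhd ℝ (fun c => A * q₁ c + B * q₂ c + E * q₃ c) (Ioo (σ z₂) (σ z₁)) :=
      ((analyticOnNhd_const.mul a1).add (analyticOnNhd_const.mul a2)).add (analyticOnNhd_const.mul a3)
    have hmid : (c₁ + c₂) / 2 ∈ Ioo c₁ c₂ := ⟨by linarith, by linarith⟩
    have hsub : Ioo c₁ c₂ ⊆ Ioo (σ z₂) (σ z₁) := Ioo_subset_Ioo hc₁ hc₂
    -- The identity theorem spreads the relation from `(c₁,c₂)` to all levels between the critical
    -- values.
    refine hG.eqOn_of_preconnected_of_eventuallyEq (g := fun _ => m) analyticOnNhd_const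
      isPreconnected_Ioo (hsub hmid) ?_
    filter_upwards [Ioo_mem_nhds hmid.1 hmid.2] with c hcc
    have hc' := hsub hcc
    exact hrel _ (hq₁ c hc').1 _ (hq₂ c hc').1 _ (hq₃ c hc').1 c hcc (hq₁ c hc').2 (hq₂ c hc').2
      (hq₃ c hc').2
  -- As `c ↑ σ(z₁)` the first two roots merge at `z₁`.
  have hAB : A = B := by
    have hF : ∀ᶠ c in 𝓝[<] (σ z₁), c ∈ Ioo (σ z₂) (σ z₁) := Ioo_mem_nhdsLT h.value_lt
    have hid : Tendsto id (𝓝[<] (σ z₁)) (𝓝 (σ z₁)) := tendsto_id.mono_right nhdsWithin_le_nhds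
    obtain ⟨w, hw, hwσ⟩ := h.exists_right h.value_lt
    have hw0 : 0 < w := h.pos'.trans hw
    refine weights_eq_of_merging (F := 𝓝[<] (σ z₁)) (z := z₁) (w := w) (q := q₁) (r := q₂) (s := q₃)
      (m := m) (E := E) (h.analytic _ h.pos) h.deriv_left hz₁ (h.analytic w hw0).differentiableAt
      (h.deriv_ne w hw0 (h.lt.trans hw).ne' (ne_of_gt hw)) hwσ.symm ?_ ?_ ?_
      (hF.mono fun c hc => (hq₁ c hc).2.trans (hq₂ c hc).2.symm)
      (hF.mono fun c hc => (hq₃ c hc).2.trans (hq₂ c hc).2.symm) (hF.mono hall)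
    · exact tendsto_nhdsWithin_iff.2 ⟨h.tendsto_left h.pos le_rfl hid (hF.mono hq₁),
        hF.mono fun c hc => (hq₁ c hc).1.2⟩
    · exact tendsto_nhdsWithin_iff.2 ⟨h.tendsto_middle (left_mem_Icc.2 h.lt.le) hid (hF.mono hq₂),
        hF.mono fun c hc => (hq₂ c hc).1.1⟩
    · exact tendsto_nhdsWithin_iff.2 ⟨h.tendsto_right (le_of_lt hw) (by rwa [hwσ]) (hF.mono hq₃),
        hF.mono fun c hc e => by
          have := (hq₃ c hc).2
          rw [e, hwσ] at this
          exact hc.2.ne this.symm⟩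
  -- As `c ↓ σ(z₂)` the last two roots merge at `z₂`.
  have hBE : B = E := by
    have hF : ∀ᶠ c in 𝓝[>] (σ z₂), c ∈ Ioo (σ z₂) (σ z₁) := Ioo_mem_nhdsGT h.value_lt
    have hid : Tendsto id (𝓝[>] (σ z₂)) (𝓝 (σ z₂)) := tendsto_id.mono_right nhdsWithin_le_nhds
    obtain ⟨w, hw, hwσ⟩ := h.exists_left h.value_lt
    refine weights_eq_of_merging (F := 𝓝[>] (σ z₂)) (z := z₂) (w := w) (q := q₂) (r := q₃) (s := q₁)
      (m := m) (E := A) (h.analytic _ h.pos') h.deriv_right hz₂ (h.analytic w hw.1).differentiableAt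
      (h.deriv_ne w hw.1 hw.2.ne (hw.2.trans h.lt).ne) hwσ.symm ?_ ?_ ?_
      (hF.mono fun c hc => (hq₂ c hc).2.trans (hq₃ c hc).2.symm)
      (hF.mono fun c hc => (hq₁ c hc).2.trans (hq₃ c hc).2.symm)
      (hF.mono fun c hc => by linarith [hall c hc])
    · exact tendsto_nhdsWithin_iff.2 ⟨h.tendsto_middle (right_mem_Icc.2 h.lt.le) hid (hF.mono hq₂),
        hF.mono fun c hc => (hq₂ c hc).1.2⟩
    · exact tendsto_nhdsWithin_iff.2 ⟨h.tendsto_right le_rfl hid (hF.mono hq₃),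
        hF.mono fun c hc => (hq₃ c hc).1⟩
    · exact tendsto_nhdsWithin_iff.2 ⟨h.tendsto_left hw.1 hw.2.le (by rwa [hwσ]) (hF.mono hq₁),
        hF.mono fun c hc e => by
          have := (hq₁ c hc).2
          rw [e, hwσ] at this
          exact hc.1.ne this⟩
  intro p₁ hp₁ p₂ hp₂ p₃ hp₃ c hc h1 h2 h3
  rw [← hall c hc, i1 hp₁ (hq₁ c hc).1 (h1.trans (hq₁ c hc).2.symm),
    i2 hp₂ (hq₂ c hc).1 (h2.trans (hq₂ c hc).2.symm), i3 hp₃ (hq₃ c hc).1 (h3.trans (hq₃ c hc).2.symm)]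
  have hA : A = 1 / 3 := by linarith
  have hB : B = 1 / 3 := by linarith
  have hE : E = 1 / 3 := by linarith
  rw [hA, hB, hE]
  ring

end CubicShape

end

/-! ### Energy and dissipation -/

section

set_option linter.unusedSectionVars false

variable {Ω : Type*} [MeasurableSpace Ω] {P : Measure Ω} [IsProbabilityMeasure P]

/-- A solution of the evolution equation for times `t > 1` with values in a compact subinterval of `(0,∞)`. -/
structure BoundedFlow (σ : ℝ → ℝ) (P : Measure Ω) (μ a b : ℝ) (p : Ω → ℝ → ℝ) : Prop where
  pos : 0 < a
  measurable : ∀ t, Measurable fun x => p x t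
  continuous : ∀ x, Continuous (p x)
  mem : ∀ x t, p x t ∈ Icc a b
  mass : ∀ t, ∫ x, p x t ∂P = μ
  deriv : ∀ x t, 1 < t → HasDerivAt (p x) (-(σ (p x t) - ∫ y, σ (p y t) ∂P)) t

/-- The mean stress at time `t`. -/
noncomputable def meanStress (σ : ℝ → ℝ) (P : Measure Ω) (p : Ω → ℝ → ℝ) (t : ℝ) : ℝ :=
  ∫ y, σ (p y t) ∂P

/-- The deviation of the stress from its mean. -/
noncomputable def defect (σ : ℝ → ℝ) (P : Measure Ω) (p : Ω → ℝ → ℝ) (x : Ω) (t : ℝ) : ℝ :=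
  σ (p x t) - meanStress σ P p t

/-- The rate of energy dissipation. -/
noncomputable def dissipation (σ : ℝ → ℝ) (P : Measure Ω) (p : Ω → ℝ → ℝ) (t : ℝ) : ℝ :=
  ∫ x, defect σ P p x t ^ 2 ∂P

lemma integral_intervalIntegral_swap {G : Ω → ℝ → ℝ} {C s t : ℝ} (hst : s ≤ t)
    (hc : ∀ x, Continuous (G x)) (hm : ∀ t, Measurable fun x => G x t) (hC : ∀ x t, |G x t| ≤ C) :
    ∫ x, (∫ r in s..t, G x r) ∂P = ∫ r in s..t, (∫ x, G x r ∂P) := by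
  simp only [intervalIntegral.integral_of_le hst]
  refine integral_integral_swap ?_
  have h1 : Measurable (Function.uncurry fun t x => G x t) :=
    measurable_uncurry_of_continuous_of_measurable hc hm
  exact Integrable.of_bound (h1.comp measurable_swap).aestronglyMeasurable C
    (Eventually.of_forall fun z => hC z.1 z.2)

/-- A function that reaches height `η` and grows at rate at most `Λ` was at least `η/2` during the
preceding time `η/(2Λ)`. This quantifies what a visit to height `η` costs. -/
lemma sq_div_le_integral_of_lipschitz {f : ℝ → ℝ} {s r t η Λ : ℝ} (hΛ : 0 < Λ) (hη : 0 < η)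
    (hf0 : ∀ x, 0 ≤ f x) (hfc : Continuous f) (hlip : ∀ x ∈ Icc s r, f r - f x ≤ Λ * (r - x))
    (hr : η ≤ f r) (hsr : η / (2 * Λ) ≤ r - s) (hrt : r ≤ t) : η ^ 2 / (4 * Λ) ≤ ∫ x in s..t, f x := by
  have hd : 0 < η / (2 * Λ) := by positivity
  have h1 : ∫ _ in (r - η / (2 * Λ))..r, η / 2 ≤ ∫ x in (r - η / (2 * Λ))..r, f x := by
    refine intervalIntegral.integral_mono_on (by linarith) intervalIntegrable_const
      (hfc.intervalIntegrable _ _) fun x hx => ?_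
    have h2 := hlip x ⟨by linarith [hx.1], hx.2⟩
    have h3 : Λ * (r - x) ≤ Λ * (η / (2 * Λ)) := mul_le_mul_of_nonneg_left (by linarith [hx.1]) hΛ.le
    have h4 : Λ * (η / (2 * Λ)) = η / 2 := by field_simp
    linarith
  have h2 : ∫ x in (r - η / (2 * Λ))..r, f x ≤ ∫ x in s..t, f x :=
    intervalIntegral.integral_mono_interval (by linarith) (by linarith) hrt
      (Eventually.of_forall hf0) (hfc.intervalIntegrable _ _)
  rw [intervalIntegral.integral_const, smul_eq_mul] at h1
  have h3 : (r - (r - η / (2 * Λ))) * (η / 2) = η ^ 2 / (4 * Λ) := by field_simp; ring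
  linarith

namespace BoundedFlow

variable {σ : ℝ → ℝ} {z₁ z₂ μ a b : ℝ} {p : Ω → ℝ → ℝ}

lemma pos_value (hp : BoundedFlow σ P μ a b p) (x : Ω) (t : ℝ) : 0 < p x t := hp.pos.trans_le (hp.mem x t).1

lemma integrable (hp : BoundedFlow σ P μ a b p) (t : ℝ) : Integrable (fun x => p x t) P :=
  Integrable.of_bound (hp.measurable t).aestronglyMeasurable b (Eventually.of_forall fun x => by
    rw [Real.norm_of_nonneg (hp.pos_value x t).le]
    exact (hp.mem x t).2)

lemma measurable_stress (hp : BoundedFlow σ P μ a b p) (h : CubicShape σ z₁ z₂) (t : ℝ) :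
    Measurable fun x => σ (p x t) :=
  h.measurable_comp hp.pos (hp.measurable t) fun x => (hp.mem x t).1

lemma measurable_defect (hp : BoundedFlow σ P μ a b p) (h : CubicShape σ z₁ z₂) (t : ℝ) :
    Measurable fun x => defect σ P p x t := (hp.measurable_stress h t).sub_const _

lemma continuous_stress (hp : BoundedFlow σ P μ a b p) (h : CubicShape σ z₁ z₂) (x : Ω) :
    Continuous fun t => σ (p x t) :=
  h.continuousOn.comp_continuous (hp.continuous x) fun t => hp.pos_value x t

lemma continuous_meanStress (hp : BoundedFlow σ P μ a b p) (h : CubicShape σ z₁ z₂) :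
    Continuous (meanStress σ P p) := by
  obtain ⟨C, -, hC⟩ := h.exists_bound (b := b) hp.pos
  exact continuous_of_dominated (bound := fun _ => C)
    (fun t => (hp.measurable_stress h t).aestronglyMeasurable)
    (fun t => Eventually.of_forall fun x => hC _ (hp.mem x t)) (integrable_const _)
    (Eventually.of_forall fun x => hp.continuous_stress h x)

lemma continuous_defect (hp : BoundedFlow σ P μ a b p) (h : CubicShape σ z₁ z₂) (x : Ω) :
    Continuous (defect σ P p x) := (hp.continuous_stress h x).sub (hp.continuous_meanStress h)

lemma abs_meanStress_le (hp : BoundedFlow σ P μ a b p) {C : ℝ} (hC : ∀ q ∈ Icc a b, |σ q| ≤ C) (t : ℝ) :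
    |meanStress σ P p t| ≤ C := by
  simpa [meanStress] using norm_integral_le_of_norm_le_const (μ := P) (f := fun x => σ (p x t)) (C := C)
    (Eventually.of_forall fun x => hC _ (hp.mem x t))

lemma abs_defect_le (hp : BoundedFlow σ P μ a b p) {C : ℝ} (hC : ∀ q ∈ Icc a b, |σ q| ≤ C) (x : Ω) (t : ℝ) :
    |defect σ P p x t| ≤ 2 * C := by
  refine (abs_sub _ _).trans ?_
  linarith [hC _ (hp.mem x t), hp.abs_meanStress_le hC t]

lemma integrable_stress (hp : BoundedFlow σ P μ a b p) (h : CubicShape σ z₁ z₂) (t : ℝ) :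
    Integrable (fun x => σ (p x t)) P := by
  obtain ⟨C, -, hC⟩ := h.exists_bound (b := b) hp.pos
  exact Integrable.of_bound (hp.measurable_stress h t).aestronglyMeasurable C
    (Eventually.of_forall fun x => hC _ (hp.mem x t))

lemma integrable_defect (hp : BoundedFlow σ P μ a b p) (h : CubicShape σ z₁ z₂) (t : ℝ) :
    Integrable (fun x => defect σ P p x t) P := (hp.integrable_stress h t).sub (integrable_const _)

lemma integral_defect (hp : BoundedFlow σ P μ a b p) (h : CubicShape σ z₁ z₂) (t : ℝ) :
    ∫ x, defect σ P p x t ∂P = 0 := by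
  unfold defect
  rw [integral_sub (hp.integrable_stress h t) (integrable_const _)]
  simp [meanStress]

lemma integrable_defect_sq (hp : BoundedFlow σ P μ a b p) (h : CubicShape σ z₁ z₂) (t : ℝ) :
    Integrable (fun x => defect σ P p x t ^ 2) P := by
  obtain ⟨C, -, hC⟩ := h.exists_bound (b := b) hp.pos
  refine Integrable.of_bound ((hp.measurable_defect h t).pow_const 2).aestronglyMeasurable ((2 * C) ^ 2)
    (Eventually.of_forall fun x => ?_)
  rw [norm_pow]
  exact pow_le_pow_left₀ (norm_nonneg _) (hp.abs_defect_le hC x t) 2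

lemma dissipation_nonneg (t : ℝ) : 0 ≤ dissipation σ P p t := integral_nonneg fun _ => sq_nonneg _

lemma continuous_dissipation (hp : BoundedFlow σ P μ a b p) (h : CubicShape σ z₁ z₂) :
    Continuous (dissipation σ P p) := by
  obtain ⟨C, -, hC⟩ := h.exists_bound (b := b) hp.pos
  refine continuous_of_dominated (bound := fun _ => (2 * C) ^ 2)
    (fun t => ((hp.measurable_defect h t).pow_const 2).aestronglyMeasurable)
    (fun t => Eventually.of_forall fun x => ?_) (integrable_const _)
    (Eventually.of_forall fun x => (hp.continuous_defect h x).pow 2)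
  rw [norm_pow]
  exact pow_le_pow_left₀ (norm_nonneg _) (hp.abs_defect_le hC x t) 2

/-- The squared defect and the dissipation are Lipschitz in time. -/
lemma exists_lipschitz (hp : BoundedFlow σ P μ a b p) (h : CubicShape σ z₁ z₂) :
    ∃ Λ, 0 < Λ ∧ (∀ x, ∀ s ∈ Ioi (1:ℝ), ∀ t ∈ Ioi (1:ℝ),
      |defect σ P p x t ^ 2 - defect σ P p x s ^ 2| ≤ Λ * |t - s|) ∧
      ∀ s ∈ Ioi (1:ℝ), ∀ t ∈ Ioi (1:ℝ), |dissipation σ P p t - dissipation σ P p s| ≤ Λ * |t - s| := by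
  obtain ⟨C, hC0, hC⟩ := h.exists_bound (b := b) hp.pos
  obtain ⟨L, hL0, hL⟩ := h.exists_lipschitz (b := b) hp.pos
  have hplip : ∀ x, ∀ s ∈ Ioi (1:ℝ), ∀ t ∈ Ioi (1:ℝ), |p x t - p x s| ≤ 2 * C * |t - s| := by
    intro x s hs t ht
    exact (convex_Ioi (1:ℝ)).norm_image_sub_le_of_norm_hasDerivWithin_le
      (fun r hr => (hp.deriv x r hr).hasDerivWithinAt)
      (fun r hr => by rw [norm_neg]; exact hp.abs_defect_le hC x r) hs ht
  have hσlip : ∀ x, ∀ s ∈ Ioi (1:ℝ), ∀ t ∈ Ioi (1:ℝ), |σ (p x t) - σ (p x s)| ≤ L * (2 * C * |t - s|) :=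
    fun x s hs t ht => (hL _ (hp.mem x t) _ (hp.mem x s)).trans
      (mul_le_mul_of_nonneg_left (hplip x s hs t ht) hL0)
  have hSlip : ∀ s ∈ Ioi (1:ℝ), ∀ t ∈ Ioi (1:ℝ),
      |meanStress σ P p t - meanStress σ P p s| ≤ L * (2 * C * |t - s|) := by
    intro s hs t ht
    unfold meanStress
    rw [← integral_sub (hp.integrable_stress h t) (hp.integrable_stress h s)]
    simpa using norm_integral_le_of_norm_le_const (μ := P) (f := fun x => σ (p x t) - σ (p x s))
      (Eventually.of_forall fun x => hσlip x s hs t ht)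
  have hsq : ∀ x, ∀ s ∈ Ioi (1:ℝ), ∀ t ∈ Ioi (1:ℝ),
      |defect σ P p x t ^ 2 - defect σ P p x s ^ 2| ≤ (16 * L * C ^ 2 + 1) * |t - s| := by
    intro x s hs t ht
    have e1 : |defect σ P p x t - defect σ P p x s| ≤ 4 * L * C * |t - s| := by
      have : defect σ P p x t - defect σ P p x s =
        (σ (p x t) - σ (p x s)) - (meanStress σ P p t - meanStress σ P p s) := by unfold defect; ring
      rw [this]
      refine (abs_sub _ _).trans ?_
      linarith [hσlip x s hs t ht, hSlip s hs t ht]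
    have e2 : |defect σ P p x t + defect σ P p x s| ≤ 4 * C := by
      refine (abs_add_le _ _).trans ?_
      linarith [hp.abs_defect_le hC x t, hp.abs_defect_le hC x s]
    rw [sq_sub_sq, abs_mul, mul_comm]
    have := mul_le_mul e1 e2 (abs_nonneg _) (by positivity)
    nlinarith [abs_nonneg (t - s)]
  -- The difference of squares has factors bounded by `4LC |t - s|` and `4C`; the summand `1` only
  -- keeps the constant positive.
  refine ⟨16 * L * C ^ 2 + 1, by positivity, hsq, fun s hs t ht => ?_⟩
  unfold dissipation
  rw [← integral_sub (hp.integrable_defect_sq h t) (hp.integrable_defect_sq h s)]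
  simpa using norm_integral_le_of_norm_le_const (μ := P)
    (f := fun x => defect σ P p x t ^ 2 - defect σ P p x s ^ 2)
      (Eventually.of_forall fun x => hsq x s hs t ht)

/-- The energy identity. -/
lemma exists_energy (hp : BoundedFlow σ P μ a b p) (h : CubicShape σ z₁ z₂) :
    ∃ (E : ℝ → ℝ) (M : ℝ), (∀ t, |E t| ≤ M) ∧ ∀ s t, 1 < s → s ≤ t →
      ∫ r in s..t, dissipation σ P p r = E s - E t := by
  obtain ⟨C, hC0, hC⟩ := h.exists_bound (b := b) hp.pos
  set W : ℝ → ℝ := storedEnergy σ with hW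
  have hWd : ∀ q, 0 < q → HasDerivAt W (σ q) q := by
    intro q hq
    have hsub : uIcc 1 q ⊆ Ioi 0 := fun r hr => (lt_min one_pos hq).trans_le hr.1
    exact intervalIntegral.integral_hasDerivAt_right (h.continuousOn.mono hsub).intervalIntegrable
      (h.continuousOn.stronglyMeasurableAtFilter isOpen_Ioi q hq) (h.continuousAt hq)
  have hWc : ContinuousOn W (Ioi 0) := fun q hq => (hWd q hq).continuousAt.continuousWithinAt
  obtain ⟨M, hM⟩ := isCompact_Icc.exists_bound_of_continuousOn
    (hWc.mono fun q (hq : q ∈ Icc a b) => hp.pos.trans_le hq.1)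
  have hWm : ∀ t, Measurable fun x => W (p x t) := fun t => by
    have hc : Continuous fun z => W (max a z) := hWc.comp_continuous (by fun_prop)
      fun z => hp.pos.trans_le (le_max_left a z)
    have he : (fun x => W (p x t)) = fun x => W (max a (p x t)) :=
      funext fun x => by rw [max_eq_right (hp.mem x t).1]
    rw [he]
    exact hc.measurable.comp (hp.measurable t)
  have hWi : ∀ t, Integrable (fun x => W (p x t)) P := fun t =>
    Integrable.of_bound (hWm t).aestronglyMeasurable M (Eventually.of_forall fun x => hM _ (hp.mem x t))
  refine ⟨fun t => ∫ x, W (p x t) ∂P, M, fun t => ?_, fun s t hs hst => ?_⟩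
  · simpa using norm_integral_le_of_norm_le_const (μ := P) (f := fun x => W (p x t))
      (Eventually.of_forall fun x => hM _ (hp.mem x t))
  · have h1 : ∀ x, ∫ r in s..t, σ (p x r) * defect σ P p x r = W (p x s) - W (p x t) := by
      intro x
      have hd : ∀ r ∈ uIcc s t, HasDerivAt (fun r => -W (p x r)) (σ (p x r) * defect σ P p x r) r := by
        intro r hr
        rw [uIcc_of_le hst] at hr
        have := ((hWd _ (hp.pos_value x r)).comp r (hp.deriv x r (hs.trans_le hr.1))).neg
        refine this.congr_deriv ?_
        unfold defect meanStress
        ring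
      rw [intervalIntegral.integral_eq_sub_of_hasDerivAt hd
        (((hp.continuous_stress h x).mul (hp.continuous_defect h x)).intervalIntegrable _ _)]
      ring
    -- The defect has mean zero, so `σ` may be replaced by the defect in the energy production.
    have h2 : ∀ r, ∫ x, σ (p x r) * defect σ P p x r ∂P = dissipation σ P p r := by
      intro r
      have e : ∀ x, σ (p x r) * defect σ P p x r =
          defect σ P p x r ^ 2 + meanStress σ P p r * defect σ P p x r := fun x => by
        unfold defect; ring
      simp only [e]
      rw [integral_add (hp.integrable_defect_sq h r) ((hp.integrable_defect h r).const_mul _),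
        integral_const_mul, hp.integral_defect h r, mul_zero, add_zero, dissipation]
    have h3 := integral_intervalIntegral_swap (P := P) (G := fun x r => σ (p x r) * defect σ P p x r)
      (C := C * (2 * C)) hst (fun x => (hp.continuous_stress h x).mul (hp.continuous_defect h x))
      (fun r => (hp.measurable_stress h r).mul (hp.measurable_defect h r))
      (fun x r => by
        rw [abs_mul]
        exact mul_le_mul (hC _ (hp.mem x r)) (hp.abs_defect_le hC x r) (abs_nonneg _) hC0)
    simp only [h1, h2] at h3
    rw [← h3, integral_sub (hWi s) (hWi t)]

lemma integral_defect_sq_swap (hp : BoundedFlow σ P μ a b p) (h : CubicShape σ z₁ z₂) {s t : ℝ}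
    (hst : s ≤ t) : ∫ x, (∫ r in s..t, defect σ P p x r ^ 2) ∂P = ∫ r in s..t, dissipation σ P p r := by
  obtain ⟨C, hC0, hC⟩ := h.exists_bound (b := b) hp.pos
  exact integral_intervalIntegral_swap hst (fun x => (hp.continuous_defect h x).pow 2)
    (fun r => (hp.measurable_defect h r).pow_const 2) (C := (2 * C) ^ 2) (fun x r => by
      rw [abs_pow]
      exact pow_le_pow_left₀ (abs_nonneg _) (hp.abs_defect_le hC x r) 2)

/-- The energy is nonincreasing and bounded below; once it is within `ε` of its infimum, at most `ε`
remains to be dissipated. -/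
lemma exists_forall_integral_dissipation_le (hp : BoundedFlow σ P μ a b p) (h : CubicShape σ z₁ z₂)
    {ε : ℝ} (hε : 0 < ε) :
    ∃ T, 1 < T ∧ ∀ s t, T ≤ s → s ≤ t → ∫ r in s..t, dissipation σ P p r ≤ ε := by
  obtain ⟨E, M, hM, hE⟩ := hp.exists_energy h
  have hanti : ∀ s t, 1 < s → s ≤ t → E t ≤ E s := fun s t hs hst => by
    have := intervalIntegral.integral_nonneg (μ := volume) hst (fun r _ => dissipation_nonneg (σ := σ) (P := P) (p := p) r)
    rw [hE s t hs hst] at this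
    linarith
  have hbdd : BddBelow (E '' Ioi 1) := ⟨-M, by
    rintro _ ⟨t, -, rfl⟩
    exact (abs_le.1 (hM t)).1⟩
  have hne : (E '' Ioi 1).Nonempty := ⟨E 2, mem_image_of_mem E (by norm_num)⟩
  obtain ⟨_, ⟨T, hT, rfl⟩, hlt⟩ := exists_lt_of_csInf_lt hne (lt_add_of_pos_right (sInf (E '' Ioi 1)) hε)
  refine ⟨T, hT, fun s t hs hst => ?_⟩
  rw [hE s t (lt_of_lt_of_le hT hs) hst]
  have h1 := hanti T s hT hs
  have h2 := csInf_le hbdd (mem_image_of_mem E (show t ∈ Ioi 1 from (lt_of_lt_of_le hT hs).trans_le hst))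
  linarith

/-- The dissipation tends to zero. -/
lemma tendsto_dissipation (hp : BoundedFlow σ P μ a b p) (h : CubicShape σ z₁ z₂) :
    Tendsto (dissipation σ P p) atTop (𝓝 0) := by
  obtain ⟨Λ, hΛ, -, hlip⟩ := hp.exists_lipschitz h
  rw [Metric.tendsto_atTop]
  intro ε hε
  -- The tolerance is half the cost `ε²/(4Λ)` of a late visit to height `ε`.
  obtain ⟨T, hT, hint⟩ := hp.exists_forall_integral_dissipation_le h
    (show 0 < ε ^ 2 / (8 * Λ) by positivity)
  have hd : 0 < ε / (2 * Λ) := by positivity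
  refine ⟨T + ε / (2 * Λ), fun t ht => ?_⟩
  rw [dist_zero_right, Real.norm_of_nonneg (dissipation_nonneg t)]
  by_contra! hcon
  have h1 := sq_div_le_integral_of_lipschitz (f := dissipation σ P p) (s := t - ε / (2 * Λ)) (r := t)
    (t := t) hΛ hε dissipation_nonneg (hp.continuous_dissipation h) (fun x hx => by
      have hx1 : x ∈ Ioi (1:ℝ) := by simp only [mem_Ioi]; linarith [hx.1]
      have ht1 : t ∈ Ioi (1:ℝ) := by simp only [mem_Ioi]; linarith
      have := (le_abs_self _).trans (hlip x hx1 t ht1)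
      rwa [abs_of_nonneg (by linarith [hx.2])] at this) hcon (by linarith) le_rfl
  have h2 := hint (t - ε / (2 * Λ)) t (by linarith) (by linarith)
  have h3 : 0 < ε ^ 2 / (8 * Λ) := by positivity
  have h4 : ε ^ 2 / (4 * Λ) = 2 * (ε ^ 2 / (8 * Λ)) := by field_simp; ring
  linarith

end BoundedFlow

end

/-! ### Roots, crossings and branches -/

section

set_option linter.unusedSectionVars false

variable {Ω : Type*} [MeasurableSpace Ω] {P : Measure Ω} [IsProbabilityMeasure P]

/-- Points of a compact interval at which `σ` is close to `c` are close to the only root of `σ = c`. -/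
lemma exists_abs_sub_le_add_sq {σ : ℝ → ℝ} (hσ : ContinuousOn σ (Ioi 0)) {s : Set ℝ} (hs : IsClosed s)
    {a b c q : ℝ} (ha : 0 < a) (huniq : ∀ p ∈ s, 0 < p → σ p = c → p = q) {ε : ℝ} (hε : 0 < ε) :
    ∃ K, 0 ≤ K ∧ ∀ p ∈ Icc a b, p ∈ s → |p - q| ≤ ε + K * (σ p - c) ^ 2 := by
  -- On the compact set of points at distance at least `ε` from `q`, `(σ - c)²` has a positive
  -- minimum; `K` is a bound for `|p - q|` divided by it. The squared form lets the estimate be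
  -- integrated against the dissipation.
  have hD : IsCompact ((Icc a b ∩ s) ∩ {p | ε ≤ |p - q|}) :=
    (isCompact_Icc.inter_right hs).inter_right (isClosed_le continuous_const (by fun_prop))
  rcases ((Icc a b ∩ s) ∩ {p | ε ≤ |p - q|}).eq_empty_or_nonempty with he | hne
  · refine ⟨0, le_rfl, fun p hp hps => ?_⟩
    by_contra! hcon
    have : p ∈ (Icc a b ∩ s) ∩ {p | ε ≤ |p - q|} := ⟨⟨hp, hps⟩, by simp only [mem_ofPred_eq]; linarith⟩
    rw [he] at this
    exact this
  · obtain ⟨p₀, hp₀, hmin⟩ := hD.exists_isMinOn hne (f := fun p => (σ p - c) ^ 2)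
      (((hσ.mono fun p hp => ha.trans_le hp.1.1.1).sub continuousOn_const).pow 2)
    have hm : 0 < (σ p₀ - c) ^ 2 := by
      refine lt_of_le_of_ne (sq_nonneg _) fun h0 => ?_
      have h1 : σ p₀ = c := by nlinarith
      have h2 := huniq p₀ hp₀.1.2 (ha.trans_le hp₀.1.1.1) h1
      have h3 : ε ≤ |p₀ - q| := hp₀.2
      rw [h2, sub_self, abs_zero] at h3
      linarith
    have hR : ∀ p ∈ Icc a b, |p - q| ≤ |a| + |b| + |q| := fun p hp => by
      have h1 : |p| ≤ |a| + |b| := by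
        rw [abs_le]
        constructor
        · linarith [neg_abs_le a, abs_nonneg b, hp.1]
        · linarith [le_abs_self b, abs_nonneg a, hp.2]
      linarith [abs_sub p q]
    refine ⟨(|a| + |b| + |q|) / (σ p₀ - c) ^ 2, by positivity, fun p hp hps => ?_⟩
    have hK : 0 ≤ (|a| + |b| + |q|) / (σ p₀ - c) ^ 2 := by positivity
    rcases lt_or_ge |p - q| ε with h1 | h1
    · have := mul_nonneg hK (sq_nonneg (σ p - c))
      linarith
    · have h2 : (σ p₀ - c) ^ 2 ≤ (σ p - c) ^ 2 := hmin (a := p) ⟨⟨hp, hps⟩, h1⟩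
      have h3 := mul_le_mul_of_nonneg_left h2 hK
      rw [div_mul_cancel₀ _ hm.ne'] at h3
      linarith [hR p hp]

/-- A continuous function oscillating across `[c, d]` traverses `[c, d]` upwards at arbitrarily late times. -/
lemma exists_upcrossing {S : ℝ → ℝ} (hS : Continuous S) {u c d v : ℝ} (huc : u ≤ c) (hcd : c < d) (hdv : d ≤ v)
    (hu : ∃ᶠ t in atTop, S t < u) (hv : ∃ᶠ t in atTop, v < S t) (T : ℝ) :
    ∃ s t, T ≤ s ∧ s ≤ t ∧ S s = c ∧ S t = d ∧ ∀ r ∈ Icc s t, S r ∈ Icc c d := by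
  obtain ⟨t₀, ht₀, h0⟩ := frequently_atTop.1 hu T
  obtain ⟨t₁, ht₁, h1⟩ := frequently_atTop.1 hv t₀
  -- `t` is the first time after `t₀` at which `S` reaches `d`, and `s` below is the last time
  -- before `t` with `S ≤ c`; extremality confines `S` to `[c,d]` in between.
  obtain ⟨t, ⟨⟨htl, htr⟩, htd⟩, htmin⟩ := (isCompact_Icc.inter_right
    (isClosed_le continuous_const hS : IsClosed {r | d ≤ S r})).exists_isLeast (s := Icc t₀ t₁ ∩ {r | d ≤ S r})
    ⟨t₁, ⟨ht₁, le_rfl⟩, by simp only [mem_ofPred_eq]; linarith⟩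
  have htd' : S t = d := by
    obtain ⟨r, hr, hrd⟩ := intermediate_value_Icc htl hS.continuousOn (show d ∈ Icc (S t₀) (S t) from ⟨by linarith, htd⟩)
    have := htmin ⟨⟨hr.1, hr.2.trans htr⟩, hrd.ge⟩
    rw [le_antisymm this hr.2, hrd]
  obtain ⟨s, ⟨⟨hsl, hsr⟩, hsc⟩, hsmax⟩ := (isCompact_Icc.inter_right
    (isClosed_le hS continuous_const : IsClosed {r | S r ≤ c})).exists_isGreatest (s := Icc t₀ t ∩ {r | S r ≤ c})
    ⟨t₀, ⟨le_rfl, htl⟩, by simp only [mem_ofPred_eq]; linarith⟩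
  have hsc' : S s = c := by
    obtain ⟨r, hr, hrc⟩ := intermediate_value_Icc hsr hS.continuousOn
      (show c ∈ Icc (S s) (S t) from ⟨hsc, by linarith⟩)
    have := hsmax ⟨⟨hsl.trans hr.1, hr.2⟩, hrc.le⟩
    rw [le_antisymm hr.1 this, hrc]
  refine ⟨s, t, ht₀.trans hsl, hsr, hsc', htd', fun r hr => ⟨?_, ?_⟩⟩
  · by_contra! hcon
    have := hsmax ⟨⟨hsl.trans hr.1, hr.2⟩, hcon.le⟩
    rw [le_antisymm this hr.1, hsc'] at hcon
    exact lt_irrefl _ hcon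
  · by_contra! hcon
    have := htmin ⟨⟨hsl.trans hr.1, hr.2.trans htr⟩, hcon.le⟩
    rw [le_antisymm hr.2 this, htd'] at hcon
    exact lt_irrefl _ hcon

/-- A continuous function that avoids a value stays on its side of it. -/
lemma side_of_avoids {f : ℝ → ℝ} (hf : Continuous f) {s t z : ℝ} (hz : ∀ r ∈ Icc s t, f r ≠ z) :
    ∀ r ∈ Icc s t, (f s < z → f r < z) ∧ (z < f s → z < f r) := by
  intro r hr
  constructor <;> intro h0 <;> by_contra! hcon
  · obtain ⟨x, hx, hxz⟩ := intermediate_value_Icc hr.1 hf.continuousOn (show z ∈ Icc (f s) (f r) from ⟨h0.le, hcon⟩)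
    exact hz x ⟨hx.1, hx.2.trans hr.2⟩ hxz
  · obtain ⟨x, hx, hxz⟩ := intermediate_value_Icc' hr.1 hf.continuousOn (show z ∈ Icc (f r) (f s) from ⟨hcon, h0.le⟩)
    exact hz x ⟨hx.1, hx.2.trans hr.2⟩ hxz

/-- The root among `p₁`, `p₂`, `p₃` lying in the same branch as `y`. -/
noncomputable def branchRoot (z₁ z₂ p₁ p₂ p₃ y : ℝ) : ℝ := if y < z₁ then p₁ else if y ≤ z₂ then p₂ else p₃

lemma integral_branchRoot {f : Ω → ℝ} (hf : Measurable f) {z₁ z₂ : ℝ} (h12 : z₁ < z₂) (p₁ p₂ p₃ : ℝ) :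
    Integrable (fun x => branchRoot z₁ z₂ p₁ p₂ p₃ (f x)) P ∧
    ∫ x, branchRoot z₁ z₂ p₁ p₂ p₃ (f x) ∂P = P.real {x | f x < z₁} * p₁ +
      P.real {x | z₁ ≤ f x ∧ f x ≤ z₂} * p₂ + P.real {x | z₂ < f x} * p₃ := by
  have m1 : MeasurableSet {x | f x < z₁} := measurableSet_lt hf measurable_const
  have m2 : MeasurableSet {x | z₁ ≤ f x ∧ f x ≤ z₂} :=
    (measurableSet_le measurable_const hf).inter (measurableSet_le hf measurable_const)
  have m3 : MeasurableSet {x | z₂ < f x} := measurableSet_lt measurable_const hf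
  have e : (fun x => branchRoot z₁ z₂ p₁ p₂ p₃ (f x)) = fun x => {x | f x < z₁}.indicator (fun _ => p₁) x +
      {x | z₁ ≤ f x ∧ f x ≤ z₂}.indicator (fun _ => p₂) x + {x | z₂ < f x}.indicator (fun _ => p₃) x := by
    funext x
    simp only [branchRoot, indicator, mem_ofPred_eq]
    rcases lt_or_ge (f x) z₁ with h1 | h1
    · rw [if_pos h1, if_pos h1, if_neg (by intro h; linarith [h.1]), if_neg (by linarith)]; ring
    · rcases le_or_gt (f x) z₂ with h2 | h2
      · rw [if_neg (by linarith), if_pos h2, if_neg (by linarith), if_pos ⟨h1, h2⟩, if_neg (by linarith)]; ring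
      · rw [if_neg (by linarith), if_neg (by linarith), if_neg (by linarith),
          if_neg (by intro h; linarith [h.2]), if_pos h2]; ring
  have i1 : Integrable ({x | f x < z₁}.indicator fun _ => p₁) P := (integrable_const _).indicator m1
  have i2 : Integrable ({x | z₁ ≤ f x ∧ f x ≤ z₂}.indicator fun _ => p₂) P := (integrable_const _).indicator m2
  have i3 : Integrable ({x | z₂ < f x}.indicator fun _ => p₃) P := (integrable_const _).indicator m3
  rw [e]
  refine ⟨(i1.add i2).add i3, ?_⟩
  rw [integral_add (by exact i1.add i2) i3, integral_add i1 i2, integral_indicator_const _ m1,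
    integral_indicator_const _ m2, integral_indicator_const _ m3]
  simp only [smul_eq_mul]

lemma sum_branch_measures {f : Ω → ℝ} (hf : Measurable f) {z₁ z₂ : ℝ} (h12 : z₁ < z₂) :
    P.real {x | f x < z₁} + P.real {x | z₁ ≤ f x ∧ f x ≤ z₂} + P.real {x | z₂ < f x} = 1 := by
  have h := (integral_branchRoot (P := P) hf h12 1 1 1).2
  have e : ∀ x, branchRoot z₁ z₂ 1 1 1 (f x) = 1 := fun x => by simp [branchRoot]
  simp only [e] at h
  simp at h
  linarith

namespace BoundedFlow

variable {σ : ℝ → ℝ} {z₁ z₂ μ a b : ℝ} {p : Ω → ℝ → ℝ}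

/-- If `σ = c` has only one root and the mean stress equals `c` at arbitrarily late times, then this root
is `μ`. -/
lemma root_eq_of_frequently (hp : BoundedFlow σ P μ a b p) (h : CubicShape σ z₁ z₂) {c q : ℝ}
    (huniq : ∀ y, 0 < y → σ y = c → y = q) (hS : ∀ T, ∃ t, T ≤ t ∧ meanStress σ P p t = c) : μ = q := by
  choose r hr hrc using fun n : ℕ => hS n
  have hr' : Tendsto r atTop atTop := tendsto_atTop_mono hr tendsto_natCast_atTop_atTop
  have key : ∀ ε, 0 < ε → |μ - q| ≤ ε := by
    intro ε hε
    obtain ⟨K, hK, hq⟩ := exists_abs_sub_le_add_sq h.continuousOn (b := b) isClosed_univ hp.pos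
      (fun y _ => huniq y) hε
    -- As `μ` is the mean of `p`, `|μ - q| ≤ ∫ |p - q|`, and the integrand is controlled by the
    -- squared defect at a time when the mean stress is `c`.
    have hb : ∀ n, |μ - q| ≤ ε + K * dissipation σ P p (r n) := fun n => by
      have e1 : μ - q = ∫ x, (p x (r n) - q) ∂P := by
        rw [integral_sub (hp.integrable _) (integrable_const _), hp.mass]; simp
      have e2 : ε + K * dissipation σ P p (r n) = ∫ x, (ε + K * defect σ P p x (r n) ^ 2) ∂P := by
        rw [integral_add (integrable_const _) ((hp.integrable_defect_sq h _).const_mul _), integral_const_mul]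
        simp [dissipation]
      rw [e1, e2]
      refine abs_integral_le_integral_abs.trans (integral_mono ((hp.integrable _).sub (integrable_const _)).abs
        ((integrable_const _).add ((hp.integrable_defect_sq h _).const_mul _)) fun x => ?_)
      have := hq (p x (r n)) (hp.mem _ _) (mem_univ _)
      simpa only [defect, hrc] using this
    have hl : Tendsto (fun n => ε + K * dissipation σ P p (r n)) atTop (𝓝 (ε + K * 0)) :=
      (((hp.tendsto_dissipation h).comp hr').const_mul K).const_add ε
    rw [mul_zero, add_zero] at hl
    exact ge_of_tendsto' hl hb
  have h0 : |μ - q| ≤ 0 := le_of_forall_pos_le_add fun ε hε => by simpa using key ε hε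
  linarith [abs_nonpos_iff.1 h0]

/-- Leaving a branch while the mean stress stays away from the critical values costs dissipation. -/
lemma avoids_critical (hp : BoundedFlow σ P μ a b p) (h : CubicShape σ z₁ z₂) {Λ η s t z : ℝ} {x : Ω}
    (hΛ : 0 < Λ) (hlip : ∀ s ∈ Ioi (1:ℝ), ∀ t ∈ Ioi (1:ℝ),
      |defect σ P p x t ^ 2 - defect σ P p x s ^ 2| ≤ Λ * |t - s|) (hη : 0 < η) (hs : 1 < s)
    (hz : ∀ r ∈ Icc s t, η ≤ |σ z - meanStress σ P p r|) (h0 : defect σ P p x s ^ 2 < η ^ 2 / 2)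
    (hint : ∫ r in s..t, defect σ P p x r ^ 2 < (η ^ 2) ^ 2 / (4 * Λ)) : ∀ r ∈ Icc s t, p x r ≠ z := by
  intro r hr hrz
  have h1 : η ^ 2 ≤ defect σ P p x r ^ 2 := by
    rw [← sq_abs (defect σ P p x r)]
    refine pow_le_pow_left₀ hη.le ?_ 2
    rw [defect, hrz]
    exact hz r hr
  -- The squared defect rises from below `η²/2` at `s` to at least `η²` at `r`, which takes this
  -- much time; staying high meanwhile costs the amount excluded by `hint`.
  have h2 : η ^ 2 / (2 * Λ) ≤ r - s := by
    have := (le_abs_self _).trans (hlip s hs r (hs.trans_le hr.1))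
    rw [abs_of_nonneg (by linarith [hr.1])] at this
    rw [div_le_iff₀ (by positivity)]
    nlinarith
  have h3 := sq_div_le_integral_of_lipschitz (f := fun r => defect σ P p x r ^ 2) hΛ (pow_pos hη 2)
    (fun r => sq_nonneg _) ((hp.continuous_defect h x).pow 2) (fun y hy => by
      have := (le_abs_self _).trans (hlip y (hs.trans_le hy.1) r (hs.trans_le hr.1))
      rwa [abs_of_nonneg (by linarith [hy.2])] at this) h1 h2 hr.2
  linarith

end BoundedFlow

end

/-! ### Convergence of the mean stress -/

section

set_option linter.unusedSectionVars false

variable {Ω : Type*} [MeasurableSpace Ω] {P : Measure Ω} [IsProbabilityMeasure P]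

namespace BoundedFlow

variable {σ : ℝ → ℝ} {z₁ z₂ μ a b : ℝ} {p : Ω → ℝ → ℝ}

/-- If the defect at `s` and the dissipation along the trajectory over `[s,t]` are both small, the
trajectory cannot pass `z₁` or `z₂`, so at time `r` it is still on the branch it occupied at `s` and
lies near that branch's root. Otherwise one of the two is large and pays for the crude bound `p₃ +
b`. -/
lemma exists_abs_branchRoot_sub_le (hp : BoundedFlow σ P μ a b p) (h : CubicShape σ z₁ z₂) {η c₁ c₂ c p₁ p₂ p₃ : ℝ}
    (hη : 0 < η) (h1 : η ≤ c₁ - σ z₂) (h2 : η ≤ σ z₁ - c₂) (hp₁ : p₁ ∈ Ioo 0 z₁) (hp₂ : p₂ ∈ Ioo z₁ z₂)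
    (hp₃ : p₃ ∈ Ioi z₂) (e₁ : σ p₁ = c) (e₂ : σ p₂ = c) (e₃ : σ p₃ = c) {ε : ℝ} (hε : 0 < ε) :
    ∃ K, 0 ≤ K ∧ ∀ s t r x, 1 < s → r ∈ Icc s t → (∀ r ∈ Icc s t, meanStress σ P p r ∈ Icc c₁ c₂) →
      meanStress σ P p r = c → |branchRoot z₁ z₂ p₁ p₂ p₃ (p x s) - p x r| ≤
        ε + K * (defect σ P p x r ^ 2 + defect σ P p x s ^ 2 + ∫ r in s..t, defect σ P p x r ^ 2) := by
  obtain ⟨Λ, hΛ, hlip, -⟩ := hp.exists_lipschitz h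
  obtain ⟨K₁, hK₁, hq₁⟩ := exists_abs_sub_le_add_sq h.continuousOn (b := b) (isClosed_Iic (a := z₁)) hp.pos
    (c := c) (q := p₁) (fun y hy hy0 hyc => h.mono_left.injOn ⟨hy0, hy⟩ ⟨hp₁.1, hp₁.2.le⟩ (hyc.trans e₁.symm)) hε
  obtain ⟨K₂, hK₂, hq₂⟩ := exists_abs_sub_le_add_sq h.continuousOn (b := b) (isClosed_Icc (a := z₁) (b := z₂)) hp.pos
    (c := c) (q := p₂) (fun y hy _ hyc => h.anti.injOn hy ⟨hp₂.1.le, hp₂.2.le⟩ (hyc.trans e₂.symm)) hε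
  obtain ⟨K₃, hK₃, hq₃⟩ := exists_abs_sub_le_add_sq h.continuousOn (b := b) (isClosed_Ici (a := z₂)) hp.pos
    (c := c) (q := p₃) (fun y hy _ hyc => h.mono_right.injOn hy (mem_Ioi.1 hp₃).le (hyc.trans e₃.symm)) hε
  have hb : 0 ≤ b := by
    have : Nonempty Ω := nonempty_of_isProbabilityMeasure P
    obtain ⟨x⟩ := this
    exact ((hp.pos_value x 0).trans_le (hp.mem x 0).2).le
  have hp30 : 0 < p₃ := h.pos'.trans hp₃
  have hM : 0 ≤ p₃ + b := by positivity
  -- The last two terms are `p₃ + b` divided by the thresholds `η²/2` and `(η²)²/(4Λ)` separating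
  -- the cases.
  set K := K₁ + K₂ + K₃ + (p₃ + b) * (2 / η ^ 2) + (p₃ + b) * (4 * Λ / (η ^ 2) ^ 2) with hK
  have hk4 : 0 ≤ (p₃ + b) * (2 / η ^ 2) := by positivity
  have hk5 : 0 ≤ (p₃ + b) * (4 * Λ / (η ^ 2) ^ 2) := by positivity
  refine ⟨K, by positivity, fun s t r x hs hr hS hSr => ?_⟩
  have hst : s ≤ t := hr.1.trans hr.2
  have hint0 : 0 ≤ ∫ r in s..t, defect σ P p x r ^ 2 :=
    intervalIntegral.integral_nonneg hst fun r _ => sq_nonneg _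
  have hr0 := sq_nonneg (defect σ P p x r)
  have hs0 := sq_nonneg (defect σ P p x s)
  have hM' : |branchRoot z₁ z₂ p₁ p₂ p₃ (p x s) - p x r| ≤ p₃ + b := by
    have hβ : 0 < branchRoot z₁ z₂ p₁ p₂ p₃ (p x s) ∧ branchRoot z₁ z₂ p₁ p₂ p₃ (p x s) ≤ p₃ := by
      have := h.lt
      have := h.pos
      have := mem_Ioi.1 hp₃
      unfold branchRoot
      split_ifs
      · exact ⟨hp₁.1, by linarith [hp₁.2]⟩
      · exact ⟨by linarith [hp₂.1], by linarith [hp₂.2]⟩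
      · exact ⟨hp30, le_rfl⟩
    rw [abs_le]
    constructor <;> linarith [hβ.1, hβ.2, (hp.mem x r).2, hp.pos_value x r]
  have hle : ∀ k y, 0 ≤ y → 0 ≤ k → k ≤ K → y ≤ (defect σ P p x r ^ 2 + defect σ P p x s ^ 2 +
      ∫ r in s..t, defect σ P p x r ^ 2) → k * y ≤ K * (defect σ P p x r ^ 2 + defect σ P p x s ^ 2 +
      ∫ r in s..t, defect σ P p x r ^ 2) := fun k y hy hk hkK hyy =>
    mul_le_mul hkK hyy hy (hk.trans hkK)
  rcases lt_or_ge (defect σ P p x s ^ 2) (η ^ 2 / 2) with g1 | g1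
  · rcases lt_or_ge (∫ r in s..t, defect σ P p x r ^ 2) ((η ^ 2) ^ 2 / (4 * Λ)) with g2 | g2
    · have av₁ := hp.avoids_critical h hΛ (hlip x) hη hs (z := z₁) (fun r hr => by
        rw [abs_of_nonneg (by linarith [(hS r hr).2])]; linarith [(hS r hr).2]) g1 g2
      have av₂ := hp.avoids_critical h hΛ (hlip x) hη hs (z := z₂) (fun r hr => by
        rw [abs_of_nonpos (by linarith [(hS r hr).1])]; linarith [(hS r hr).1]) g1 g2
      have s₁ := side_of_avoids (hp.continuous x) av₁ r hr
      have s₂ := side_of_avoids (hp.continuous x) av₂ r hr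
      have d : defect σ P p x r = σ (p x r) - c := by rw [defect, hSr]
      unfold branchRoot
      rw [abs_sub_comm]
      split_ifs with b1 b2
      · have := hq₁ _ (hp.mem x r) (s₁.1 b1).le
        rw [← d] at this
        linarith [hle K₁ _ hr0 hK₁ (by linarith) (by linarith)]
      · have b1' : z₁ < p x s := lt_of_le_of_ne (not_lt.1 b1) (av₁ s ⟨le_rfl, hst⟩).symm
        have b2' : p x s < z₂ := lt_of_le_of_ne b2 (av₂ s ⟨le_rfl, hst⟩)
        have := hq₂ _ (hp.mem x r) ⟨(s₁.2 b1').le, (s₂.1 b2').le⟩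
        rw [← d] at this
        linarith [hle K₂ _ hr0 hK₂ (by linarith) (by linarith)]
      · have := hq₃ _ (hp.mem x r) (s₂.2 (not_le.1 b2)).le
        rw [← d] at this
        linarith [hle K₃ _ hr0 hK₃ (by linarith) (by linarith)]
    · have := hle _ _ hint0 hk5 (by linarith) (by linarith)
      have g3 := mul_le_mul_of_nonneg_left g2 hk5
      have g4 : (p₃ + b) * (4 * Λ / (η ^ 2) ^ 2) * ((η ^ 2) ^ 2 / (4 * Λ)) = p₃ + b := by field_simp
      linarith
  · have := hle _ _ hs0 hk4 (by linarith) (by linarith)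
    have g3 := mul_le_mul_of_nonneg_left g1 hk4
    have g4 : (p₃ + b) * (2 / η ^ 2) * (η ^ 2 / 2) = p₃ + b := by field_simp
    linarith

lemma integrable_integral_defect_sq (hp : BoundedFlow σ P μ a b p) (h : CubicShape σ z₁ z₂) {s t : ℝ}
    (hst : s ≤ t) : Integrable (fun x => ∫ r in s..t, defect σ P p x r ^ 2) P := by
  obtain ⟨C, hC0, hC⟩ := h.exists_bound (b := b) hp.pos
  have hm : Measurable (Function.uncurry fun t x => defect σ P p x t ^ 2) :=
    measurable_uncurry_of_continuous_of_measurable (fun x => (hp.continuous_defect h x).pow 2)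
      (fun t => (hp.measurable_defect h t).pow_const 2)
  have hm' : StronglyMeasurable (Function.uncurry fun x t => defect σ P p x t ^ 2) :=
    (hm.comp measurable_swap).stronglyMeasurable
  simp only [intervalIntegral.integral_of_le hst]
  refine Integrable.of_bound hm'.integral_prod_right.aestronglyMeasurable ((2 * C) ^ 2 * (t - s))
    (Eventually.of_forall fun x => ?_)
  have := norm_setIntegral_le_of_norm_le_const (μ := volume) (s := Ioc s t) (f := fun r => defect σ P p x r ^ 2)
    (C := (2 * C) ^ 2) (by simp) (fun r _ => by
      rw [norm_pow]; exact pow_le_pow_left₀ (norm_nonneg _) (hp.abs_defect_le hC x r) 2)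
  simpa [Measure.real, hst] using this

/-- The previous estimate integrated over the labels. The weights are those at the start `s` of the
traversal and do not depend on the level `c` met at time `r`. -/
lemma exists_abs_weights_sub_le (hp : BoundedFlow σ P μ a b p) (h : CubicShape σ z₁ z₂) {η c₁ c₂ c p₁ p₂ p₃ : ℝ}
    (hη : 0 < η) (h1 : η ≤ c₁ - σ z₂) (h2 : η ≤ σ z₁ - c₂) (hp₁ : p₁ ∈ Ioo 0 z₁) (hp₂ : p₂ ∈ Ioo z₁ z₂)
    (hp₃ : p₃ ∈ Ioi z₂) (e₁ : σ p₁ = c) (e₂ : σ p₂ = c) (e₃ : σ p₃ = c) {ε : ℝ} (hε : 0 < ε) :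
    ∃ K, 0 ≤ K ∧ ∀ s t r, 1 < s → r ∈ Icc s t → (∀ r ∈ Icc s t, meanStress σ P p r ∈ Icc c₁ c₂) →
      meanStress σ P p r = c → |P.real {x | p x s < z₁} * p₁ + P.real {x | z₁ ≤ p x s ∧ p x s ≤ z₂} * p₂ +
        P.real {x | z₂ < p x s} * p₃ - μ| ≤
        ε + K * (dissipation σ P p r + dissipation σ P p s + ∫ r in s..t, dissipation σ P p r) := by
  obtain ⟨K, hK, hKb⟩ := hp.exists_abs_branchRoot_sub_le h hη h1 h2 hp₁ hp₂ hp₃ e₁ e₂ e₃ hε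
  refine ⟨K, hK, fun s t r hs hr hS hSr => ?_⟩
  have hst : s ≤ t := hr.1.trans hr.2
  obtain ⟨i1, i2⟩ := integral_branchRoot (P := P) (hp.measurable s) h.lt p₁ p₂ p₃
  have j1 := hp.integrable_defect_sq h r
  have j2 := hp.integrable_defect_sq h s
  have j3 := hp.integrable_integral_defect_sq h hst
  have j12 : Integrable (fun x => defect σ P p x r ^ 2 + defect σ P p x s ^ 2) P := j1.add j2
  have j : Integrable (fun x => defect σ P p x r ^ 2 + defect σ P p x s ^ 2 +
    ∫ r in s..t, defect σ P p x r ^ 2) P := j12.add j3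
  have E : ∫ x, (ε + K * (defect σ P p x r ^ 2 + defect σ P p x s ^ 2 + ∫ r in s..t, defect σ P p x r ^ 2)) ∂P =
      ε + K * (dissipation σ P p r + dissipation σ P p s + ∫ r in s..t, dissipation σ P p r) := by
    rw [integral_add (integrable_const _) (j.const_mul _), integral_const_mul, integral_add j12 j3,
      integral_add j1 j2, hp.integral_defect_sq_swap h hst]
    simp [dissipation]
  rw [← i2, ← hp.mass r, ← integral_sub i1 (hp.integrable r), ← E]
  exact abs_integral_le_integral_abs.trans (integral_mono (i1.sub (hp.integrable r)).abs
    ((integrable_const _).add (j.const_mul _)) fun x => hKb s t r x hs hr hS hSr)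

/-- If the mean stress keeps traversing `[c₁, c₂]`, then for `c ∈ (c₁, c₂)` the weighted mean of the roots of
`σ = c`, with fixed weights, is `μ`. -/
lemma exists_weights (hp : BoundedFlow σ P μ a b p) (h : CubicShape σ z₁ z₂) {c₁ c₂ : ℝ}
    (h1 : σ z₂ < c₁) (h2 : c₂ < σ z₁)
    (hw : ∀ T, ∃ s t, T ≤ s ∧ s ≤ t ∧ meanStress σ P p s = c₁ ∧ meanStress σ P p t = c₂ ∧
      ∀ r ∈ Icc s t, meanStress σ P p r ∈ Icc c₁ c₂) :
    ∃ A B E : ℝ, A + B + E = 1 ∧ ∀ p₁ ∈ Ioo 0 z₁, ∀ p₂ ∈ Ioo z₁ z₂, ∀ p₃ ∈ Ioi z₂, ∀ c ∈ Ioo c₁ c₂,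
      σ p₁ = c → σ p₂ = c → σ p₃ = c → A * p₁ + B * p₂ + E * p₃ = μ := by
  choose s t hs hst hsc htc hS using fun n : ℕ => hw (n + 2)
  have hs1 : ∀ n, 1 < s n := fun n => by
    have : (0:ℝ) ≤ n := n.cast_nonneg
    linarith [hs n]
  have hs' : Tendsto s atTop atTop :=
    tendsto_atTop_mono (fun n => by linarith [hs n]) tendsto_natCast_atTop_atTop
  set lam : ℕ → ℝ × ℝ × ℝ := fun n => (P.real {x | p x (s n) < z₁},
    P.real {x | z₁ ≤ p x (s n) ∧ p x (s n) ≤ z₂}, P.real {x | z₂ < p x (s n)}) with hlam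
  have hK : IsCompact (Icc (0:ℝ) 1 ×ˢ Icc (0:ℝ) 1 ×ˢ Icc (0:ℝ) 1) :=
    isCompact_Icc.prod (isCompact_Icc.prod isCompact_Icc)
  -- The limiting weights are extracted along the starting times, before any level is chosen, so the
  -- same triple serves all `c ∈ (c₁,c₂)`.
  obtain ⟨⟨A, B, E⟩, -, φ, hφ, hlim⟩ := hK.tendsto_subseq (x := lam) fun n =>
    ⟨⟨measureReal_nonneg, measureReal_le_one⟩, ⟨measureReal_nonneg, measureReal_le_one⟩,
      measureReal_nonneg, measureReal_le_one⟩
  have hA : Tendsto (fun n => (lam (φ n)).1) atTop (𝓝 A) := (continuous_fst.tendsto _).comp hlim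
  have hB : Tendsto (fun n => (lam (φ n)).2.1) atTop (𝓝 B) :=
    ((continuous_fst.comp continuous_snd).tendsto _).comp hlim
  have hE : Tendsto (fun n => (lam (φ n)).2.2) atTop (𝓝 E) :=
    ((continuous_snd.comp continuous_snd).tendsto _).comp hlim
  refine ⟨A, B, E, ?_, fun p₁ hp₁ p₂ hp₂ p₃ hp₃ c hc e₁ e₂ e₃ => ?_⟩
  · refine tendsto_nhds_unique ((hA.add hB).add hE) ?_
    exact tendsto_const_nhds.congr fun n => (sum_branch_measures (hp.measurable _) h.lt).symm
  · have hr : ∀ n, ∃ r ∈ Icc (s n) (t n), meanStress σ P p r = c := fun n =>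
      intermediate_value_Icc (hst n) (hp.continuous_meanStress h).continuousOn
        (by rw [hsc, htc]; exact ⟨hc.1.le, hc.2.le⟩)
    choose r hr hrc using hr
    have hr' : Tendsto r atTop atTop := tendsto_atTop_mono (fun n => (hr n).1) hs'
    have hφ' := hφ.tendsto_atTop
    have hQ := hp.tendsto_dissipation h
    have hI : Tendsto (fun n => ∫ r in (s n)..(t n), dissipation σ P p r) atTop (𝓝 0) := by
      rw [Metric.tendsto_atTop]
      intro δ hδ
      obtain ⟨T, -, hT⟩ := hp.exists_forall_integral_dissipation_le h (half_pos hδ)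
      obtain ⟨N, hN⟩ := eventually_atTop.1 (hs'.eventually_ge_atTop T)
      refine ⟨N, fun n hn => ?_⟩
      rw [dist_zero_right, Real.norm_of_nonneg
        (intervalIntegral.integral_nonneg (hst n) fun r _ => dissipation_nonneg r)]
      linarith [hT _ _ (hN n hn) (hst n)]
    set η := min (c₁ - σ z₂) (σ z₁ - c₂) with hηd
    have hη : 0 < η := lt_min (by linarith) (by linarith)
    have hL : Tendsto (fun n => |(lam (φ n)).1 * p₁ + (lam (φ n)).2.1 * p₂ + (lam (φ n)).2.2 * p₃ - μ|) atTop
        (𝓝 |A * p₁ + B * p₂ + E * p₃ - μ|) :=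
      ((((hA.mul_const p₁).add (hB.mul_const p₂)).add (hE.mul_const p₃)).sub_const μ).abs
    have key : ∀ ε, 0 < ε → |A * p₁ + B * p₂ + E * p₃ - μ| ≤ ε := by
      intro ε hε
      obtain ⟨K, hK, hKb⟩ := hp.exists_abs_weights_sub_le h hη (min_le_left _ _) (min_le_right _ _)
        hp₁ hp₂ hp₃ e₁ e₂ e₃ hε
      have hR : Tendsto (fun n => ε + K * (dissipation σ P p (r n) + dissipation σ P p (s n) +
          ∫ r in (s n)..(t n), dissipation σ P p r)) atTop (𝓝 (ε + K * (0 + 0 + 0))) :=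
        ((((hQ.comp hr').add (hQ.comp hs')).add hI).const_mul K).const_add ε
      rw [add_zero, add_zero, mul_zero, add_zero] at hR
      exact le_of_tendsto_of_tendsto' hL (hR.comp hφ') fun n =>
        hKb (s (φ n)) (t (φ n)) (r (φ n)) (hs1 _) (hr _) (hS _) (hrc _)
    have h0 : |A * p₁ + B * p₂ + E * p₃ - μ| ≤ 0 := le_of_forall_pos_le_add fun ε hε => by simpa using key ε hε
    linarith [abs_nonpos_iff.1 h0]

/-- The mean stress converges. -/
theorem exists_tendsto_meanStress (hp : BoundedFlow σ P μ a b p) (h : CubicShape σ z₁ z₂)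
    (hz₁ : iteratedDeriv 2 σ z₁ ≠ 0) (hz₂ : iteratedDeriv 2 σ z₂ ≠ 0) (hNC3 : NC3 σ z₁ z₂ μ) :
    ∃ c, Tendsto (meanStress σ P p) atTop (𝓝 c) := by
  obtain ⟨C, -, hC⟩ := h.exists_bound (b := b) hp.pos
  have hS := hp.continuous_meanStress h
  have hbd : ∀ t, |meanStress σ P p t| ≤ C := hp.abs_meanStress_le hC
  refine tendsto_of_no_upcrossings dense_univ ?_
    (isBoundedUnder_of ⟨C, fun t => (abs_le.1 (hbd t)).2⟩) (isBoundedUnder_of ⟨-C, fun t => (abs_le.1 (hbd t)).1⟩)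
  rintro u - v - huv ⟨hu, hv⟩
  have hfreq : ∀ c ∈ Ioo u v, ∀ T, ∃ t, T ≤ t ∧ meanStress σ P p t = c := fun c hc T => by
    obtain ⟨s, t, hs, hst, hsc, -⟩ := exists_upcrossing hS hc.1.le hc.2 le_rfl hu hv T
    exact ⟨s, hs, hsc⟩
  -- If `c` and `d` both had a single root, both roots would be `μ`, so that `σ(μ)` would equal both
  -- `c` and `d`.
  have huniq : ∀ c d, u < c → c < d → d < v →
      (∀ e ∈ Icc c d, ∃ q, σ q = e ∧ ∀ y, 0 < y → σ y = e → y = q) → False := by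
    intro c d hc hcd hd H
    obtain ⟨q, hq, hq'⟩ := H c ⟨le_rfl, hcd.le⟩
    obtain ⟨q', hq1, hq1'⟩ := H d ⟨hcd.le, le_rfl⟩
    have e1 := hp.root_eq_of_frequently h hq' (hfreq c ⟨hc, by linarith⟩)
    have e2 := hp.root_eq_of_frequently h hq1' (hfreq d ⟨by linarith, hd⟩)
    rw [← e1] at hq
    rw [← e2] at hq1
    linarith
  have hval := h.value_lt
  -- Either `(u,v)` contains levels above `σ(z₁)` or below `σ(z₂)`, which have a single root, or it
  -- lies between the critical values.
  rcases lt_or_ge (σ z₁) v with hv1 | hv1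
  · have hm : max u (σ z₁) < v := max_lt huv hv1
    have hmu := le_max_left u (σ z₁)
    have hmz := le_max_right u (σ z₁)
    refine huniq (max u (σ z₁) + (v - max u (σ z₁)) / 3) (max u (σ z₁) + 2 * (v - max u (σ z₁)) / 3)
      (by linarith) (by linarith) (by linarith) fun e he => ?_
    have he1 : σ z₁ < e := by linarith [he.1]
    obtain ⟨q, hq, hqe⟩ := h.exists_right (hval.trans he1)
    refine ⟨q, hqe, fun y hy hye => ?_⟩
    have hy2 : z₂ ≤ y := by
      by_contra! hcon
      linarith [h.le_left hy hcon.le]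
    exact h.mono_right.injOn hy2 (mem_Ioi.1 hq).le (hye.trans hqe.symm)
  rcases lt_or_ge u (σ z₂) with hu1 | hu1
  · have hm : u < min v (σ z₂) := lt_min huv hu1
    have hmv := min_le_left v (σ z₂)
    have hmz := min_le_right v (σ z₂)
    refine huniq (u + (min v (σ z₂) - u) / 3) (u + 2 * (min v (σ z₂) - u) / 3)
      (by linarith) (by linarith) (by linarith) fun e he => ?_
    have he1 : e < σ z₂ := by linarith [he.2]
    obtain ⟨q, hq, hqe⟩ := h.exists_left (he1.trans hval)
    refine ⟨q, hqe, fun y hy hye => ?_⟩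
    have hy2 : y ≤ z₁ := by
      by_contra! hcon
      linarith [h.right_le hcon.le]
    exact h.mono_left.injOn ⟨hy, hy2⟩ ⟨hq.1, hq.2.le⟩ (hye.trans hqe.symm)
  -- The middle third of `[u,v]` lies strictly inside the range of critical values, which supplies
  -- the margin `η` of the branch estimate.
  · have hcd : u + (v - u) / 3 < u + 2 * (v - u) / 3 := by linarith
    obtain ⟨A, B, E, hsum, hrel⟩ := hp.exists_weights h (c₁ := u + (v - u) / 3) (c₂ := u + 2 * (v - u) / 3)
      (by linarith) (by linarith)
      fun T => exists_upcrossing hS (by linarith) hcd (by linarith) hu hv T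
    obtain ⟨c, hc, p₁, hp₁, p₂, hp₂, p₃, hp₃, e₁, e₂, e₃, hne⟩ := hNC3
    exact hne (h.mean_roots_eq hz₁ hz₂ hsum (by linarith) hcd (by linarith) hrel p₁ hp₁ p₂ hp₂ p₃ hp₃ c hc e₁ e₂ e₃)

end BoundedFlow

end

/-! ### Pointwise convergence of trajectories -/

section

set_option linter.unusedSectionVars false

variable {Ω : Type*} [MeasurableSpace Ω] {P : Measure Ω} [IsProbabilityMeasure P]

/-- A function whose derivative is negative wherever the function equals `w` stays below `w`. -/
lemma le_of_deriv_neg_at {f f' : ℝ → ℝ} {w t₀ : ℝ} (hf : ∀ t, t₀ ≤ t → HasDerivAt f (f' t) t)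
    (hneg : ∀ t, t₀ ≤ t → f t = w → f' t < 0) (h0 : f t₀ ≤ w) : ∀ t, t₀ ≤ t → f t ≤ w := fun _ ht =>
  image_le_of_deriv_right_lt_deriv_boundary (B := fun _ => w) (B' := fun _ => 0)
    (fun x hx => (hf x hx.1).continuousAt.continuousWithinAt) (fun x hx => (hf x hx.1).hasDerivWithinAt) h0
    (fun x => hasDerivAt_const x w) (fun x hx => hneg x hx.1) ⟨ht, le_rfl⟩

lemma CubicShape.exists_ne {σ : ℝ → ℝ} {z₁ z₂ : ℝ} (h : CubicShape σ z₁ z₂) {u v : ℝ} (hu : 0 < u) (huv : u < v)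
    (c : ℝ) : ∃ w ∈ Ioo u v, σ w ≠ c := by
  by_contra! hcon
  obtain ⟨w, hw, hwz⟩ := (Ioo_infinite huv).exists_notMem_finset {z₁, z₂}
  simp only [Finset.mem_insert, Finset.mem_singleton, not_or] at hwz
  refine h.deriv_ne w (hu.trans hw.1) hwz.1 hwz.2 ?_
  have : σ =ᶠ[𝓝 w] fun _ => c := by
    filter_upwards [Ioo_mem_nhds hw.1 hw.2] with y hy using hcon y hy
  rw [this.deriv_eq, deriv_const]

namespace BoundedFlow

variable {σ : ℝ → ℝ} {z₁ z₂ μ a b : ℝ} {p : Ω → ℝ → ℝ}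

/-- Were `p x` to oscillate across `(u,v)`, pick `w` between with `σ(w) ≠ c`. At late times the
velocity at `w`, namely `S(t) - σ(w)`, has a fixed sign, so `w` can be crossed in one direction
only. -/
lemma exists_tendsto_value (hp : BoundedFlow σ P μ a b p) (h : CubicShape σ z₁ z₂) {c : ℝ}
    (hc : Tendsto (meanStress σ P p) atTop (𝓝 c)) (x : Ω) : ∃ q, Tendsto (p x) atTop (𝓝 q) := by
  refine tendsto_of_no_upcrossings dense_univ ?_
    (isBoundedUnder_of ⟨b, fun t => (hp.mem x t).2⟩) (isBoundedUnder_of ⟨a, fun t => (hp.mem x t).1⟩)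
  rintro u - v - huv ⟨hu, hv⟩
  have hu0 : 0 < u := by
    obtain ⟨t, ht⟩ := hu.exists
    exact (hp.pos_value x t).trans ht
  obtain ⟨w, hw, hwc⟩ := h.exists_ne hu0 huv c
  rcases lt_or_gt_of_ne hwc with h1 | h1
  · obtain ⟨T, hT⟩ := eventually_atTop.1 ((hc.eventually_const_lt h1).and (eventually_gt_atTop 1))
    obtain ⟨t₀, ht₀, h0⟩ := frequently_atTop.1 hv T
    obtain ⟨t₁, ht₁, h2⟩ := frequently_atTop.1 hu t₀
    have := le_of_deriv_neg_at (f := fun t => -p x t) (w := -w)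
      (fun t ht => (hp.deriv x t (hT t (ht₀.trans ht)).2).neg) (fun t ht he => by
        have e : p x t = w := neg_injective he
        have := (hT t (ht₀.trans ht)).1
        rw [meanStress] at this
        rw [e]
        linarith) (by linarith [hw.2]) t₁ ht₁
    linarith [hw.1]
  · obtain ⟨T, hT⟩ := eventually_atTop.1 ((hc.eventually_lt_const h1).and (eventually_gt_atTop 1))
    obtain ⟨t₀, ht₀, h0⟩ := frequently_atTop.1 hu T
    obtain ⟨t₁, ht₁, h2⟩ := frequently_atTop.1 hv t₀
    have := le_of_deriv_neg_at (f := p x) (w := w)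
      (fun t ht => hp.deriv x t (hT t (ht₀.trans ht)).2) (fun t ht he => by
        have := (hT t (ht₀.trans ht)).1
        rw [meanStress] at this
        rw [he]
        linarith) (by linarith [hw.1]) t₁ ht₁
    linarith [hw.2]

/-- Every bounded flow converges pointwise to an equilibrium. -/
theorem exists_equilibrium (hp : BoundedFlow σ P μ a b p) (h : CubicShape σ z₁ z₂)
    (hz₁ : iteratedDeriv 2 σ z₁ ≠ 0) (hz₂ : iteratedDeriv 2 σ z₂ ≠ 0) (hNC3 : NC3 σ z₁ z₂ μ) :
    ∃ q : Ω → ℝ, Measurable q ∧ (∀ x, q x ∈ Icc a b) ∧ (∃ c, ∀ᵐ x ∂P, σ (q x) = c) ∧ ∫ x, q x ∂P = μ ∧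
      ∀ x, Tendsto (p x) atTop (𝓝 (q x)) := by
  obtain ⟨c, hc⟩ := hp.exists_tendsto_meanStress h hz₁ hz₂ hNC3
  choose q hq using hp.exists_tendsto_value h hc
  have hqab : ∀ x, q x ∈ Icc a b := fun x => isClosed_Icc.mem_of_tendsto (hq x) (Eventually.of_forall (hp.mem x))
  have hqm : Measurable q := measurable_of_tendsto_metrizable' atTop hp.measurable (tendsto_pi_nhds.2 hq)
  obtain ⟨C, hC0, hC⟩ := h.exists_bound (b := b) hp.pos
  refine ⟨q, hqm, hqab, ⟨c, ?_⟩, ?_, hq⟩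
  -- The dissipation converges both to `∫ (σ(q) - c)²` and to `0`.
  · have hlim : Tendsto (dissipation σ P p) atTop (𝓝 (∫ x, (σ (q x) - c) ^ 2 ∂P)) := by
      refine tendsto_integral_filter_of_dominated_convergence (fun _ => (2 * C) ^ 2)
        (Eventually.of_forall fun t => ((hp.measurable_defect h t).pow_const 2).aestronglyMeasurable)
        (Eventually.of_forall fun t => Eventually.of_forall fun x => ?_) (integrable_const _)
        (Eventually.of_forall fun x => ?_)
      · rw [norm_pow]
        exact pow_le_pow_left₀ (norm_nonneg _) (hp.abs_defect_le hC x t) 2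
      · exact ((((h.continuousAt (hp.pos.trans_le (hqab x).1)).tendsto.comp (hq x)).sub hc).pow 2)
    have h0 := tendsto_nhds_unique hlim (hp.tendsto_dissipation h)
    have hcC : |c| ≤ C := le_of_tendsto' hc.abs (hp.abs_meanStress_le hC)
    have hi : Integrable (fun x => (σ (q x) - c) ^ 2) P := by
      refine Integrable.of_bound (((h.measurable_comp hp.pos hqm fun x => (hqab x).1).sub_const c).pow_const
        2).aestronglyMeasurable ((2 * C) ^ 2) (Eventually.of_forall fun x => ?_)
      rw [norm_pow]
      refine pow_le_pow_left₀ (norm_nonneg _) ?_ 2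
      rw [Real.norm_eq_abs]
      linarith [abs_sub (σ (q x)) c, hC _ (hqab x)]
    rw [integral_eq_zero_iff_of_nonneg (fun x => sq_nonneg _) hi] at h0
    filter_upwards [h0] with x hx
    have : (σ (q x) - c) ^ 2 = 0 := hx
    linarith [pow_eq_zero_iff (two_ne_zero) |>.1 this]
  · have hlim : Tendsto (fun t => ∫ x, p x t ∂P) atTop (𝓝 (∫ x, q x ∂P)) := by
      refine tendsto_integral_filter_of_dominated_convergence (fun _ => b)
        (Eventually.of_forall fun t => (hp.measurable t).aestronglyMeasurable)
        (Eventually.of_forall fun t => Eventually.of_forall fun x => ?_) (integrable_const _)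
        (Eventually.of_forall hq)
      rw [Real.norm_of_nonneg (hp.pos_value x t).le]
      exact (hp.mem x t).2
    exact tendsto_nhds_unique hlim (by simp only [hp.mass]; exact tendsto_const_nhds)

end BoundedFlow

end

/-! ### Return to `L²(0,1)` -/

section

set_option linter.unusedSectionVars false

variable {Ω : Type*} [MeasurableSpace Ω] {P : Measure Ω} [IsProbabilityMeasure P]

/-- Convergence in `L²(0,1)` in terms of representatives. -/
lemma tendsto_of_tendsto_integral_sq {ι : Type*} {F : Filter ι} {u : ι → L2} {f : L2} {p : ι → ℝ → ℝ}
    {q : ℝ → ℝ} (hp : ∀ᶠ i in F, p i =ᵐ[unitMeasure] u i) (hq : q =ᵐ[unitMeasure] f)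
    (h : Tendsto (fun i => ∫ x, (p i x - q x) ^ 2 ∂unitMeasure) F (𝓝 0)) : Tendsto u F (𝓝 f) := by
  rw [tendsto_iff_norm_sub_tendsto_zero]
  have h1 : Tendsto (fun i => ‖u i - f‖ ^ 2) F (𝓝 0) := h.congr' (by
    filter_upwards [hp] with i hi using (norm_sub_sq_eq_integral hi hq).symm)
  have h2 := h1.sqrt
  rw [Real.sqrt_zero] at h2
  exact h2.congr fun i => Real.sqrt_sq (norm_nonneg _)

lemma tendsto_integral_sub_sq {ι : Type*} {F : Filter ι} [F.IsCountablyGenerated] {p : ι → Ω → ℝ} {q : Ω → ℝ}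
    {a b : ℝ} (hm : ∀ᶠ i in F, Measurable (p i)) (hqm : Measurable q) (hp : ∀ᶠ i in F, ∀ x, p i x ∈ Icc a b)
    (hq : ∀ x, q x ∈ Icc a b) (h : ∀ x, Tendsto (fun i => p i x) F (𝓝 (q x))) :
    Tendsto (fun i => ∫ x, (p i x - q x) ^ 2 ∂P) F (𝓝 0) := by
  have := tendsto_integral_filter_of_dominated_convergence (μ := P) (l := F) (F := fun i x => (p i x - q x) ^ 2)
    (f := fun _ => 0) (fun _ => (b - a) ^ 2)
    (by filter_upwards [hm] with i hi using ((hi.sub hqm).pow_const 2).aestronglyMeasurable)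
    (by
      filter_upwards [hp] with i hi
      refine Eventually.of_forall fun x => ?_
      rw [norm_pow]
      refine pow_le_pow_left₀ (norm_nonneg _) ?_ 2
      rw [Real.norm_eq_abs, abs_le]
      constructor <;> linarith [(hi x).1, (hi x).2, (hq x).1, (hq x).2])
    (integrable_const _)
    (Eventually.of_forall fun x => by simpa using ((h x).sub_const (q x)).pow 2)
  simpa using this

namespace RegularFlow

variable {σ : ℝ → ℝ} {z₁ z₂ μ : ℝ} {p : Ω → ℝ → ℝ}

/-- Freezing time before `τ` confines the values to one compact interval for all real `t`; since `τ
≤ 1`, the equation survives for `t > 1`. -/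
lemma boundedFlow (hp : RegularFlow σ P μ p) {τ : ℝ} (hτ : 0 < τ) (hτ1 : τ ≤ 1) :
    ∃ a b, BoundedFlow σ P μ a b fun x t => p x (max t τ) := by
  obtain ⟨a, b, ha, hab⟩ := hp.bounds τ hτ
  have hpos : ∀ t, 0 < max t τ := fun t => hτ.trans_le (le_max_right _ _)
  refine ⟨a, b, ha, fun t => hp.measurable _ (hpos t), fun x => ?_, fun x t => hab x _ (le_max_right _ _),
    fun t => hp.mass _ (hpos t), fun x t ht => ?_⟩
  · rw [continuous_iff_continuousAt]
    intro t
    exact ContinuousAt.comp (f := fun t => max t τ) (hp.deriv x _ (hpos t)).continuousAt (by fun_prop)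
  · have e : max t τ = t := max_eq_left (hτ1.trans ht.le)
    have e' : (fun t => p x (max t τ)) =ᶠ[𝓝 t] p x := by
      filter_upwards [Ioi_mem_nhds ht] with r hr
      rw [max_eq_left (hτ1.trans (le_of_lt hr))]
    simp only [e]
    exact (hp.deriv x t (one_pos.trans ht)).congr_of_eventuallyEq e'

lemma exists_curve {p : ℝ → ℝ → ℝ} (hp : RegularFlow σ unitMeasure μ p) (p₀ : L2) :
    ∃ u : ℝ≥0 → L2, u 0 = p₀ ∧ ∀ t : ℝ≥0, 0 < t → (fun x => p x t) =ᵐ[unitMeasure] u t := by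
  have : ∀ t : ℝ≥0, ∃ f : L2, (t = 0 → f = p₀) ∧ (0 < t → (fun x => p x t) =ᵐ[unitMeasure] f) := by
    intro t
    rcases eq_or_ne t 0 with ht | ht
    · exact ⟨p₀, fun _ => rfl, fun h => absurd ht h.ne'⟩
    · have ht0 : 0 < (t:ℝ) := NNReal.coe_pos.2 (pos_iff_ne_zero.2 ht)
      obtain ⟨a, b, ha, hab⟩ := hp.bounds t ht0
      have hL : MemLp (fun x => p x t) 2 unitMeasure :=
        MemLp.of_bound (hp.measurable t ht0).aestronglyMeasurable b (Eventually.of_forall fun x => by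
          rw [Real.norm_of_nonneg (ha.le.trans (hab x t le_rfl).1)]
          exact (hab x t le_rfl).2)
      exact ⟨hL.toLp, fun h => absurd h ht, fun _ => hL.coeFn_toLp.symm⟩
  choose u hu using this
  exact ⟨u, (hu 0).1 rfl, fun t => (hu t).2⟩

lemma continuous_curve {p : ℝ → ℝ → ℝ} (hp : RegularFlow σ unitMeasure μ p) {g : ℝ → ℝ} {u : ℝ≥0 → L2}
    (hg : g =ᵐ[unitMeasure] u 0) (hu : ∀ t : ℝ≥0, 0 < t → (fun x => p x t) =ᵐ[unitMeasure] u t)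
    (h0 : Tendsto (fun t => ∫ x, (p x t - g x) ^ 2 ∂unitMeasure) (𝓝[>] 0) (𝓝 0)) : Continuous u := by
  rw [continuous_iff_continuousAt]
  intro t
  rcases eq_or_ne t 0 with rfl | ht
  · rw [← continuousWithinAt_compl_self]
    have hco : Tendsto (fun t : ℝ≥0 => (t:ℝ)) (𝓝[{0}ᶜ] 0) (𝓝[>] 0) := by
      refine tendsto_nhdsWithin_iff.2 ⟨(NNReal.continuous_coe.tendsto 0).mono_left nhdsWithin_le_nhds, ?_⟩
      filter_upwards [self_mem_nhdsWithin] with t ht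
      exact NNReal.coe_pos.2 (pos_iff_ne_zero.2 (show t ≠ 0 from ht))
    refine tendsto_of_tendsto_integral_sq (p := fun t x => p x t) ?_ hg (h0.comp hco)
    filter_upwards [self_mem_nhdsWithin] with t ht using hu t (pos_iff_ne_zero.2 ht)
  · have ht0 : 0 < t := pos_iff_ne_zero.2 ht
    have ht0' : 0 < (t:ℝ) := NNReal.coe_pos.2 ht0
    obtain ⟨a, b, ha, hab⟩ := hp.bounds (t / 2) (half_pos ht0')
    have hev : ∀ᶠ s : ℝ≥0 in 𝓝 t, (t:ℝ) / 2 < s :=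
      NNReal.continuous_coe.continuousAt.eventually_const_lt (half_lt_self ht0')
    refine tendsto_of_tendsto_integral_sq (p := fun t x => p x t) ?_ (hu t ht0)
      (tendsto_integral_sub_sq (a := a) (b := b) ?_ (hp.measurable t ht0') ?_
        (fun x => hab x t (half_le_self ht0'.le)) fun x => ?_)
    · filter_upwards [lt_mem_nhds ht0] with s hs using hu s hs
    · filter_upwards [lt_mem_nhds ht0] with s hs using hp.measurable s (NNReal.coe_pos.2 hs)
    · filter_upwards [hev] with s hs x using hab x s hs.le
    · exact (hp.deriv x t ht0').continuousAt.tendsto.comp (NNReal.continuous_coe.tendsto t)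

/-- A regular flow extended by its initial datum. -/
noncomputable def extend (g : Ω → ℝ) (p : Ω → ℝ → ℝ) (x : Ω) (t : ℝ) : ℝ := if 0 < t then p x t else g x

lemma extend_of_pos {g : Ω → ℝ} (x : Ω) {t : ℝ} (ht : 0 < t) : extend g p x t = p x t := if_pos ht

/-- Freezing time before `1/(n+1)` gives functions continuous in `t` and measurable in `x`, hence
jointly measurable. At each point these approximations are eventually equal to the extended flow. -/
lemma measurable_extend (hp : RegularFlow σ P μ p) {g : Ω → ℝ} (hg : Measurable g) :
    Measurable fun z : Ω × ℝ => extend g p z.1 z.2 := by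
  have hn : ∀ n : ℕ, 0 < 1 / ((n:ℝ) + 1) := fun n => Nat.one_div_pos_of_nat
  refine measurable_of_tendsto_metrizable
    (f := fun (n : ℕ) (z : Ω × ℝ) => if 0 < z.2 then p z.1 (max z.2 (1 / ((n:ℝ) + 1))) else g z.1) (fun n => ?_) ?_
  · obtain ⟨a, b, hb⟩ := hp.boundedFlow (hn n) (by
      rw [div_le_one (by positivity)]
      linarith [(n.cast_nonneg : (0:ℝ) ≤ n)])
    have hm : Measurable (Function.uncurry fun t x => p x (max t (1 / ((n:ℝ) + 1)))) :=
      measurable_uncurry_of_continuous_of_measurable hb.continuous hb.measurable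
    exact Measurable.ite (measurableSet_lt measurable_const measurable_snd) (hm.comp measurable_swap)
      (hg.comp measurable_fst)
  · rw [tendsto_pi_nhds]
    rintro ⟨x, t⟩
    refine tendsto_const_nhds.congr' ?_
    by_cases ht : 0 < t
    · filter_upwards [tendsto_one_div_add_atTop_nhds_zero_nat.eventually_lt_const ht] with n h
      simp only [extend, if_pos ht]
      rw [max_eq_left h.le]
    · exact Eventually.of_forall fun n => by simp only [extend, if_neg ht]

lemma stressDefect_extend {p : ℝ → ℝ → ℝ} {g : ℝ → ℝ} (x : ℝ) {t : ℝ} (ht : 0 < t) :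
    stressDefect σ (extend g p) x t = σ (p x t) - ∫ y, σ (p y t) ∂unitMeasure := by
  simp only [stressDefect, extend_of_pos _ ht]

lemma continuousOn_stressDefect {p : ℝ → ℝ → ℝ} (hp : RegularFlow σ unitMeasure μ p) (h : CubicShape σ z₁ z₂)
    (g : ℝ → ℝ) (x : ℝ) {τ : ℝ} (hτ : 0 < τ) : ContinuousOn (stressDefect σ (extend g p) x) (Ici τ) := by
  obtain ⟨a, b, hb⟩ := hp.boundedFlow (lt_min hτ one_pos) (min_le_right _ _)
  refine (hb.continuous_defect h x).continuousOn.congr fun t ht => ?_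
  rw [stressDefect_extend x (hτ.trans_le ht), defect, meanStress,
    max_eq_left ((min_le_left _ _).trans ht)]

/-- A regular flow that attains its initial datum is a solution. -/
theorem isSolution {p : ℝ → ℝ → ℝ} (hp : RegularFlow σ unitMeasure μ p) (h : CubicShape σ z₁ z₂) {p₀ : L2}
    {g : ℝ → ℝ} {u : ℝ≥0 → L2} (hgm : Measurable g) (hg : g =ᵐ[unitMeasure] u 0) (hu0 : u 0 = p₀)
    (hu : ∀ t : ℝ≥0, 0 < t → (fun x => p x t) =ᵐ[unitMeasure] u t)
    (h0 : Tendsto (fun t => ∫ x, (p x t - g x) ^ 2 ∂unitMeasure) (𝓝[>] 0) (𝓝 0))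
    (hmass : ∫ x, p₀ x ∂unitMeasure = μ) : IsSolution σ μ p₀ u := by
  intro T hT
  have hpos : ∀ᵐ t ∂(volume.restrict (Icc 0 (T:ℝ))), 0 < t := by
    rw [← Measure.restrict_congr_set Ioc_ae_eq_Icc]
    filter_upwards [self_mem_ae_restrict measurableSet_Ioc] with t ht using ht.1
  refine ⟨(hp.continuous_curve hg hu h0).continuousOn, hu0, fun t _ => ?_, extend g p, fun t _ => ?_,
    (hp.measurable_extend hgm).aestronglyMeasurable, ?_, ?_, ?_, ?_⟩
  · rcases eq_or_ne t 0 with rfl | ht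
    · rw [hu0, hmass]
    · have ht0 := pos_iff_ne_zero.2 ht
      rw [← hp.mass t (NNReal.coe_pos.2 ht0)]
      exact (integral_congr_ae (hu t ht0)).symm
  · rcases eq_or_ne t 0 with rfl | ht
    · filter_upwards [hg] with x hx
      simpa [extend] using hx
    · have ht0 := pos_iff_ne_zero.2 ht
      filter_upwards [hu t ht0] with x hx
      rw [extend_of_pos x (NNReal.coe_pos.2 ht0), hx]
  · filter_upwards [Measure.quasiMeasurePreserving_snd.ae hpos] with z hz
    obtain ⟨a, b, ha, hab⟩ := hp.bounds z.2 hz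
    rw [extend_of_pos _ hz]
    exact ha.trans_le (hab _ _ le_rfl).1
  · filter_upwards [hpos] with t ht
    obtain ⟨a, b, hb⟩ := hp.boundedFlow (lt_min ht one_pos) (min_le_right _ _)
    have := hb.integrable_stress h t
    simp only [extend_of_pos _ ht]
    rwa [max_eq_left (min_le_left _ _)] at this
  · refine Eventually.of_forall fun x τ hτ => ?_
    exact (((hp.continuousOn_stressDefect h g x hτ).mono Icc_subset_Ici_self).integrableOn_Icc
      (b := (T:ℝ))).mono_set Ioo_subset_Icc_self
  · refine Eventually.of_forall fun x s hs t ht => ?_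
    have hm : 0 < min s t := lt_min hs.1 ht.1
    rw [extend_of_pos x ht.1, extend_of_pos x hs.1]
    have hd : ∀ r ∈ uIcc s t, HasDerivAt (p x) (-stressDefect σ (extend g p) x r) r := fun r hr => by
      rw [stressDefect_extend x (hm.trans_le hr.1)]
      exact hp.deriv x r (hm.trans_le hr.1)
    have hi : IntervalIntegrable (fun r => -stressDefect σ (extend g p) x r) volume s t :=
      ((hp.continuousOn_stressDefect h g x hm).mono Icc_subset_Ici_self).neg.intervalIntegrable
    have := intervalIntegral.integral_eq_sub_of_hasDerivAt hd hi
    rw [intervalIntegral.integral_neg] at this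
    linarith

/-- A regular flow converges to an equilibrium in `L²(0,1)`. -/
theorem exists_tendsto_equilibrium {p : ℝ → ℝ → ℝ} (hp : RegularFlow σ unitMeasure μ p) (h : CubicShape σ z₁ z₂)
    (hz₁ : iteratedDeriv 2 σ z₁ ≠ 0) (hz₂ : iteratedDeriv 2 σ z₂ ≠ 0) (hNC3 : NC3 σ z₁ z₂ μ) {u : ℝ≥0 → L2}
    (hu : ∀ t : ℝ≥0, 0 < t → (fun x => p x t) =ᵐ[unitMeasure] u t) :
    ∃ pbar ∈ equilibria σ μ, Tendsto u atTop (𝓝 pbar) := by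
  obtain ⟨a, b, hb⟩ := hp.boundedFlow one_pos le_rfl
  obtain ⟨q, hqm, hqab, ⟨c, hqc⟩, hqμ, hq⟩ := hb.exists_equilibrium h hz₁ hz₂ hNC3
  have hL : MemLp q 2 unitMeasure := MemLp.of_bound hqm.aestronglyMeasurable b (Eventually.of_forall fun x => by
    rw [Real.norm_of_nonneg (hb.pos.le.trans (hqab x).1)]
    exact (hqab x).2)
  have hae := hL.coeFn_toLp
  refine ⟨hL.toLp, ⟨?_, ⟨c, ?_⟩, ?_⟩, ?_⟩
  · filter_upwards [hae] with x hx
    rw [hx]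
    exact hb.pos.trans_le (hqab x).1
  · filter_upwards [hae, hqc] with x hx hxc
    rw [hx, hxc]
  · rw [integral_congr_ae hae, hqμ]
  · have hco : Tendsto (fun t : ℝ≥0 => (t:ℝ)) atTop atTop := NNReal.tendsto_coe_atTop.2 tendsto_id
    refine tendsto_of_tendsto_integral_sq (p := fun t x => p x (max t 1)) ?_ hae.symm
      (tendsto_integral_sub_sq (a := a) (b := b) (Eventually.of_forall fun t => hb.measurable t) hqm
        (Eventually.of_forall fun t x => hb.mem x t) hqab fun x => (hq x).comp hco)
    filter_upwards [eventually_ge_atTop 1] with t ht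
    have ht' : (1:ℝ) ≤ t := by exact_mod_cast ht
    rw [max_eq_left ht']
    exact hu t (one_pos.trans_le ht)

end RegularFlow

end

end Viscoelastic

theorem mainTheorem3 (σ : ℝ → ℝ) (μ : ℝ) (hμ : 0 < μ)
    (hσ : Viscoelastic.StandingAssumptions σ)
    (hC1 : AnalyticOnNhd ℝ σ (Ioi 0))
    (z₁ z₂ : ℝ) (hC2 : Viscoelastic.IsCubicLike σ z₁ z₂)
    (hNC3 : Viscoelastic.NC3 σ z₁ z₂ μ) :
    ∀ p₀ ∈ Viscoelastic.phaseSpace μ,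
      (∃! u : ℝ≥0 → Viscoelastic.L2, Viscoelastic.IsSolution σ μ p₀ u) ∧
      ∀ u : ℝ≥0 → Viscoelastic.L2, Viscoelastic.IsSolution σ μ p₀ u →
        ∃ pbar ∈ Viscoelastic.equilibria σ μ, Tendsto u atTop (𝓝 pbar) := by
  have h := Viscoelastic.cubicShape_of hσ hC1 hC2
  intro p₀ hp₀
  obtain ⟨hnn, hmass⟩ := hp₀
  obtain ⟨m, -, hint⟩ := hσ.integrable_top
  -- The approximation scheme needs a datum that is measurable and nonnegative everywhere; the
  -- positive part of `p₀` is such a representative.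
  have hgm : Measurable fun x => max (p₀ x) 0 := (Lp.stronglyMeasurable p₀).measurable.max measurable_const
  have hg : (fun x => max (p₀ x) 0) =ᵐ[Viscoelastic.unitMeasure] p₀ := by
    filter_upwards [hnn] with x hx using max_eq_left hx
  obtain ⟨p, hp, h0⟩ := Viscoelastic.exists_regularFlow (P := Viscoelastic.unitMeasure) h hint hgm
    (fun x => le_max_right _ _)
    ((Viscoelastic.integrable_sq_coe p₀).congr (hg.mono fun x hx => congrArg (· ^ 2) hx.symm)) hμ
    ((integral_congr_ae hg).trans hmass)
  obtain ⟨u, hu0, hu⟩ := hp.exists_curve p₀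
  have hsol : Viscoelastic.IsSolution σ μ p₀ u := hp.isSolution h hgm (by rwa [hu0]) hu0 hu h0 hmass
  refine ⟨⟨u, hsol, fun v hv => Viscoelastic.IsSolution.unique h hμ hv hsol⟩, fun v hv => ?_⟩
  rw [Viscoelastic.IsSolution.unique h hμ hv hsol]
  exact hp.exists_tendsto_equilibrium h hC2.nondegenerate₁ hC2.nondegenerate₂ hNC3 hu
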